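/- **Setting.** Work on the line $\mathbb R$ or on the circle $\mathbb T=\mathbb R/\mathbb Z$, with $\hat f(\xi)=(2\pi)^{-1/2}\int_{\mathbb R} e^{-i\xi x}f(x)\,dx$, respectively $\hat f(\xi)=\int_0^1e^{-i\xi x}f(x)\,dx$ for $\xi\in2\pi\mathbb Z$. For $\sigma\in\mathbb R$ and $\kappa\ge1$ let $$\|f\|_{H^\sigma_\kappa}^2=\int(|\xi|+\kappa)^{2\sigma}|\hat f(\xi)|^2\,d\xi$$ (a sum over $2\pi\mathbb Z$ on the circle), $H^\sigma=H^\sigma_1$. Let $H^\sigma_+$ and $L^2_+$ be the subspaces of $H^\sigma$ and $L^2$ of elements whose Fourier transform is supported on $[0,\infty)$. Let $\langle g,f\rangle=\int\bar g f\,dx$, extended to a duality pairing of $H^{-\sigma}$ and $H^{\sigma}$, and let $\mathcal L_0=-i\partial_x$ on $L^2_+$, with domain $H^1_+$ and resolvent $R_0(\kappa)=(\mathcal L_0+\kappa)^{-1}$. **Proposition 3.2.** Fix $s\in(-\tfrac12,0)$ and put $\varepsilon=\tfrac12(\tfrac12-|s|)$. In each of the two geometries there are constants $C_s\ge1$ and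 $K>0$, depending only on $s$, such that the following holds for every real-valued $q\in H^s$. 1. The quadratic form $f\mapsto\langle f,\mathcal L_0f\rangle-\int q|f|^2\,dx$ is well defined on $H^{1/2}_+$ (that is, $\int|\xi||\hat f(\xi)|^2d\xi<\infty$ and the integral $\int q|f|^2\,dx=\int\hat q(-\xi)\widehat{|f|^2}(\xi)\,d\xi$ converges absolutely), and there is a unique selfadjoint operator $\mathcal L$ on $L^2_+$, bounded below, whose associated closed quadratic form is this form with form domain $H^{1/2}_+$. 2. The extension of $\mathcal L$ to the form domain $H^{1/2}_+$ maps $H^{s+1}_+$ into $H^s_+$, and $\|\mathcal Lf\|_{H^s}\le K\,[1+\|q\|_{H^s}]\,\|f\|_{H^{s+1}}$ for all $f\in H^{s+1}_+$. 3. If $\kappa\ge C_s(1+\|q\|_{H^s_\kappa})^{1/(2\varepsilon)}$, then $-\kappa$ lies in the resolvent set of $\mathcal L$, the resolvent $R(\kappa)=(\mathcal L+\kappa)^{-1}$ extends to a bounded map from $H^{-1/2}_+$ into $H^{1/2}_+$, and for all $f\in H^s_+$ $$\|R(\kappa)f\|_{H^{s+1}_\kappa}\le K\|f\|_{H^s_\kappa},\qquad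 \|[R(\kappa)-R_0(\kappa)]f\|_{H^{s+1}_\kappa}\le K\kappa^{-2\varepsilon}\|q\|_{H^s_\kappa}\|f\|_{H^s_\kappa}.$$ 4. $\sigma_{\rm ess}(\mathcal L)=\sigma_{\rm ess}(\mathcal L_0)$, where the essential spectrum is the spectrum with the isolated eigenvalues of finite multiplicity removed. 5. For every $f\in H^s_+$ the function $z\mapsto\langle f,(\mathcal L+z)^{-1}f\rangle$ is well defined and analytic on $\{z:-z\notin\sigma(\mathcal L)\}$ and extends to a meromorphic function on $\{z:-z\in\mathbb C\setminus\sigma_{\rm ess}(\mathcal L)\}$. Here $(\mathcal L+z)^{-1}f\in H^{1/2}_+$ denotes the unique solution $u \in H^{1/2}_+$ of $(\mathcal L+z)u=f$, where $\mathcal L$ is extended to its form domain. -/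

import Mathlib

open MeasureTheory Filter Topology Set
open scoped SchwartzMap FourierTransform InnerProductSpace ENNReal

noncomputable section

namespace BenjaminOno

/-- The two geometries: the line `ℝ` and the circle `𝕋 = ℝ / ℤ`. -/
inductive Geometry
  | line
  | circle

/-- The measure on position space: Lebesgue measure on `ℝ` for the line; for the circle `ℝ / ℤ`,
Lebesgue measure on the fundamental domain `(0, 1]`. -/
def posMeasure : Geometry → Measure ℝ
  | .line => volume
  | .circle => volume.restrict (Ioc 0 1)

/-- The measure on frequency space: Lebesgue measure on `ℝ` for the line, counting measure on
`2πℤ` for the circle. -/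
def freqMeasure : Geometry → Measure ℝ
  | .line => volume
  | .circle => Measure.sum fun n : ℤ => Measure.dirac (2 * Real.pi * (n : ℝ))

/-- The constant in front of the Fourier integral (and of the inversion formula):
`1 / √(2π)` on the line and `1` on the circle. -/
def fourierConst : Geometry → ℝ
  | .line => (Real.sqrt (2 * Real.pi))⁻¹
  | .circle => 1

/-- The Fourier transform of an absolutely integrable function, `c ∫ e^{-iξx} g(x) dx`, with the
integral over `ℝ` or over `[0, 1]`, and with `c = 1/√(2π)` or `c = 1`. -/
def fourierL1 (G : Geometry) (g : ℝ → ℂ) (ξ : ℝ) : ℂ :=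
  (fourierConst G : ℂ) * ∫ x, Complex.exp (-(Complex.I * ξ * x)) * g x ∂(posMeasure G)

/-- The Fourier transform of a square integrable function.  On the circle this is given by the
integral.  On the line it is Mathlib's `L²` Fourier transform, the continuous extension of
`𝓕 f (w) = ∫ e^{-2πixw} f(x) dx`, rescaled to the convention
`\hat f(ξ) = (2π)^{-1/2} ∫ e^{-iξx} f(x) dx`. -/
def fourierL2 : (G : Geometry) → Lp ℂ 2 (posMeasure G) → ℝ → ℂ
  | .line, f => fun ξ =>
      (fourierConst .line : ℂ) * (𝓕 (show Lp ℂ 2 (volume : Measure ℝ) from f) :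
        Lp ℂ 2 (volume : Measure ℝ)) (ξ / (2 * Real.pi))
  | .circle, f => fourierL1 .circle f

lemma ae_freqMeasure_circle {p : ℝ → Prop} :
    (∀ᵐ ξ ∂(freqMeasure .circle), p ξ) ↔ ∀ n : ℤ, p (2 * Real.pi * (n : ℝ)) := by
  simp only [freqMeasure]
  rw [Measure.ae_sum_iff]
  simp [ae_dirac_eq]

lemma quasi_div : Measure.QuasiMeasurePreserving (fun ξ : ℝ => ξ / (2 * Real.pi))
    volume volume := by
  have h := Measure.quasiMeasurePreserving_smul (E := ℝ) volume
    (r := (2 * Real.pi)⁻¹) (by positivity)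
  convert h using 2 with ξ
  simp [div_eq_inv_mul]

lemma quasi_mul : Measure.QuasiMeasurePreserving (fun ξ : ℝ => 2 * Real.pi * ξ)
    volume volume := by
  have h := Measure.quasiMeasurePreserving_smul (E := ℝ) volume
    (r := (2 * Real.pi)) (by positivity)
  exact h

lemma integrable_char_mul (ξ : ℝ) (f : Lp ℂ 2 (posMeasure .circle)) :
    Integrable (fun x : ℝ => Complex.exp (-(Complex.I * ξ * x)) * f x) (posMeasure .circle) := by
  have : IsFiniteMeasure (posMeasure .circle) := by
    simp only [posMeasure]; infer_instance
  have hf : Integrable (f : ℝ → ℂ) (posMeasure .circle) :=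
    (Lp.memLp f).integrable (by norm_num)
  refine hf.bdd_mul (c := 1) ?_ ?_
  · exact (by fun_prop : Continuous fun x : ℝ =>
      Complex.exp (-(Complex.I * ξ * x))).aestronglyMeasurable
  · refine Eventually.of_forall fun x => ?_
    rw [Complex.norm_exp]
    simp

lemma fourierL2_line (f : Lp ℂ 2 (volume : Measure ℝ)) (ξ : ℝ) :
    fourierL2 .line f ξ = (fourierConst .line : ℂ) *
      (𝓕 f : Lp ℂ 2 (volume : Measure ℝ)) (ξ / (2 * Real.pi)) := rfl

lemma fourierL2_add_line (f g : Lp ℂ 2 (volume : Measure ℝ)) :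
    ∀ᵐ ξ ∂(volume : Measure ℝ),
      fourierL2 .line (f + g) ξ = fourierL2 .line f ξ + fourierL2 .line g ξ := by
  have h : (𝓕 (f + g) : Lp ℂ 2 (volume : Measure ℝ)) = 𝓕 f + 𝓕 g :=
    FourierTransform.fourier_add _ _
  have h2 := quasi_div.ae (Lp.coeFn_add (𝓕 f) (𝓕 g))
  filter_upwards [h2] with ξ hξ
  rw [fourierL2_line, h, hξ, fourierL2_line, fourierL2_line, Pi.add_apply, mul_add]

lemma fourierL2_smul_line (c : ℂ) (f : Lp ℂ 2 (volume : Measure ℝ)) :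
    ∀ᵐ ξ ∂(volume : Measure ℝ), fourierL2 .line (c • f) ξ = c * fourierL2 .line f ξ := by
  have h : (𝓕 (c • f) : Lp ℂ 2 (volume : Measure ℝ)) = c • 𝓕 f :=
    FourierTransform.fourier_smul _ _
  have h2 := quasi_div.ae (Lp.coeFn_smul c (𝓕 f))
  filter_upwards [h2] with ξ hξ
  rw [fourierL2_line, h, hξ, fourierL2_line, Pi.smul_apply, smul_eq_mul, mul_left_comm]

lemma fourierL2_add (G : Geometry) (f g : Lp ℂ 2 (posMeasure G)) :
    fourierL2 G (f + g) =ᵐ[freqMeasure G] fun ξ => fourierL2 G f ξ + fourierL2 G g ξ := by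
  cases G with
  | line =>
    exact fourierL2_add_line f g
  | circle =>
    refine ae_freqMeasure_circle.2 fun n => ?_
    simp only [fourierL2, fourierL1]
    rw [← mul_add, ← integral_add (μ := posMeasure .circle) (integrable_char_mul (2 * Real.pi * (n : ℝ)) f)
      (integrable_char_mul (2 * Real.pi * (n : ℝ)) g)]
    congr 1
    refine integral_congr_ae ?_
    filter_upwards [Lp.coeFn_add f g] with x hx
    rw [hx]
    simp [mul_add]

lemma fourierL2_smul (G : Geometry) (c : ℂ) (f : Lp ℂ 2 (posMeasure G)) :
    fourierL2 G (c • f) =ᵐ[freqMeasure G] fun ξ => c * fourierL2 G f ξ := by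
  cases G with
  | line =>
    exact fourierL2_smul_line c f
  | circle =>
    refine ae_freqMeasure_circle.2 fun n => ?_
    simp only [fourierL2, fourierL1]
    rw [mul_left_comm c, ← integral_const_mul c]
    refine congrArg _ (integral_congr_ae ?_)
    filter_upwards [Lp.coeFn_smul c f] with x hx
    rw [hx]
    simp [mul_left_comm]

/-- The Hardy space `L²_+`: square integrable functions whose Fourier transform is supported on
`[0, ∞)`.  It carries the inner product `⟪g, f⟫ = ∫ \bar g f dx` of `L²`. -/
def L2Plus (G : Geometry) : Submodule ℂ (Lp ℂ 2 (posMeasure G)) where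
  carrier := {f | ∀ᵐ ξ ∂(freqMeasure G), ξ < 0 → fourierL2 G f ξ = 0}
  add_mem' {f g} hf hg := by
    filter_upwards [hf, hg, fourierL2_add G f g] with ξ h1 h2 h3 hξ
    rw [h3, h1 hξ, h2 hξ, add_zero]
  zero_mem' := by
    have h := fourierL2_smul G 0 0
    rw [zero_smul] at h
    filter_upwards [h] with ξ h1 _
    rw [h1, zero_mul]
  smul_mem' c f hf := by
    filter_upwards [hf, fourierL2_smul G c f] with ξ h1 h2 hξ
    rw [h2, h1 hξ, mul_zero]

lemma continuous_fourierL1_circle (ξ : ℝ) :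
    Continuous fun f : Lp ℂ 2 (posMeasure .circle) => fourierL1 .circle f ξ := by
  have : IsFiniteMeasure (posMeasure .circle) := by
    simp only [posMeasure]; infer_instance
  have he : MemLp (fun x : ℝ => Complex.exp (Complex.I * ξ * x)) 2 (posMeasure .circle) := by
    refine MemLp.of_bound (by fun_prop) 1 (Eventually.of_forall fun x => ?_)
    rw [Complex.norm_exp]
    simp
  have h : ∀ f : Lp ℂ 2 (posMeasure .circle),
      fourierL1 .circle f ξ = (fourierConst .circle : ℂ) * ⟪he.toLp, f⟫_ℂ := by
    intro f
    rw [L2.inner_def, fourierL1]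
    congr 1
    refine integral_congr_ae ?_
    filter_upwards [he.coeFn_toLp] with x hx
    rw [hx, RCLike.inner_apply, ← Complex.exp_conj, mul_comm]
    congr 2
    simp
  simp_rw [h]
  fun_prop

lemma fourierConst_ne (G : Geometry) : (fourierConst G : ℂ) ≠ 0 := by
  cases G
  · rw [fourierConst, Complex.ofReal_ne_zero]
    positivity
  · simp [fourierConst]

lemma mem_L2Plus_line (f : Lp ℂ 2 (volume : Measure ℝ)) :
    (∀ᵐ ξ ∂(volume : Measure ℝ), ξ < 0 → fourierL2 .line f ξ = 0) ↔
      LpToLpRestrictCLM ℝ ℂ ℂ volume 2 (Iio 0) (𝓕 f : Lp ℂ 2 (volume : Measure ℝ)) = 0 := by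
  have h1 : (∀ᵐ ξ ∂(volume : Measure ℝ), ξ < 0 → fourierL2 .line f ξ = 0) ↔
      ∀ᵐ ξ ∂(volume : Measure ℝ), ξ ∈ Iio (0 : ℝ) → (𝓕 f : Lp ℂ 2 (volume : Measure ℝ)) ξ = 0 := by
    simp only [fourierL2_line, mul_eq_zero, fourierConst_ne, false_or, mem_Iio]
    constructor
    · intro h
      filter_upwards [quasi_mul.ae h] with ξ hξ hneg
      have h3 := hξ (by have := Real.pi_pos; nlinarith)
      rwa [mul_div_cancel_left₀ _ (by positivity)] at h3
    · intro h
      filter_upwards [quasi_div.ae h] with ξ hξ hneg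
      exact hξ (div_neg_of_neg_of_pos hneg (by positivity))
  rw [h1, Lp.eq_zero_iff_ae_eq_zero, ← ae_restrict_iff' measurableSet_Iio]
  have h2 := LpToLpRestrictCLM_coeFn (p := 2) (μ := (volume : Measure ℝ)) ℂ (Iio (0 : ℝ))
    (𝓕 f : Lp ℂ 2 (volume : Measure ℝ))
  constructor
  · intro h
    filter_upwards [h, h2] with ξ a b
    exact b.trans a
  · intro h
    filter_upwards [h, h2] with ξ a b
    exact b.symm.trans a

lemma isClosed_L2Plus_line :
    IsClosed {f : Lp ℂ 2 (volume : Measure ℝ) |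
      ∀ᵐ ξ ∂(volume : Measure ℝ), ξ < 0 → fourierL2 .line f ξ = 0} := by
  simp only [mem_L2Plus_line]
  exact isClosed_eq ((LpToLpRestrictCLM ℝ ℂ ℂ volume 2 (Iio 0)).continuous.comp
    (Lp.fourierTransformₗᵢ ℝ ℂ).continuous) continuous_const

lemma isClosed_L2Plus (G : Geometry) : IsClosed (L2Plus G : Set (Lp ℂ 2 (posMeasure G))) := by
  cases G with
  | line => exact isClosed_L2Plus_line
  | circle =>
    have h : (L2Plus .circle : Set (Lp ℂ 2 (posMeasure .circle))) =
        ⋂ n : ℤ, {f : Lp ℂ 2 (posMeasure .circle) | 2 * Real.pi * (n : ℝ) < 0 →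
          fourierL1 .circle f (2 * Real.pi * (n : ℝ)) = 0} := by
      ext f
      simp only [mem_iInter, mem_ofPred_eq]
      exact ae_freqMeasure_circle
    rw [h]
    refine isClosed_iInter fun n => ?_
    by_cases hn : 2 * Real.pi * (n : ℝ) < 0
    · simp only [hn, true_imp_iff]
      exact isClosed_eq (continuous_fourierL1_circle _) continuous_const
    · simp [hn]

instance (G : Geometry) : CompleteSpace (L2Plus G) :=
  (isClosed_L2Plus G).completeSpace_coe

/-- The Fourier transform of an element of the Hardy space. -/
def hardyHat {G : Geometry} (f : L2Plus G) : ℝ → ℂ := fourierL2 G (f : Lp ℂ 2 (posMeasure G))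

/-! ### Sobolev spaces -/

/-- A function `φ` on frequency space is square integrable with the weight `(|ξ| + 1)^{2σ}`. -/
def WeightedL2 (G : Geometry) (σ : ℝ) (φ : ℝ → ℂ) : Prop :=
  AEStronglyMeasurable φ (freqMeasure G) ∧
    Integrable (fun ξ => (|ξ| + 1) ^ (2 * σ) * ‖φ ξ‖ ^ 2) (freqMeasure G)

/-- The `H^σ_κ` norm in terms of the Fourier transform `φ`:
`(∫ (|ξ| + κ)^{2σ} |φ(ξ)|² dξ)^{1/2}`, or the corresponding sum over `2πℤ`. -/
def sobolevNorm (G : Geometry) (σ κ : ℝ) (φ : ℝ → ℂ) : ℝ :=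
  Real.sqrt (∫ ξ, (|ξ| + κ) ^ (2 * σ) * ‖φ ξ‖ ^ 2 ∂(freqMeasure G))

/-- The tempered distribution `T` on `ℝ` has Fourier transform `φ`, that is,
`T(x) = c ∫ e^{iξx} φ(ξ) dξ` in the sense of distributions, the integral being a sum over `2πℤ`
in the case of the circle (so that `T` is then `1`-periodic).
Here `𝓕⁻ g (ξ / 2π) = ∫ e^{iξx} g(x) dx`. -/
def HasFourierTransform (G : Geometry) (T : 𝓢'(ℝ, ℂ)) (φ : ℝ → ℂ) : Prop :=
  AEStronglyMeasurable φ (freqMeasure G) ∧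
    ∀ g : 𝓢(ℝ, ℂ),
      Integrable (fun ξ => φ ξ * (𝓕⁻ g : 𝓢(ℝ, ℂ)) (ξ / (2 * Real.pi))) (freqMeasure G) ∧
      T g = (fourierConst G : ℂ) *
        ∫ ξ, φ ξ * (𝓕⁻ g : 𝓢(ℝ, ℂ)) (ξ / (2 * Real.pi)) ∂(freqMeasure G)

open Classical in
/-- The Fourier transform of a (periodic, for the circle) tempered distribution whose Fourier
transform is a function; it is determined up to null sets of `freqMeasure G`. -/
def distHat (G : Geometry) (T : 𝓢'(ℝ, ℂ)) : ℝ → ℂ :=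
  if h : ∃ φ, HasFourierTransform G T φ then h.choose else 0

/-- `T ∈ H^σ`.  (For every `κ ≥ 1` the norms of `H^σ_κ` and of `H^σ` are equivalent.) -/
def MemH (G : Geometry) (σ : ℝ) (T : 𝓢'(ℝ, ℂ)) : Prop :=
  (∃ φ, HasFourierTransform G T φ) ∧ WeightedL2 G σ (distHat G T)

/-- `T ∈ H^σ_+`: moreover the Fourier transform is supported on `[0, ∞)`. -/
def MemHPlus (G : Geometry) (σ : ℝ) (T : 𝓢'(ℝ, ℂ)) : Prop :=
  MemH G σ T ∧ ∀ᵐ ξ ∂(freqMeasure G), ξ < 0 → distHat G T ξ = 0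

/-- `H^σ_+` as a subset of `L²_+`, for `σ ≥ 0`. -/
def HPlus (G : Geometry) (σ : ℝ) : Set (L2Plus G) := {f | WeightedL2 G σ (hardyHat f)}

/-- A distribution is real-valued if it takes real values on real test functions. -/
def IsRealValued (T : 𝓢'(ℝ, ℂ)) : Prop :=
  ∀ g : 𝓢(ℝ, ℂ), (∀ x, (g x).im = 0) → (T g).im = 0

/-- The sesquilinear `L²` pairing `∫ \bar g f dx`, on the Fourier side. -/
def pairing (G : Geometry) (gHat fHat : ℝ → ℂ) : ℂ :=
  ∫ ξ, (starRingEnd ℂ) (gHat ξ) * fHat ξ ∂(freqMeasure G)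

/-! ### The quadratic form of the Lax operator -/

/-- The Fourier transform of the integrable function `|f|²`. -/
def sqHat {G : Geometry} (f : L2Plus G) : ℝ → ℂ :=
  fourierL1 G fun x => ((‖(f : Lp ℂ 2 (posMeasure G)) x‖ ^ 2 : ℝ) : ℂ)

/-- `∫ q |f|² dx`, the pairing of the distribution `q` with the function `|f|²`, through
`∫ q h dx = ∫ \hat q(-ξ) \hat h(ξ) dξ`. -/
def potentialForm (G : Geometry) (q : 𝓢'(ℝ, ℂ)) (f : L2Plus G) : ℂ :=
  ∫ ξ, distHat G q (-ξ) * sqHat f ξ ∂(freqMeasure G)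

/-- The form `⟨f, 𝓛₀ f⟩ = ∫ ξ |\hat f(ξ)|² dξ` of `𝓛₀ = -i ∂ₓ`. -/
def freeForm {G : Geometry} (f : L2Plus G) : ℝ :=
  ∫ ξ, ξ * ‖hardyHat f ξ‖ ^ 2 ∂(freqMeasure G)

/-- The quadratic form `f ↦ ⟨f, 𝓛₀ f⟩ - ∫ q |f|² dx`. -/
def laxForm (G : Geometry) (q : 𝓢'(ℝ, ℂ)) (f : L2Plus G) : ℂ :=
  (freeForm f : ℂ) - potentialForm G q f

/-! ### Unbounded operators -/

section Operators

variable {H : Type*} [NormedAddCommGroup H] [InnerProductSpace ℂ H]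

/-- The operator is bounded from below. -/
def IsSemibounded (A : H →ₗ.[ℂ] H) : Prop :=
  ∃ c : ℝ, ∀ f : A.domain, c * ‖(f : H)‖ ^ 2 ≤ (⟪(f : H), A f⟫_ℂ).re

/-- `u n` is a sequence in the domain of `A` which converges to `f` in `H` and is Cauchy with
respect to the quadratic form of `A`. -/
def FormApprox (A : H →ₗ.[ℂ] H) (u : ℕ → A.domain) (f : H) : Prop :=
  Tendsto (fun n => (u n : H)) atTop (𝓝 f) ∧
    ∀ δ > 0, ∃ N, ∀ m ≥ N, ∀ n ≥ N, ‖⟪((u m - u n : A.domain) : H), A (u m - u n)⟫_ℂ‖ < δ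

/-- The quadratic form associated to the semibounded selfadjoint operator `A`, which is the
closure of `f ↦ ⟪f, A f⟫` on the domain of `A`, has form domain `Q` and is given there by `a`. -/
def HasQuadraticForm (A : H →ₗ.[ℂ] H) (Q : Set H) (a : H → ℂ) : Prop :=
  (∀ f, f ∈ Q ↔ ∃ u, FormApprox A u f) ∧
    ∀ f u, FormApprox A u f → Tendsto (fun n => ⟪(u n : H), A (u n)⟫_ℂ) atTop (𝓝 (a f))

/-- The set of `z` such that `A - z` is a bijection from the domain of `A` onto `H` with bounded
inverse. -/
def resolventSet (A : H →ₗ.[ℂ] H) : Set ℂ :=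
  {z | ∃ R : H →L[ℂ] H, (∀ h, ∃ hR : R h ∈ A.domain, A ⟨R h, hR⟩ - z • R h = h) ∧
    ∀ g : A.domain, R (A g - z • (g : H)) = g}

/-- The spectrum. -/
def spec (A : H →ₗ.[ℂ] H) : Set ℂ := (resolventSet A)ᶜ

/-- The eigenspace `{g | A g = z g}`. -/
def eigenspace (A : H →ₗ.[ℂ] H) (z : ℂ) : Submodule ℂ A.domain :=
  LinearMap.ker (A.toFun - z • A.domain.subtype)

/-- The discrete spectrum: isolated points of the spectrum that are eigenvalues of finite
multiplicity. -/
def discreteSpec (A : H →ₗ.[ℂ] H) : Set ℂ :=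
  {z | z ∈ spec A ∧ (∃ δ > 0, ∀ w ∈ spec A, dist w z < δ → w = z) ∧
    eigenspace A z ≠ ⊥ ∧ FiniteDimensional ℂ (eigenspace A z)}

/-- The essential spectrum: the spectrum with the discrete spectrum removed. -/
def essSpec (A : H →ₗ.[ℂ] H) : Set ℂ := spec A \ discreteSpec A

end Operators

/-- `(A + z) u = T` for the extension of the selfadjoint operator `A` on `L²_+` to its form domain,
with values in distributions: `⟨g, (A + z) u⟩ = ⟨A g, u⟩ + z ⟨g, u⟩ = ⟨g, T⟩` for all `g` in the
domain of `A`. -/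
def ShiftedApplyEq {G : Geometry} (A : L2Plus G →ₗ.[ℂ] L2Plus G) (z : ℂ) (u : L2Plus G)
    (T : 𝓢'(ℝ, ℂ)) : Prop :=
  ∀ g : A.domain, ⟪A g, u⟫_ℂ + z * ⟪(g : L2Plus G), u⟫_ℂ =
    pairing G (hardyHat (g : L2Plus G)) (distHat G T)

/-- `u = (A + z)⁻¹ f` with `u ∈ H^{1/2}_+`, for `f ∈ H^{-1/2}_+`. -/
def IsResolventOf {G : Geometry} (A : L2Plus G →ₗ.[ℂ] L2Plus G) (z : ℂ) (f : 𝓢'(ℝ, ℂ))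
    (u : L2Plus G) : Prop :=
  u ∈ HPlus G (1 / 2) ∧ ShiftedApplyEq A z u f

/-! ### The free operator -/

/-- The graph of `𝓛₀ = -i ∂ₓ` on `L²_+`: pairs `(f, h)` with `\hat h(ξ) = ξ \hat f(ξ)`. -/
def freeGraph (G : Geometry) : Submodule ℂ (L2Plus G × L2Plus G) where
  carrier := {p | ∀ᵐ ξ ∂(freqMeasure G), hardyHat p.2 ξ = ξ * hardyHat p.1 ξ}
  add_mem' {p r} hp hr := by
    filter_upwards [hp, hr, fourierL2_add G p.1 r.1, fourierL2_add G p.2 r.2] with ξ h1 h2 h3 h4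
    simp only [hardyHat] at *
    simp only [Prod.fst_add, Prod.snd_add, Submodule.coe_add, h3, h4, h1, h2, mul_add]
  zero_mem' := by
    have h := fourierL2_smul G 0 0
    rw [zero_smul] at h
    filter_upwards [h] with ξ h1
    change fourierL2 G 0 ξ = ξ * fourierL2 G 0 ξ
    rw [h1, zero_mul, mul_zero]
  smul_mem' c p hp := by
    filter_upwards [hp, fourierL2_smul G c p.1, fourierL2_smul G c p.2] with ξ h1 h2 h3
    simp only [hardyHat] at *
    simp only [Prod.smul_fst, Prod.smul_snd, Submodule.coe_smul, h1, h2, h3]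
    ring

/-- The operator `𝓛₀ = -i ∂ₓ` on `L²_+`, with its natural domain `H¹_+`. -/
def freeOp (G : Geometry) : L2Plus G →ₗ.[ℂ] L2Plus G := (freeGraph G).toLinearPMap

lemma eq_zero_of_fourierL2_line (f : Lp ℂ 2 (volume : Measure ℝ))
    (hf : ∀ᵐ ξ ∂(volume : Measure ℝ), fourierL2 .line f ξ = 0) : f = 0 := by
  have h : (𝓕 f : Lp ℂ 2 (volume : Measure ℝ)) = 0 := by
    rw [Lp.eq_zero_iff_ae_eq_zero]
    filter_upwards [quasi_mul.ae hf] with ξ hξ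
    simp only [fourierL2_line, mul_eq_zero, fourierConst_ne, false_or] at hξ
    rwa [mul_div_cancel_left₀ _ (by positivity)] at hξ
  exact (Lp.fourierTransformₗᵢ ℝ ℂ).map_eq_zero_iff.1 h

/-- Injectivity of the Fourier transform. -/
lemma eq_zero_of_fourierL2 (G : Geometry) (f : Lp ℂ 2 (posMeasure G))
    (hf : ∀ᵐ ξ ∂(freqMeasure G), fourierL2 G f ξ = 0) : f = 0 := by
  cases G with
  | line =>
    exact eq_zero_of_fourierL2_line f hf
  | circle =>
    have h0 := ae_freqMeasure_circle.1 hf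
    have hL2 : MemLp (f : ℝ → ℂ) 2 (volume.restrict (Ioc (0 : ℝ) 1)) := Lp.memLp f
    have hP := tsum_sq_fourierCoeffOn (zero_lt_one' ℝ) hL2
    have hz : ∀ n : ℤ, fourierCoeffOn (zero_lt_one' ℝ) (f : ℝ → ℂ) n = 0 := by
      intro n
      have h1 := h0 n
      simp only [fourierL2, fourierL1, fourierConst, posMeasure, Complex.ofReal_one, one_mul] at h1
      rw [fourierCoeffOn_eq_integral, intervalIntegral.integral_of_le zero_le_one]
      rw [← h1]
      simp only [sub_zero, div_one, one_smul]
      refine integral_congr_ae (Eventually.of_forall fun x => ?_)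
      simp only [fourier_coe_apply, smul_eq_mul]
      congr 2
      push_cast
      ring
    simp only [hz] at hP
    have h3 : ∫ x in Ioc (0 : ℝ) 1, ‖f x‖ ^ 2 = 0 := by
      rw [← intervalIntegral.integral_of_le zero_le_one]
      simpa using hP.symm
    rw [integral_eq_zero_iff_of_nonneg (fun x => by positivity) hL2.integrable_norm_pow'] at h3
    rw [Lp.eq_zero_iff_ae_eq_zero]
    change (f : ℝ → ℂ) =ᵐ[volume.restrict (Ioc (0 : ℝ) 1)] 0
    filter_upwards [h3] with x hx
    simpa using hx

/-- The free operator is genuinely given by its graph. -/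
lemma freeOp_graph (G : Geometry) : (freeOp G).graph = freeGraph G := by
  refine Submodule.toLinearPMap_graph_eq _ fun p hp h0 => ?_
  apply Subtype.ext
  refine eq_zero_of_fourierL2 G _ ?_
  have hz := fourierL2_smul G 0 0
  rw [zero_smul] at hz
  filter_upwards [hp, hz] with ξ h1 h2
  change hardyHat p.2 ξ = 0
  rw [h1, h0]
  change ξ * fourierL2 G 0 ξ = 0
  rw [h2, zero_mul, mul_zero]

/-- `ε = ½ (½ - |s|)`. -/
def epsOf (s : ℝ) : ℝ := (1 / 2) * (1 / 2 - |s|)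

end BenjaminOno

end

noncomputable section

namespace BenjaminOno

/-! ### Compact perturbations of selfadjoint operators -/

section Fredholm

variable {H : Type*} [NormedAddCommGroup H] [InnerProductSpace ℂ H] [CompleteSpace H]

/-! The Fourier transform turns `L2Plus G` into L² of the nonnegative frequencies. With B =
(𝓛₀+κ)^{-1/2} one has formally 𝓛 + κ = B⁻¹(1 − S)B⁻¹, where S = B q B is the integral operator with
kernel c (ξ+κ)^{-1/2} q̂(ξ−η) (η+κ)^{-1/2}. Everything rests on one estimate,
`exists_hsKernel_weightedKernel`: the operator (|ξ|+κ)^{-α} q (|ξ|+κ)^{-β}, with α+β = 1 and α, β ≥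
|s|, has Hilbert–Schmidt norm at most C κ^{-2ε} ‖q‖_{H^s_κ}. For large κ this is at most 1/2. Then J
= 1 − S is coercive and invertible, T = B J⁻¹ B is bounded, selfadjoint and injective, and 𝓛 is
defined to be T⁻¹ − κ.

B maps L²_+ onto H^{1/2}_+, and by coercivity form convergence is L² convergence of B⁻¹f; this gives
the closed form (`FormFactors.hasQuadraticForm_op`). A selfadjoint operator is determined by its
form (`HasQuadraticForm.unique`), so the constructions at different κ produce the same 𝓛, and each
large κ may be treated with its own factors.

The H^s → H^{s+1} bounds use the weights α = −s, β = s+1. The operator A so obtained is conjugate to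
S through a weight (`weightedKernel_intertwine`), so solving with 1 − A solves the same equation
with the better norm.

Spectral questions about 𝓛 become questions about the bounded pencil 1 − zT. A point lies outside
the essential spectrum exactly when the pencil there is invertible modulo compact operators, and T
differs from its free counterpart by the compact operator B J⁻¹ S B; this is Weyl's theorem. Near
such a point μ where the pencil is singular, with P the projection onto its kernel, (1 − zT)⁻¹ = (1
+ (1 − z/μ)⁻¹P)(1 − zT + P)⁻¹, which is meromorphic. A resolvent identity carries this over to
distributions f (`FormFactors.exists_meromorphic`). -/

/-- The Fredholm alternative: an injective compact perturbation of an invertible operator is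
invertible. -/
lemma isUnit_add_compact {U K : H →L[ℂ] H} (hU : IsUnit U) (hK : IsCompactOperator K)
    (hinj : ∀ x, (U + K) x = 0 → x = 0) : IsUnit (U + K) := by
  obtain ⟨u, rfl⟩ := hU
  have hC : IsCompactOperator (-((↑u⁻¹ : H →L[ℂ] H) * K)) := by
    have := (hK.clm_comp (↑u⁻¹ : H →L[ℂ] H)).neg
    exact this
  -- Once the unit is factored out, 1 minus a compact operator remains. For the compact operator, 1
  -- is an eigenvalue or lies in the resolvent set, and an eigenvector would be killed by U + K.
  have hfac : (u : H →L[ℂ] H) + K = u * (1 - (-((↑u⁻¹ : H →L[ℂ] H) * K))) := by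
    rw [sub_neg_eq_add, mul_add, mul_one, u.mul_inv_cancel_left]
  rcases hC.hasEigenvalue_or_mem_resolventSet (μ := (1 : ℂ)) one_ne_zero with h | h
  · obtain ⟨x, hx⟩ := h.exists_hasEigenvector
    refine absurd (hinj x ?_) hx.2
    have h1 := hx.apply_eq_smul
    rw [hfac]
    have h2 : (-((↑u⁻¹ : H →L[ℂ] H) * K)) x = x := by simpa using h1
    simp only [mul_apply_eq_comp, sub_apply, one_apply_eq_self]
    rw [h2, sub_self, map_zero]
  · rw [spectrum.mem_resolventSet_iff, map_one] at h
    rw [hfac]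
    exact u.isUnit.mul h

/-- On the kernel of A the compact operator (A + K)⁻¹K acts as the identity, and a compact identity
forces finite dimension. -/
lemma finiteDimensional_ker_of_isUnit_add_compact {A K : H →L[ℂ] H} (hK : IsCompactOperator K)
    (hU : IsUnit (A + K)) : FiniteDimensional ℂ (LinearMap.ker A.toLinearMap) := by
  obtain ⟨u, hu⟩ := hU
  set N := LinearMap.ker A.toLinearMap
  have hC : IsCompactOperator (((↑u⁻¹ : H →L[ℂ] H) * K : H →L[ℂ] H) : H →ₗ[ℂ] H) :=
    hK.clm_comp (↑u⁻¹ : H →L[ℂ] H)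
  have hid : ∀ x ∈ N, (((↑u⁻¹ : H →L[ℂ] H) * K : H →L[ℂ] H) : H →ₗ[ℂ] H) x = x := by
    intro x hx
    have hx0 : A x = 0 := hx
    have h1 : (u : H →L[ℂ] H) x = K x := by rw [hu]; simp [hx0]
    have h2 : (↑u⁻¹ : H →L[ℂ] H) ((u : H →L[ℂ] H) x) = x := by
      rw [← mul_apply_eq_comp, u.inv_mul]; rfl
    change (↑u⁻¹ : H →L[ℂ] H) (K x) = x
    rw [← h1, h2]
  have hclosed : IsClosed (N : Set H) := ContinuousLinearMap.isClosed_ker A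
  have := hC.restrict (V := N) (fun x hx => by rw [hid x hx]; exact hx) hclosed
  apply FiniteDimensional.of_isCompactOperator_id (𝕜 := ℂ)
  have hfun : (id : N → N) = LinearMap.restrict
      (((↑u⁻¹ : H →L[ℂ] H) * K : H →L[ℂ] H) : H →ₗ[ℂ] H)
      (fun x (hx : x ∈ N) => by rw [hid x hx]; exact hx) := by
    funext x
    exact Subtype.ext (hid x x.2).symm
  rw [hfun]
  exact this

lemma isCompactOperator_of_range_le {E : H →L[ℂ] H} (V : Submodule ℂ H) [FiniteDimensional ℂ V]
    (h : ∀ x, E x ∈ V) : IsCompactOperator E := by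
  have h1 : IsCompactOperator (E.codRestrict V h) := by
    have : ProperSpace V := FiniteDimensional.proper ℂ V
    have : LocallyCompactSpace V := inferInstance
    exact isCompactOperator_of_locallyCompactSpace_dom (E.codRestrict V h)
  exact h1.clm_comp V.subtypeL

/-- Isolated points of the spectrum of finite multiplicity are removed by a compact
perturbation. -/
lemma exists_compact_isUnit_of_isolated {T : H →L[ℂ] H} (hT : IsSelfAdjoint T) {μ : ℂ}
    (hμ : ¬ IsUnit (1 - μ • T))
    (hiso : ∃ δ > 0, ∀ μ', ¬ IsUnit (1 - μ' • T) → dist μ' μ < δ → μ' = μ)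
    (hfin : FiniteDimensional ℂ (LinearMap.ker (1 - μ • T : H →L[ℂ] H).toLinearMap)) :
    ∃ K : H →L[ℂ] H, IsCompactOperator K ∧ IsUnit (1 - μ • T + K) := by
  classical
  have hμ0 : μ ≠ 0 := by rintro rfl; simp at hμ
  have hn : IsStarNormal T := hT.isStarNormal
  obtain ⟨δ, hδ, hiso⟩ := hiso
  have hspec : ∀ x ∈ spectrum ℂ T, x ≠ 0 → ¬ IsUnit (1 - x⁻¹ • T) := by
    intro x hx hx0 hu
    apply hx
    rw [spectrum.mem_resolventSet_iff]
    have : algebraMap ℂ (H →L[ℂ] H) x - T = x • (1 - x⁻¹ • T) := by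
      rw [smul_sub, smul_inv_smul₀ hx0, Algebra.algebraMap_eq_smul_one]
    rw [this, Algebra.smul_def]
    exact ((IsUnit.mk0 x hx0).map _).mul hu
  -- Indicator of the spectral point μ⁻¹. It is continuous on the spectrum because the point is
  -- isolated there, so the continuous functional calculus produces the spectral projection.
  set f : ℂ → ℂ := fun x => if x = μ⁻¹ then 1 else 0 with hf
  have hev : ∀ᶠ x in 𝓝 μ⁻¹, x ∈ spectrum ℂ T → x = μ⁻¹ := by
    have h1 : ∀ᶠ x in 𝓝 μ⁻¹, dist x⁻¹ μ < δ := by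
      have : Tendsto (fun x : ℂ => x⁻¹) (𝓝 μ⁻¹) (𝓝 μ) := by
        have := tendsto_inv₀ (inv_ne_zero hμ0)
        rwa [inv_inv] at this
      exact this (Metric.ball_mem_nhds μ hδ)
    filter_upwards [h1, isOpen_ne.mem_nhds (inv_ne_zero hμ0)] with x hx hx0 hxs
    have := hiso x⁻¹ (hspec x hxs hx0) hx
    rw [← this, inv_inv]
  have hfc : ContinuousOn f (spectrum ℂ T) := by
    intro x hx
    by_cases hxe : x = μ⁻¹
    · subst hxe
      have : f =ᶠ[𝓝[spectrum ℂ T] μ⁻¹] fun _ => 1 := by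
        filter_upwards [mem_nhdsWithin_of_mem_nhds hev, self_mem_nhdsWithin] with y hy hys
        simp [f, hy hys]
      exact (continuousWithinAt_const (b := (1 : ℂ))).congr_of_eventuallyEq this (by simp [f])
    · have : f =ᶠ[𝓝[spectrum ℂ T] x] fun _ => 0 := by
        filter_upwards [mem_nhdsWithin_of_mem_nhds (isOpen_ne.mem_nhds hxe)] with y hy
        simp only [f, if_neg hy]
      exact (continuousWithinAt_const (b := (0 : ℂ))).congr_of_eventuallyEq this (by simp [f, hxe])
  refine ⟨cfc f T, ?_, ?_⟩
  · refine isCompactOperator_of_range_le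
      (LinearMap.ker (1 - μ • T : H →L[ℂ] H).toLinearMap) fun x => ?_
    -- Since (1 − μx) f(x) vanishes identically, the range of the projection lies in the
    -- finite-dimensional kernel.
    have h0 : (1 - μ • T) * cfc f T = 0 := by
      have h1 : (1 - μ • T) = cfc (fun x => 1 - μ * x) T := by
        rw [cfc_sub (fun _ : ℂ => (1 : ℂ)) (fun x => μ * x) T, cfc_const_one ℂ T,
          cfc_const_mul_id μ T]
      rw [h1, ← cfc_mul (fun x => 1 - μ * x) f T (by fun_prop) hfc]
      have : (fun x => (1 - μ * x) * f x) = fun _ => (0 : ℂ) := by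
        funext x
        by_cases hx : x = μ⁻¹
        · simp [hx, hμ0]
        · simp [f, hx]
      rw [this, cfc_const_zero]
    have := congrArg (fun A : H →L[ℂ] H => A x) h0
    simpa using this
  · have h1 : (1 - μ • T) + cfc f T = cfc (fun x => 1 - μ * x + f x) T := by
      rw [cfc_add T (fun x => 1 - μ * x) f (by fun_prop) hfc,
        cfc_sub (fun _ : ℂ => (1 : ℂ)) (fun x => μ * x) T, cfc_const_one ℂ T,
          cfc_const_mul_id μ T]
    rw [h1]
    refine (isUnit_cfc_iff (fun x => 1 - μ * x + f x) T
      (((by fun_prop : Continuous fun x : ℂ => 1 - μ * x).continuousOn).add hfc)).2 fun x hx => ?_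
    by_cases hxe : x = μ⁻¹
    · simp [f, hxe, hμ0]
    · simp only [f, if_neg hxe, add_zero]
      intro h
      exact hxe (eq_inv_of_mul_eq_one_right (sub_eq_zero.1 h).symm)

/-- If `1 - μ T` is not invertible but a compact perturbation of it is, then `1 - μ T` becomes
invertible by adding the projection onto its kernel. -/
lemma exists_projection_of_isUnit_add_compact {T : H →L[ℂ] H} (hT : IsSelfAdjoint T) {μ : ℂ}
    (hμ : ¬ IsUnit (1 - μ • T)) {K : H →L[ℂ] H} (hK : IsCompactOperator K)
    (hU : IsUnit (1 - μ • T + K)) :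
    LinearMap.ker (1 - μ • T : H →L[ℂ] H).toLinearMap ≠ ⊥ ∧
    ∃ P : H →L[ℂ] H, IsUnit (1 - μ • T + P) ∧ ∀ z, z ≠ μ →
      (1 - z • T) * (1 + (1 - z / μ)⁻¹ • P) = 1 - z • T + P ∧
      (1 + (1 - z / μ)⁻¹ • P) * (1 - z • T) = 1 - z • T + P := by
  have hμ0 : μ ≠ 0 := by rintro rfl; simp at hμ
  -- μ⁻¹ belongs to the spectrum of a selfadjoint operator. Reality of μ makes 1 − μT selfadjoint,
  -- so the orthogonal projection onto its kernel commutes with T.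
  have hreal : (starRingEnd ℂ) μ = μ := by
    have h1 : μ⁻¹ ∈ spectrum ℂ T := by
      intro h
      rw [spectrum.mem_resolventSet_iff] at h
      apply hμ
      have : (1 - μ • T) = μ • (algebraMap ℂ (H →L[ℂ] H) μ⁻¹ - T) := by
        rw [smul_sub, Algebra.algebraMap_eq_smul_one, smul_inv_smul₀ hμ0]
      rw [this, Algebra.smul_def]
      exact ((IsUnit.mk0 μ hμ0).map _).mul h
    have h2 := hT.im_eq_zero_of_mem_spectrum h1
    have h3 := Complex.conj_eq_iff_im.2 h2
    rw [map_inv₀] at h3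
    exact inv_injective h3
  set A : H →L[ℂ] H := 1 - μ • T with hA
  set N := LinearMap.ker A.toLinearMap with hN
  have hfin : FiniteDimensional ℂ N := finiteDimensional_ker_of_isUnit_add_compact hK hU
  have hAsa : ∀ x y, ⟪A x, y⟫_ℂ = ⟪x, A y⟫_ℂ := by
    intro x y
    have h1 := ContinuousLinearMap.isSelfAdjoint_iff_isSymmetric.1 hT x y
    simp only [ContinuousLinearMap.coe_coe] at h1
    simp only [hA, sub_apply, one_apply_eq_self,
      smul_apply, inner_sub_left, inner_sub_right, inner_smul_left,
      inner_smul_right, hreal, h1]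
  set P : H →L[ℂ] H := N.starProjection with hP
  have hPc : IsCompactOperator P :=
    isCompactOperator_of_range_le N fun x => Submodule.starProjection_apply_mem N x
  have hAP : ∀ x, A (P x) = 0 := fun x =>
    (Submodule.starProjection_apply_mem N x : P x ∈ N)
  have hPA : ∀ x, P (A x) = 0 := by
    intro x
    apply ext_inner_left ℂ
    intro y
    have : ⟪y, P (A x)⟫_ℂ = ⟪P y, A x⟫_ℂ := by
      rw [hP]; exact (N.inner_starProjection_left_eq_right y (A x)).symm
    rw [this, ← hAsa, hAP, inner_zero_left, inner_zero_right]
  have hTP : ∀ x, T (P x) = μ⁻¹ • P x := by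
    intro x
    have h := hAP x
    simp only [hA, sub_apply, one_apply_eq_self,
      smul_apply, sub_eq_zero] at h
    rw [eq_inv_smul_iff₀ hμ0]; exact h.symm
  have hPT : ∀ x, P (T x) = μ⁻¹ • P x := by
    intro x
    have h := hPA x
    simp only [hA, sub_apply, one_apply_eq_self,
      smul_apply, map_sub, map_smul, sub_eq_zero] at h
    rw [eq_inv_smul_iff₀ hμ0]; exact h.symm
  refine ⟨?_, P, ?_, ?_⟩
  · intro hbot
    apply hμ
    have h1 : A = (A + K) + (-K) := by abel
    rw [h1]
    refine isUnit_add_compact hU hK.neg fun x hx => ?_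
    rw [← h1] at hx
    have : x ∈ N := hx
    rw [hbot] at this
    simpa using this
  -- A + P is a compact perturbation of the invertible A + K, so only injectivity is needed; it
  -- holds because P x is orthogonal to the range of A.
  · have h1 : A + P = (A + K) + (P - K) := by abel
    rw [h1]
    refine isUnit_add_compact hU (hPc.sub hK) fun x hx => ?_
    rw [← h1] at hx
    have h2 : A x + P x = 0 := hx
    have h3 : ⟪P x, A x + P x⟫_ℂ = 0 := by rw [h2, inner_zero_right]
    rw [inner_add_right, ← hAsa, hAP, inner_zero_left, zero_add, inner_self_eq_zero] at h3
    rw [h3, add_zero] at h2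
    have hxN : x ∈ N := h2
    rw [← Submodule.starProjection_eq_self_iff.2 hxN]
    exact h3
  · intro z hz
    have hne : (1 - z / μ) ≠ 0 := by
      intro h
      apply hz
      rw [sub_eq_zero, eq_div_iff hμ0, one_mul] at h
      exact h.symm
    -- On the range of P, T is the scalar μ⁻¹ and 1 − zT is the scalar 1 − z/μ; the coefficient of P
    -- is its inverse.
    have key : ∀ p : H, (1 - z / μ)⁻¹ • p - (z * (1 - z / μ)⁻¹ * μ⁻¹) • p = p := by
      intro p
      rw [← sub_smul]
      convert one_smul ℂ p
      field_simp
    constructor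
    · ext x
      simp only [mul_apply_eq_comp, sub_apply,
        add_apply, one_apply_eq_self, smul_apply, map_add, map_smul, hTP, smul_smul]
      linear_combination (norm := module) key (P x)
    · ext x
      simp only [mul_apply_eq_comp, sub_apply,
        add_apply, one_apply_eq_self, smul_apply, map_sub, map_smul, hPT, smul_smul]
      linear_combination (norm := module) key (P x)

lemma eventually_isUnit_of_projection {T P : H →L[ℂ] H} {μ : ℂ} (hU : IsUnit (1 - μ • T + P)) :
    ∀ᶠ z in 𝓝 μ, IsUnit (1 - z • T + P) := by
  have hc : ContinuousAt (fun z : ℂ => 1 - z • T + P) μ := by fun_prop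
  exact hc (Units.isOpen.mem_nhds hU)

/-- Both factorizations are needed to get a two-sided inverse. Near a singular point the factor with
P added is boundedly invertible, so the whole singularity sits in the scalar c. -/
lemma isUnit_and_inverse_of_projection {T P : H →L[ℂ] H} {c z : ℂ}
    (hU : IsUnit (1 - z • T + P)) (h1 : (1 - z • T) * (1 + c • P) = 1 - z • T + P)
    (h2 : (1 + c • P) * (1 - z • T) = 1 - z • T + P) :
    IsUnit (1 - z • T) ∧
      Ring.inverse (1 - z • T) = (1 + c • P) * Ring.inverse (1 - z • T + P) := by
  obtain ⟨u, hu⟩ := hU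
  have hr : (1 - z • T) * ((1 + c • P) * ↑u⁻¹) = 1 := by
    rw [← mul_assoc, h1, ← hu, u.mul_inv]
  have hl : (↑u⁻¹ * (1 + c • P)) * (1 - z • T) = 1 := by
    rw [mul_assoc, h2, ← hu, u.inv_mul]
  have heq : ↑u⁻¹ * (1 + c • P) = (1 + c • P) * ↑u⁻¹ := left_inv_eq_right_inv hl hr
  let v : (H →L[ℂ] H)ˣ := ⟨1 - z • T, (1 + c • P) * ↑u⁻¹, hr, by rw [← heq, hl]⟩
  refine ⟨v.isUnit, ?_⟩
  rw [← hu, Ring.inverse_unit]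
  exact Ring.inverse_unit v

lemma analyticAt_inverse_pencil {T P : H →L[ℂ] H} {μ : ℂ} (hU : IsUnit (1 - μ • T + P))
    (x y : H) : AnalyticAt ℂ (fun z : ℂ => ⟪x, Ring.inverse (1 - z • T + P) y⟫_ℂ) μ := by
  obtain ⟨u, hu⟩ := hU
  have h1 : AnalyticAt ℂ (Ring.inverse : (H →L[ℂ] H) → (H →L[ℂ] H)) (1 - μ • T + P) := by
    rw [← hu]; exact analyticAt_inverse u
  have h2 : AnalyticAt ℂ (fun z : ℂ => 1 - z • T + P) μ := by fun_prop
  have h3 := AnalyticAt.comp (f := fun z : ℂ => 1 - z • T + P) (x := μ) h1 h2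
  have h4 : AnalyticAt ℂ (((innerSL ℂ x).comp (ContinuousLinearMap.apply ℂ H y)))
    (Ring.inverse (1 - μ • T + P)) := ContinuousLinearMap.analyticAt _ _
  exact AnalyticAt.comp (f := (Ring.inverse : (H →L[ℂ] H) → _) ∘ fun z : ℂ => 1 - z • T + P)
    (x := μ) h4 h3

/-- Matrix elements of `(1 - z T)⁻¹` are meromorphic where `1 - z T` is invertible modulo compact
operators. -/
lemma meromorphicAt_inverse_pencil {T K : H →L[ℂ] H} (hT : IsSelfAdjoint T) {μ : ℂ}
    (hK : IsCompactOperator K) (hU : IsUnit (1 - μ • T + K)) (x y : H) :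
    MeromorphicAt (fun z : ℂ => ⟪x, Ring.inverse (1 - z • T) y⟫_ℂ) μ := by
  by_cases hμ : IsUnit (1 - μ • T)
  · have := analyticAt_inverse_pencil (T := T) (P := 0) (μ := μ) (by simpa using hμ) x y
    simp only [add_zero] at this
    exact this.meromorphicAt
  · have hμ0 : μ ≠ 0 := by rintro rfl; simp at hμ
    obtain ⟨-, P, hPU, hP⟩ := exists_projection_of_isUnit_add_compact hT hμ hK hU
    have han := analyticAt_inverse_pencil hPU
    have hm : MeromorphicAt (fun z : ℂ => ⟪x, Ring.inverse (1 - z • T + P) y⟫_ℂ +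
        (1 - z / μ)⁻¹ * ⟪P.adjoint x, Ring.inverse (1 - z • T + P) y⟫_ℂ) μ := by
      have h0 : AnalyticAt ℂ (fun z : ℂ => 1 - z / μ) μ := by fun_prop
      exact (han x y).meromorphicAt.add
        (h0.meromorphicAt.inv.mul (han (P.adjoint x) y).meromorphicAt)
    refine hm.congr ?_
    filter_upwards [self_mem_nhdsWithin,
      mem_nhdsWithin_of_mem_nhds (eventually_isUnit_of_projection hPU)] with z hz hzU
    obtain ⟨h1, h2⟩ := hP z hz
    rw [(isUnit_and_inverse_of_projection hzU h1 h2).2, ContinuousLinearMap.adjoint_inner_left]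
    simp only [mul_apply_eq_comp, add_apply,
      one_apply_eq_self, smul_apply, inner_add_right, inner_smul_right]

end Fredholm

/-! ### Inverses of bounded selfadjoint operators -/

section ShiftedInverse

variable {H : Type*} [NormedAddCommGroup H] [InnerProductSpace ℂ H]

/-- The unbounded operator `T⁻¹ - κ` with domain the range of the injective operator `T`. -/
def shiftedInverse (T : H →L[ℂ] H) (hT : Function.Injective T) (κ : ℝ) : H →ₗ.[ℂ] H where
  domain := LinearMap.range T.toLinearMap
  toFun := (LinearEquiv.ofInjective T.toLinearMap hT).symm.toLinearMap -
    (κ : ℂ) • (LinearMap.range T.toLinearMap).subtype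

variable {T : H →L[ℂ] H} {hT : Function.Injective T} {κ : ℝ}

lemma mem_domain_shiftedInverse (x : H) : T x ∈ (shiftedInverse T hT κ).domain := ⟨x, rfl⟩

lemma shiftedInverse_apply (x : H) (h : T x ∈ (shiftedInverse T hT κ).domain) :
    shiftedInverse T hT κ ⟨T x, h⟩ = x - (κ : ℂ) • T x := by
  change (LinearEquiv.ofInjective T.toLinearMap hT).symm ⟨T x, h⟩ - (κ : ℂ) • T x = _
  congr 1
  rw [LinearEquiv.symm_apply_eq]
  rfl

lemma exists_eq_of_domain_shiftedInverse (g : (shiftedInverse T hT κ).domain) :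
    ∃ x, (g : H) = T x ∧ shiftedInverse T hT κ g = x - (κ : ℂ) • T x := by
  obtain ⟨g, x, rfl⟩ := g
  exact ⟨x, rfl, shiftedInverse_apply x _⟩

lemma mem_eigenspace_shiftedInverse {w : ℂ} (x : H)
    (h : T x ∈ (shiftedInverse T hT κ).domain) :
    (⟨T x, h⟩ : (shiftedInverse T hT κ).domain) ∈ eigenspace (shiftedInverse T hT κ) w ↔
      (1 - (w + κ) • T) x = 0 := by
  have h1 : (⟨T x, h⟩ : (shiftedInverse T hT κ).domain) ∈ eigenspace (shiftedInverse T hT κ) w ↔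
      shiftedInverse T hT κ ⟨T x, h⟩ - w • T x = 0 := Iff.rfl
  rw [h1, shiftedInverse_apply]
  simp only [sub_apply, one_apply_eq_self, smul_apply]
  rw [add_smul, sub_sub, add_comm]

lemma eigenspace_shiftedInverse_eq_bot_iff {w : ℂ} :
    eigenspace (shiftedInverse T hT κ) w = ⊥ ↔
      LinearMap.ker (1 - (w + κ) • T : H →L[ℂ] H).toLinearMap = ⊥ := by
  rw [Submodule.eq_bot_iff, Submodule.eq_bot_iff]
  constructor
  · intro h x hx
    have h1 := h ⟨T x, mem_domain_shiftedInverse x⟩ ((mem_eigenspace_shiftedInverse x _).2 hx)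
    have h2 : T x = 0 := congrArg Subtype.val h1
    exact hT (by rw [h2, map_zero])
  · rintro h ⟨_, x, rfl⟩ hx
    have h1 := h x ((mem_eigenspace_shiftedInverse x _).1 hx)
    exact Subtype.ext (by change T x = 0; rw [h1, map_zero])

/-- T itself maps the kernel of the pencil bijectively onto the eigenspace, so multiplicities agree.
-/
lemma finiteDimensional_eigenspace_shiftedInverse_iff {w : ℂ} :
    FiniteDimensional ℂ (eigenspace (shiftedInverse T hT κ) w) ↔
      FiniteDimensional ℂ (LinearMap.ker (1 - (w + κ) • T : H →L[ℂ] H).toLinearMap) := by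
  let e : H ≃ₗ[ℂ] (shiftedInverse T hT κ).domain := LinearEquiv.ofInjective T.toLinearMap hT
  have he : (LinearMap.ker (1 - (w + κ) • T : H →L[ℂ] H).toLinearMap).map e.toLinearMap =
      eigenspace (shiftedInverse T hT κ) w := by
    ext g
    constructor
    · rintro ⟨x, hx, rfl⟩
      exact (mem_eigenspace_shiftedInverse x _).2 hx
    · obtain ⟨g, x, rfl⟩ := g
      intro hg
      exact ⟨x, (mem_eigenspace_shiftedInverse x _).1 hg, rfl⟩
  rw [← he]
  exact (Module.Finite.equiv_iff (e.submoduleMap _)).symm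

variable [CompleteSpace H]

lemma dense_range_of_isSelfAdjoint {B : H →L[ℂ] H} (hB : IsSelfAdjoint B)
    (hinj : Function.Injective B) : DenseRange B := by
  have h1 : (LinearMap.range B.toLinearMap)ᗮ = ⊥ := by
    have := ContinuousLinearMap.orthogonal_range B
    rw [this, hB.adjoint_eq]
    exact LinearMap.ker_eq_bot.2 hinj
  have h2 := (Submodule.topologicalClosure_eq_top_iff (K := LinearMap.range B.toLinearMap)).2 h1
  rw [← Submodule.dense_iff_topologicalClosure_eq_top] at h2
  exact h2

lemma isSelfAdjoint_shiftedInverse (hsa : IsSelfAdjoint T) :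
    IsSelfAdjoint (shiftedInverse T hT κ) := by
  have hsym : ∀ x y, ⟪T x, y⟫_ℂ = ⟪x, T y⟫_ℂ :=
    ContinuousLinearMap.isSelfAdjoint_iff_isSymmetric.1 hsa
  have hd : Dense ((shiftedInverse T hT κ).domain : Set H) := dense_range_of_isSelfAdjoint hsa hT
  rw [LinearPMap.isSelfAdjoint_def]
  refine le_antisymm ?_ ?_
  -- Testing the adjoint relation against every T v identifies y as T of a vector, so the adjoint
  -- has no larger domain than the range of T.
  · have hdom : ∀ y (hy : y ∈ (LinearPMap.adjoint (shiftedInverse T hT κ)).domain),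
        y = T (LinearPMap.adjoint (shiftedInverse T hT κ) ⟨y, hy⟩ + (κ : ℂ) • y) := by
      intro y hy
      apply ext_inner_right ℂ
      intro v
      have h1 := LinearPMap.adjoint_isFormalAdjoint hd
        ⟨y, hy⟩ ⟨T v, mem_domain_shiftedInverse (hT := hT) (κ := κ) v⟩
      rw [shiftedInverse_apply] at h1
      simp only [inner_sub_right, inner_smul_right] at h1
      rw [hsym, inner_add_left, inner_smul_left, h1, Complex.conj_ofReal]
      ring
    refine ⟨fun y hy => ?_, ?_⟩
    · rw [hdom y hy]; exact mem_domain_shiftedInverse _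
    · rintro ⟨y, hy⟩ ⟨y', hy'⟩ (rfl : y = y')
      obtain ⟨x, hx, hLx⟩ := exists_eq_of_domain_shiftedInverse ⟨y, hy'⟩
      have h2 := hdom y hy
      simp only at hx
      rw [hLx, ← hx]
      have h3 := hT (hx.symm.trans h2)
      rw [h3]; abel
  · refine LinearPMap.IsFormalAdjoint.le_adjoint hd ?_
    rintro ⟨_, x, rfl⟩ ⟨_, y, rfl⟩
    change ⟪shiftedInverse T hT κ ⟨T x, mem_domain_shiftedInverse x⟩, T y⟫_ℂ =
      ⟪T x, shiftedInverse T hT κ ⟨T y, mem_domain_shiftedInverse y⟩⟫_ℂ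
    rw [shiftedInverse_apply, shiftedInverse_apply]
    simp only [inner_sub_left, inner_sub_right, inner_smul_left, inner_smul_right,
      Complex.conj_ofReal, hsym, map_sub, map_smul]

/-- For L = T⁻¹ − κ one has (L − w)T = 1 − (w+κ)T, so the resolvent at w is T(1 − (w+κ)T)⁻¹. This
trades the unbounded operator for a bounded pencil. -/
lemma mem_resolventSet_shiftedInverse {w : ℂ} :
    w ∈ resolventSet (shiftedInverse T hT κ) ↔ IsUnit (1 - (w + κ) • T) := by
  constructor
  · rintro ⟨R, h1, h2⟩
    rw [ContinuousLinearMap.isUnit_iff_bijective]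
    constructor
    · rw [injective_iff_map_eq_zero]
      intro x hx
      have h3 := h2 ⟨T x, mem_domain_shiftedInverse x⟩
      rw [shiftedInverse_apply] at h3
      have h4 : x - (κ : ℂ) • T x - w • T x = 0 := by
        rw [← hx]
        simp only [sub_apply, one_apply_eq_self, smul_apply]
        rw [add_smul, sub_sub, add_comm]
      simp only [h4, map_zero] at h3
      exact hT (by rw [← h3, map_zero])
    · intro h
      obtain ⟨hR, h3⟩ := h1 h
      obtain ⟨x, hx, hLx⟩ := exists_eq_of_domain_shiftedInverse ⟨R h, hR⟩
      simp only at hx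
      refine ⟨x, ?_⟩
      rw [hLx, hx] at h3
      rw [← h3]
      simp only [sub_apply, one_apply_eq_self, smul_apply]
      rw [add_smul, sub_sub, add_comm]
  · rintro ⟨u, hu⟩
    have hua : ∀ x, (u : H →L[ℂ] H) x = x - (κ : ℂ) • T x - w • T x := by
      intro x
      rw [hu]
      simp only [sub_apply, one_apply_eq_self, smul_apply]
      rw [add_smul, sub_sub, add_comm]
    refine ⟨T * ↑u⁻¹, fun h => ⟨mem_domain_shiftedInverse _, ?_⟩, ?_⟩
    · simp only [mul_apply_eq_comp]
      rw [shiftedInverse_apply, ← hua, ← mul_apply_eq_comp, u.mul_inv, one_apply_eq_self]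
    · rintro ⟨_, x, rfl⟩
      change (T * ↑u⁻¹) (shiftedInverse T hT κ ⟨T x, mem_domain_shiftedInverse x⟩ - w • T x) = T x
      rw [shiftedInverse_apply, ← hua, mul_apply_eq_comp,
        ← mul_apply_eq_comp (↑u⁻¹ : H →L[ℂ] H), u.inv_mul, one_apply_eq_self]

/-- The essential spectrum in terms of invertibility modulo compact operators. -/
lemma notMem_essSpec_shiftedInverse (hsa : IsSelfAdjoint T) {w : ℂ} :
    w ∉ essSpec (shiftedInverse T hT κ) ↔
      ∃ K : H →L[ℂ] H, IsCompactOperator K ∧ IsUnit (1 - (w + κ) • T + K) := by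
  have hspec : ∀ v, v ∈ spec (shiftedInverse T hT κ) ↔ ¬ IsUnit (1 - (v + κ) • T) := fun v =>
    mem_resolventSet_shiftedInverse.not
  by_cases hu : IsUnit (1 - (w + κ) • T)
  · refine iff_of_true (fun h => (hspec w).1 h.1 hu) ⟨0, isCompactOperator_zero, by simpa using hu⟩
  constructor
  · intro h
    have hd : w ∈ discreteSpec (shiftedInverse T hT κ) := by
      by_contra hd
      exact h ⟨(hspec w).2 hu, hd⟩
    obtain ⟨-, ⟨δ, hδ, hiso⟩, -, hfin⟩ := hd
    refine exists_compact_isUnit_of_isolated hsa hu ⟨δ, hδ, fun μ' hμ' hd => ?_⟩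
      (finiteDimensional_eigenspace_shiftedInverse_iff.1 hfin)
    have h1 := hiso (μ' - κ) ((hspec _).2 (by rwa [sub_add_cancel])) (by
      rw [dist_eq_norm] at hd ⊢
      convert hd using 2
      ring)
    rw [← h1, sub_add_cancel]
  · rintro ⟨K, hK, hKU⟩ h
    apply h.2
    obtain ⟨hbot, P, hPU, hP⟩ := exists_projection_of_isUnit_add_compact hsa hu hK hKU
    refine ⟨h.1, ?_, fun hb => hbot (eigenspace_shiftedInverse_eq_bot_iff.1 hb),
      finiteDimensional_eigenspace_shiftedInverse_iff.2
        (finiteDimensional_ker_of_isUnit_add_compact hK hKU)⟩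
    -- The pencil with P added stays invertible near the point, and away from the point itself this
    -- makes the pencil invertible: the spectral point is isolated.
    obtain ⟨δ, hδ, hball⟩ := Metric.eventually_nhds_iff.1 (eventually_isUnit_of_projection hPU)
    refine ⟨δ, hδ, fun v hv hvd => ?_⟩
    by_contra hne
    have h1 := hball (y := v + κ) (by simpa using hvd)
    have h2 := hP (v + κ) (by simpa using hne)
    exact (hspec v).1 hv (isUnit_and_inverse_of_projection h1 h2.1 h2.2).1

/-- Weyl's theorem. -/
lemma essSpec_shiftedInverse_eq {T' : H →L[ℂ] H} {hT' : Function.Injective T'}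
    (hsa : IsSelfAdjoint T) (hsa' : IsSelfAdjoint T') (hc : IsCompactOperator (T - T')) :
    essSpec (shiftedInverse T hT κ) = essSpec (shiftedInverse T' hT' κ) := by
  have hcs : ∀ c : ℂ, IsCompactOperator (c • (T - T')) := fun c => hc.smul c
  ext w
  rw [← not_iff_not, notMem_essSpec_shiftedInverse hsa, notMem_essSpec_shiftedInverse hsa']
  constructor
  · rintro ⟨K, hK, hU⟩
    -- The compact correction absorbs the difference of the two pencils, which is a multiple of the
    -- compact T − T'.
    refine ⟨K - (w + κ) • (T - T'), hK.sub (hcs _), ?_⟩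
    convert hU using 1
    rw [smul_sub]; abel
  · rintro ⟨K, hK, hU⟩
    refine ⟨K + (w + κ) • (T - T'), hK.add (hcs _), ?_⟩
    convert hU using 1
    rw [smul_sub]; abel

end ShiftedInverse

/-! ### Quadratic forms determine selfadjoint operators -/

section Uniqueness

variable {H : Type*} [NormedAddCommGroup H] [InnerProductSpace ℂ H]

lemma formApprox_const (A : H →ₗ.[ℂ] H) (g : A.domain) : FormApprox A (fun _ => g) g := by
  refine ⟨tendsto_const_nhds, fun δ hδ => ⟨0, fun m _ n _ => ?_⟩⟩
  simpa using hδ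

lemma HasQuadraticForm.mem_of_domain {A : H →ₗ.[ℂ] H} {Q : Set H} {a : H → ℂ}
    (h : HasQuadraticForm A Q a) (g : A.domain) : (g : H) ∈ Q :=
  (h.1 g).2 ⟨_, formApprox_const A g⟩

variable [CompleteSpace H]

/-- Polarization of the form when one argument is in the operator domain. Adding a fixed g to an
approximating sequence keeps it form-Cauchy, and the cross terms converge using only convergence in
H. -/
lemma HasQuadraticForm.add_apply {A : H →ₗ.[ℂ] H} (hA : IsSelfAdjoint A) {Q : Set H} {a : H → ℂ}
    (h : HasQuadraticForm A Q a) {f : H} (hf : f ∈ Q) (g : A.domain) :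
    a (f + g) = a f + a g + ⟪f, A g⟫_ℂ + ⟪A g, f⟫_ℂ := by
  obtain ⟨u, hu⟩ := (h.1 f).1 hf
  have hsym : ∀ x y : A.domain, ⟪A x, (y : H)⟫_ℂ = ⟪(x : H), A y⟫_ℂ := by
    intro x y
    have h1 := LinearPMap.adjoint_isFormalAdjoint hA.dense_domain
    rw [LinearPMap.isSelfAdjoint_def.1 hA] at h1
    exact h1 x y
  have hug : FormApprox A (fun n => u n + g) (f + g) := by
    refine ⟨by simpa using hu.1.add_const (g : H), fun δ hδ => ?_⟩
    simpa using hu.2 δ hδ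
  have h1 := h.2 _ _ hug
  have h2 := h.2 _ _ hu
  have h3 : a g = ⟪(g : H), A g⟫_ℂ :=
    tendsto_nhds_unique (h.2 _ _ (formApprox_const A g)) tendsto_const_nhds
  have h4 : Tendsto (fun n => ⟪((u n + g : A.domain) : H), A (u n + g)⟫_ℂ) atTop
      (𝓝 (a f + a g + ⟪f, A g⟫_ℂ + ⟪A g, f⟫_ℂ)) := by
    have h5 := ((h2.add_const (a g)).add
      (Filter.Tendsto.inner (𝕜 := ℂ) hu.1 (tendsto_const_nhds (x := A g)))).add
      (Filter.Tendsto.inner (𝕜 := ℂ) (tendsto_const_nhds (x := A g)) hu.1)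
    refine h5.congr fun n => ?_
    simp only [LinearPMap.map_add, Submodule.coe_add, inner_add_left, inner_add_right, h3,
      hsym g (u n)]
    ring
  exact tendsto_nhds_unique h1 h4

/-- Expanding a(f + g) once through A and once through A' shows that ⟪A' g, f⟫ and ⟪g, A f⟫ have the
same real part; replacing f by i f gives the imaginary part. Hence A' lies below the adjoint of A,
which is A. -/
lemma HasQuadraticForm.le_of_isSelfAdjoint {A A' : H →ₗ.[ℂ] H} (hA : IsSelfAdjoint A)
    (hA' : IsSelfAdjoint A') {Q : Set H} {a : H → ℂ} (h : HasQuadraticForm A Q a)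
    (h' : HasQuadraticForm A' Q a) : A' ≤ A := by
  have hre : ∀ (f : A.domain) (g : A'.domain),
      (⟪A' g, (f : H)⟫_ℂ).re = (⟪(g : H), A f⟫_ℂ).re := by
    intro f g
    have h1 := h.add_apply hA (h'.mem_of_domain g) f
    have h2 := h'.add_apply hA' (h.mem_of_domain f) g
    rw [add_comm, h2, ← inner_conj_symm (f : H), ← inner_conj_symm (A f)] at h1
    have h3 := congrArg Complex.re h1
    simp only [Complex.add_re, Complex.conj_re] at h3
    linarith
  have key : ∀ (g : A'.domain) (f : A.domain), ⟪A' g, (f : H)⟫_ℂ = ⟪(g : H), A f⟫_ℂ := by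
    intro g f
    refine Complex.ext (hre f g) ?_
    have h1 := hre (Complex.I • f) g
    rw [LinearPMap.map_smul, Submodule.coe_smul, inner_smul_right, inner_smul_right] at h1
    simpa using h1
  have hd := hA.dense_domain
  have hdom : ∀ g : A'.domain, (g : H) ∈ (LinearPMap.adjoint A).domain := fun g =>
    LinearPMap.mem_adjoint_domain_of_exists (T := A) (g : H) ⟨A' g, key g⟩
  have hle : A' ≤ LinearPMap.adjoint A := by
    refine ⟨fun g hg => hdom ⟨g, hg⟩, ?_⟩
    rintro ⟨g, hg⟩ ⟨g', hg'⟩ (rfl : g = g')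
    exact (LinearPMap.adjoint_apply_eq hd ⟨g, hg'⟩ (key ⟨g, hg⟩)).symm
  rwa [LinearPMap.isSelfAdjoint_def.1 hA] at hle

lemma HasQuadraticForm.unique {A A' : H →ₗ.[ℂ] H} (hA : IsSelfAdjoint A)
    (hA' : IsSelfAdjoint A') {Q : Set H} {a : H → ℂ} (h : HasQuadraticForm A Q a)
    (h' : HasQuadraticForm A' Q a) : A' = A :=
  le_antisymm (h.le_of_isSelfAdjoint hA hA' h') (h'.le_of_isSelfAdjoint hA' hA h)

end Uniqueness

/-! ### Operators defined by a form `⟪y, J y⟫` on the range of `B` -/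

/-- Bounded selfadjoint operators `B` (injective) and `J` (coercive), describing the positive
operator `B⁻¹ J B⁻¹`. -/
structure FormFactors (H : Type*) [NormedAddCommGroup H] [InnerProductSpace ℂ H]
    [CompleteSpace H] where
  B : H →L[ℂ] H
  J : H →L[ℂ] H
  invJ : H →L[ℂ] H
  isSelfAdjoint_B : IsSelfAdjoint B
  injective_B : Function.Injective B
  isSelfAdjoint_J : IsSelfAdjoint J
  coercive : ∀ y, 1 / 2 * ‖y‖ ^ 2 ≤ (⟪y, J y⟫_ℂ).re
  J_invJ : J * invJ = 1
  invJ_J : invJ * J = 1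

namespace FormFactors

variable {H : Type*} [NormedAddCommGroup H] [InnerProductSpace ℂ H] [CompleteSpace H]
variable (D : FormFactors H)

lemma J_invJ_apply (x : H) : D.J (D.invJ x) = x := by
  rw [← mul_apply_eq_comp, D.J_invJ, one_apply_eq_self]

lemma invJ_J_apply (x : H) : D.invJ (D.J x) = x := by
  rw [← mul_apply_eq_comp, D.invJ_J, one_apply_eq_self]

lemma inner_B (x y : H) : ⟪D.B x, y⟫_ℂ = ⟪x, D.B y⟫_ℂ :=
  ContinuousLinearMap.isSelfAdjoint_iff_isSymmetric.1 D.isSelfAdjoint_B x y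

lemma inner_J (x y : H) : ⟪D.J x, y⟫_ℂ = ⟪x, D.J y⟫_ℂ :=
  ContinuousLinearMap.isSelfAdjoint_iff_isSymmetric.1 D.isSelfAdjoint_J x y

lemma inner_invJ (x y : H) : ⟪D.invJ x, y⟫_ℂ = ⟪x, D.invJ y⟫_ℂ := by
  conv_lhs => rw [← D.J_invJ_apply y]
  rw [← D.inner_J, D.J_invJ_apply]

lemma norm_invJ_le (x : H) : ‖D.invJ x‖ ≤ 2 * ‖x‖ := by
  have h := D.coercive (D.invJ x)
  rw [D.J_invJ_apply] at h
  have h2 : (⟪D.invJ x, x⟫_ℂ).re ≤ ‖D.invJ x‖ * ‖x‖ :=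
    (Complex.re_le_norm _).trans (norm_inner_le_norm _ _)
  by_contra! hlt
  nlinarith [norm_nonneg x, norm_nonneg (D.invJ x)]

/-- The inverse of `B⁻¹ J B⁻¹`. -/
def T : H →L[ℂ] H := D.B * D.invJ * D.B

lemma T_apply (x : H) : D.T x = D.B (D.invJ (D.B x)) := rfl

lemma isSelfAdjoint_T : IsSelfAdjoint D.T := by
  refine ContinuousLinearMap.isSelfAdjoint_iff_isSymmetric.2 fun x y => ?_
  change ⟪D.T x, y⟫_ℂ = ⟪x, D.T y⟫_ℂ
  rw [T_apply, T_apply, D.inner_B, D.inner_invJ, D.inner_B]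

lemma injective_invJ : Function.Injective D.invJ := fun x y h => by
  rw [← D.J_invJ_apply x, h, D.J_invJ_apply]

lemma injective_T : Function.Injective D.T :=
  D.injective_B.comp (D.injective_invJ.comp D.injective_B)

/-- The operator `B⁻¹ J B⁻¹ - κ`. -/
def op (κ : ℝ) : H →ₗ.[ℂ] H := shiftedInverse D.T D.injective_T κ

lemma isSelfAdjoint_op (κ : ℝ) : IsSelfAdjoint (D.op κ) :=
  isSelfAdjoint_shiftedInverse D.isSelfAdjoint_T

/-- If g = T x = B y, then J y = B x, and moving one B across the inner product turns ⟪g, x⟫ into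
⟪y, J y⟫. -/
lemma inner_op_apply {κ : ℝ} (g : (D.op κ).domain) {y : H} (hy : (g : H) = D.B y) :
    ⟪(g : H), D.op κ g⟫_ℂ = ⟪y, D.J y⟫_ℂ - κ * ⟪D.B y, D.B y⟫_ℂ := by
  obtain ⟨x, hx, hLx⟩ := exists_eq_of_domain_shiftedInverse g
  have hyx : y = D.invJ (D.B x) := D.injective_B (by rw [← hy, hx, T_apply])
  change ⟪(g : H), shiftedInverse D.T D.injective_T κ g⟫_ℂ = _
  rw [hLx, ← hx, hy, inner_sub_right, inner_smul_right, D.inner_B, hyx, D.J_invJ_apply]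

lemma exists_eq_B_of_domain {κ : ℝ} (g : (D.op κ).domain) : ∃ y, (g : H) = D.B y := by
  obtain ⟨x, hx, -⟩ := exists_eq_of_domain_shiftedInverse g
  exact ⟨_, hx⟩

lemma isSemibounded_op (κ : ℝ) : IsSemibounded (D.op κ) := by
  refine ⟨-κ, fun g => ?_⟩
  obtain ⟨y, hy⟩ := D.exists_eq_B_of_domain g
  rw [D.inner_op_apply g hy, hy, inner_self_eq_norm_sq_to_K]
  have h := D.coercive y
  have h2 : ((κ : ℂ) * ((‖D.B y‖ : ℝ) : ℂ) ^ 2).re = κ * ‖D.B y‖ ^ 2 := by norm_cast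
  change _ ≤ (_ - (κ : ℂ) * ((‖D.B y‖ : ℝ) : ℂ) ^ 2).re
  rw [Complex.sub_re, h2]
  nlinarith [sq_nonneg ‖y‖]

/-- By coercivity of J, a sequence B yₙ that converges in H and is form-Cauchy is the same thing as
a convergent sequence yₙ. So the closure of the form lives exactly on the range of B. -/
lemma hasQuadraticForm_op {κ : ℝ} {Q : Set H} {a : H → ℂ} (hQ : ∀ f, f ∈ Q ↔ ∃ y, f = D.B y)
    (ha : ∀ y, a (D.B y) = ⟪y, D.J y⟫_ℂ - κ * ⟪D.B y, D.B y⟫_ℂ) :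
    HasQuadraticForm (D.op κ) Q a := by
  have hlim : ∀ (u : ℕ → (D.op κ).domain) (f : H), FormApprox (D.op κ) u f →
      ∃ y, f = D.B y ∧ Tendsto (fun n => ⟪(u n : H), D.op κ (u n)⟫_ℂ) atTop
        (𝓝 (⟪y, D.J y⟫_ℂ - κ * ⟪D.B y, D.B y⟫_ℂ)) := by
    intro u f hu
    choose y hy using fun n => D.exists_eq_B_of_domain (u n)
    have hcau : CauchySeq y := by
      rw [Metric.cauchySeq_iff]
      intro δ hδ
      -- Tolerances: the form and the κ-term contribute δ²/8 each, so half of ‖y m − y n‖² is at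
      -- most δ²/4. The summand 1 avoids dividing by zero.
      have hpos : 0 < δ ^ 2 / (8 * (|κ| + 1)) := by positivity
      obtain ⟨N, hN⟩ := hu.2 (δ ^ 2 / 8) (by positivity)
      obtain ⟨N', hN'⟩ := Metric.cauchySeq_iff.1 hu.1.cauchySeq (Real.sqrt (δ ^ 2 / (8 * (|κ| + 1))))
        (Real.sqrt_pos.2 hpos)
      refine ⟨max N N', fun m hm n hn => ?_⟩
      have h1 := hN m (le_of_max_le_left hm) n (le_of_max_le_left hn)
      have h2 := hN' m (le_of_max_le_right hm) n (le_of_max_le_right hn)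
      have h3 : ((u m - u n : (D.op κ).domain) : H) = D.B (y m - y n) := by
        rw [map_sub, ← hy, ← hy]; rfl
      rw [D.inner_op_apply _ h3] at h1
      have h4 := D.coercive (y m - y n)
      have h5 := (Complex.re_le_norm _).trans h1.le
      rw [inner_self_eq_norm_sq_to_K] at h5
      have h6 : ((κ : ℂ) * ((‖D.B (y m - y n)‖ : ℝ) : ℂ) ^ 2).re =
        κ * ‖D.B (y m - y n)‖ ^ 2 := by norm_cast
      change (_ - (κ : ℂ) * ((‖D.B (y m - y n)‖ : ℝ) : ℂ) ^ 2).re ≤ _ at h5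
      rw [Complex.sub_re, h6] at h5
      rw [dist_eq_norm] at h2 ⊢
      have h7 : ‖D.B (y m - y n)‖ = ‖(u m : H) - u n‖ := by rw [map_sub, ← hy, ← hy]
      rw [h7] at h5
      have h8 : ‖(u m : H) - u n‖ ^ 2 < δ ^ 2 / (8 * (|κ| + 1)) := by
        rwa [Real.lt_sqrt (norm_nonneg _)] at h2
      have h9 : κ * ‖(u m : H) - u n‖ ^ 2 ≤ δ ^ 2 / 8 := by
        calc κ * ‖(u m : H) - u n‖ ^ 2 ≤ (|κ| + 1) * (δ ^ 2 / (8 * (|κ| + 1))) :=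
              mul_le_mul ((le_abs_self κ).trans (by linarith)) h8.le (by positivity)
                (by positivity)
          _ = δ ^ 2 / 8 := by field_simp
      have : ‖y m - y n‖ ^ 2 < δ ^ 2 := by nlinarith
      exact lt_of_pow_lt_pow_left₀ 2 hδ.le this
    obtain ⟨y₀, hy₀⟩ := cauchySeq_tendsto_of_complete hcau
    have hf : f = D.B y₀ := by
      refine tendsto_nhds_unique hu.1 ?_
      simp only [hy]
      exact (D.B.continuous.tendsto _).comp hy₀
    refine ⟨y₀, hf, ?_⟩
    have h1 : ∀ n, ⟪(u n : H), D.op κ (u n)⟫_ℂ =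
        ⟪y n, D.J (y n)⟫_ℂ - κ * ⟪D.B (y n), D.B (y n)⟫_ℂ := fun n => D.inner_op_apply _ (hy n)
    simp only [h1]
    have hc : Continuous fun y => ⟪y, D.J y⟫_ℂ - κ * ⟪D.B y, D.B y⟫_ℂ := by fun_prop
    exact (hc.tendsto y₀).comp hy₀
  refine ⟨fun f => ⟨fun hf => ?_, ?_⟩, ?_⟩
  · obtain ⟨y, rfl⟩ := (hQ f).1 hf
    -- The operator domain is B applied to the range of J⁻¹B; density of that range lets every B y
    -- be approximated in form.
    have hd : DenseRange (D.invJ ∘ D.B) := by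
      have hs : Function.Surjective D.invJ := fun z => ⟨D.J z, D.invJ_J_apply z⟩
      exact hs.denseRange.comp (dense_range_of_isSelfAdjoint D.isSelfAdjoint_B D.injective_B)
        D.invJ.continuous
    obtain ⟨v, hv, hvl⟩ := mem_closure_iff_seq_limit.1 (hd y)
    choose x hx using hv
    refine ⟨fun n => ⟨D.T (x n), mem_domain_shiftedInverse _⟩, ?_, ?_⟩
    · have h1 := (D.B.continuous.tendsto y).comp hvl
      refine h1.congr fun n => ?_
      simp only [Function.comp_apply, ← hx]; rfl
    · intro δ hδ
      have hc : Continuous fun p : H × H => ‖⟪p.1 - p.2, D.J (p.1 - p.2)⟫_ℂ -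
          κ * ⟪D.B (p.1 - p.2), D.B (p.1 - p.2)⟫_ℂ‖ := by fun_prop
      have h1 : Tendsto (fun p : ℕ × ℕ => (v p.1, v p.2)) atTop (𝓝 (y, y)) := by
        rw [← prod_atTop_atTop_eq, nhds_prod_eq]
        exact hvl.prodMap hvl
      have h2 := (hc.tendsto (y, y)).comp h1
      simp only [sub_self, map_zero, inner_zero_left, mul_zero, norm_zero] at h2
      obtain ⟨⟨N, N'⟩, hN⟩ := eventually_atTop.1 (h2.eventually (gt_mem_nhds hδ))
      refine ⟨max N N', fun m hm n hn => ?_⟩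
      rw [D.inner_op_apply (y := v m - v n) _ ?_]
      · exact hN (m, n) ⟨le_of_max_le_left hm, le_of_max_le_right hn⟩
      · rw [map_sub, ← hx, ← hx]; rfl
  · rintro ⟨u, hu⟩
    obtain ⟨y, hy, -⟩ := hlim u f hu
    exact (hQ f).2 ⟨y, hy⟩
  · intro f u hu
    obtain ⟨y, rfl, hy⟩ := hlim u f hu
    rw [ha]
    exact hy

/-- The weak form of the equation `(B⁻¹ J B⁻¹ - κ + z) u = B⁻¹ b`. -/
lemma weak_equation_iff {κ : ℝ} {z : ℂ} {u b : H} :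
    (∀ x, ⟪x - (κ : ℂ) • D.T x, u⟫_ℂ + z * ⟪D.T x, u⟫_ℂ = ⟪D.invJ (D.B x), b⟫_ℂ) ↔
      (1 - (-z + κ) • D.T) u = D.B (D.invJ b) := by
  have h : ∀ x, ⟪x - (κ : ℂ) • D.T x, u⟫_ℂ + z * ⟪D.T x, u⟫_ℂ =
      ⟪x, (1 - (-z + κ) • D.T) u⟫_ℂ := by
    intro x
    have h1 : ⟪D.T x, u⟫_ℂ = ⟪x, D.T u⟫_ℂ :=
      ContinuousLinearMap.isSelfAdjoint_iff_isSymmetric.1 D.isSelfAdjoint_T x u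
    simp only [inner_sub_left, inner_smul_left, Complex.conj_ofReal, h1, sub_apply,
      one_apply_eq_self, smul_apply, inner_sub_right, inner_smul_right]
    ring
  simp only [h, D.inner_invJ, D.inner_B]
  constructor
  · exact fun h => ext_inner_left ℂ h
  · exact fun h x => by rw [h]

end FormFactors

/-! ### Hilbert–Schmidt operators -/

section HilbertSchmidt

/-- The truncations to finitely many basis vectors have finite rank. They converge to A in operator
norm, by Cauchy–Schwarz, Bessel's inequality and the vanishing tails of the sum; compact operators
form a closed set. -/
lemma HilbertBasis.isCompactOperator_of_summable {ι H H' : Type*} [NormedAddCommGroup H]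
    [InnerProductSpace ℂ H] [NormedAddCommGroup H'] [NormedSpace ℂ H']
    [CompleteSpace H'] (b : HilbertBasis ι ℂ H) (A : H →L[ℂ] H')
    (hA : Summable fun i => ‖A (b i)‖ ^ 2) : IsCompactOperator A := by
  classical
  let AF : Finset ι → (H →L[ℂ] H') := fun F => ∑ i ∈ F, (innerSL ℂ (b i)).smulRight (A (b i))
  have hAF : ∀ F x, AF F x = ∑ i ∈ F, ⟪b i, x⟫_ℂ • A (b i) := by
    intro F x
    simp [AF]
  have hcomp : ∀ F, IsCompactOperator (AF F) := by
    intro F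
    refine Submodule.sum_mem (compactOperator (RingHom.id ℂ) H H') fun i _ => ?_
    change IsCompactOperator (((innerSL ℂ (b i)).smulRight (A (b i)) : H →L[ℂ] H') : H → H')
    have h1 : IsCompactOperator (innerSL ℂ (b i) : H →L[ℂ] ℂ) :=
      isCompactOperator_of_locallyCompactSpace_dom _
    exact h1.clm_comp (ContinuousLinearMap.toSpanSingleton ℂ (A (b i)))
  have hclosed := isClosed_setOfPred_isCompactOperator (σ₁₂ := RingHom.id ℂ) (M₁ := H) (M₂ := H')
  have hmem : A ∈ closure {f : H →L[ℂ] H' | IsCompactOperator f} := by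
    rw [Metric.mem_closure_iff]
    intro ε hε
    obtain ⟨F, hF⟩ := summable_iff_vanishing_norm.1 hA ((ε / 2) ^ 2) (by positivity)
    refine ⟨AF F, hcomp F, ?_⟩
    rw [dist_eq_norm]
    refine lt_of_le_of_lt (ContinuousLinearMap.opNorm_le_bound _ (by positivity) fun x => ?_)
      (half_lt_self hε)
    have hs : HasSum (fun i => ⟪b i, x⟫_ℂ • A (b i)) (A x) := by
      have := (b.hasSum_repr x).mapL A
      simpa only [map_smul, b.repr_apply_apply] using this
    have hlim : Tendsto (fun G : Finset ι => ∑ i ∈ G, ⟪b i, x⟫_ℂ • A (b i) - AF F x) atTop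
        (𝓝 ((A - AF F) x)) := hs.sub_const _
    refine le_of_tendsto hlim.norm ?_
    filter_upwards [eventually_ge_atTop F] with G hG
    rw [hAF, ← Finset.sum_sdiff hG, add_sub_cancel_right]
    have h1 := hF (G \ F) Finset.sdiff_disjoint
    rw [Real.norm_of_nonneg (Finset.sum_nonneg fun i _ => by positivity)] at h1
    calc ‖∑ i ∈ G \ F, ⟪b i, x⟫_ℂ • A (b i)‖
        ≤ ∑ i ∈ G \ F, ‖⟪b i, x⟫_ℂ‖ * ‖A (b i)‖ :=
          (norm_sum_le _ _).trans (Finset.sum_le_sum fun i _ => (norm_smul _ _).le)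
      _ ≤ Real.sqrt (∑ i ∈ G \ F, ‖⟪b i, x⟫_ℂ‖ ^ 2) * Real.sqrt (∑ i ∈ G \ F, ‖A (b i)‖ ^ 2) :=
          Real.sum_mul_le_sqrt_mul_sqrt _ _ _
      _ ≤ ‖x‖ * (ε / 2) := by
          refine mul_le_mul ?_ ?_ (Real.sqrt_nonneg _) (norm_nonneg _)
          · rw [Real.sqrt_le_left (norm_nonneg _)]
            exact b.orthonormal.sum_inner_products_le x
          · rw [Real.sqrt_le_left (by positivity)]
            exact h1.le
      _ = ε / 2 * ‖x‖ := mul_comm _ _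
  exact hclosed.closure_subset hmem

variable {α : Type*} [MeasurableSpace α] {ν : Measure α}

lemma eLpNorm_two_sq (f : α → ℂ) : eLpNorm f 2 ν ^ 2 = ∫⁻ x, ‖f x‖ₑ ^ 2 ∂ν := by
  have := eLpNorm_nnreal_pow_eq_lintegral (f := f) (μ := ν) (p := 2) two_ne_zero
  simpa using this

lemma memLp_two_iff {f : α → ℂ} (hf : AEStronglyMeasurable f ν) :
    MemLp f 2 ν ↔ ∫⁻ x, ‖f x‖ₑ ^ 2 ∂ν ≠ ∞ := by
  rw [← eLpNorm_two_sq]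
  simp [MemLp, hf, lt_top_iff_ne_top]

lemma lintegral_enorm_sq_Lp (f : Lp ℂ 2 ν) : ∫⁻ x, ‖f x‖ₑ ^ 2 ∂ν = ‖f‖ₑ ^ 2 := by
  rw [← eLpNorm_two_sq, Lp.enorm_def]

lemma sq_lintegral_mul_le {f g : α → ℝ≥0∞} (hf : AEMeasurable f ν) (hg : AEMeasurable g ν) :
    (∫⁻ x, f x * g x ∂ν) ^ 2 ≤ (∫⁻ x, f x ^ 2 ∂ν) * ∫⁻ x, g x ^ 2 ∂ν := by
  have h := ENNReal.lintegral_mul_le_Lp_mul_Lq ν Real.HolderConjugate.two_two hf hg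
  simp only [Pi.mul_apply, ENNReal.rpow_two] at h
  refine (pow_le_pow_left' h 2).trans ?_
  rw [mul_pow]
  simp only [← ENNReal.rpow_two, ← ENNReal.rpow_mul]
  norm_num

variable [SFinite ν] {k : α × α → ℂ}

/-- The function `x ↦ ∫ k (x, y) f y dν(y)`. -/
def kernelFun (ν : Measure α) (k : α × α → ℂ) (f : α → ℂ) (x : α) : ℂ := ∫ y, k (x, y) * f y ∂ν

lemma stronglyMeasurable_kernelFun (hk : StronglyMeasurable k) {f : α → ℂ}
    (hf : StronglyMeasurable f) : StronglyMeasurable (kernelFun ν k f) := by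
  refine StronglyMeasurable.integral_prod_right (f := fun x y => k (x, y) * f y) ?_
  exact hk.mul (hf.comp_measurable measurable_snd)

lemma enorm_kernelFun_sq_le (hk : StronglyMeasurable k) {f : α → ℂ}
    (hf : AEStronglyMeasurable f ν) (x : α) :
    ‖kernelFun ν k f x‖ₑ ^ 2 ≤ (∫⁻ y, ‖k (x, y)‖ₑ ^ 2 ∂ν) * ∫⁻ y, ‖f y‖ₑ ^ 2 ∂ν := by
  refine le_trans ?_ (sq_lintegral_mul_le (hk.comp_measurable measurable_prodMk_left).enorm.aemeasurable
    hf.enorm)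
  refine pow_le_pow_left' ((enorm_integral_le_lintegral_enorm _).trans_eq ?_) 2
  simp [enorm_mul]

lemma lintegral_enorm_kernelFun_sq_le (hk : StronglyMeasurable k) {f : α → ℂ}
    (hf : AEStronglyMeasurable f ν) :
    ∫⁻ x, ‖kernelFun ν k f x‖ₑ ^ 2 ∂ν ≤
      (∫⁻ p, ‖k p‖ₑ ^ 2 ∂(ν.prod ν)) * ∫⁻ y, ‖f y‖ₑ ^ 2 ∂ν := by
  have hm : Measurable fun p => ‖k p‖ₑ ^ 2 := hk.enorm.pow_const 2
  rw [lintegral_prod _ hm.aemeasurable, ← lintegral_mul_const _ hm.lintegral_prod_right']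
  exact lintegral_mono fun x => enorm_kernelFun_sq_le hk hf x

lemma ae_memLp_kernel (hk : StronglyMeasurable k) (hk2 : ∫⁻ p, ‖k p‖ₑ ^ 2 ∂(ν.prod ν) ≠ ∞) :
    ∀ᵐ x ∂ν, MemLp (fun y => k (x, y)) 2 ν := by
  have hm : Measurable fun p => ‖k p‖ₑ ^ 2 := hk.enorm.pow_const 2
  rw [lintegral_prod _ hm.aemeasurable] at hk2
  filter_upwards [ae_lt_top hm.lintegral_prod_right' hk2] with x hx
  exact (memLp_two_iff (hk.comp_measurable measurable_prodMk_left).aestronglyMeasurable).2 hx.ne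

lemma memLp_kernelFun (hk : StronglyMeasurable k) (hk2 : ∫⁻ p, ‖k p‖ₑ ^ 2 ∂(ν.prod ν) ≠ ∞)
    (f : Lp ℂ 2 ν) : MemLp (kernelFun ν k f) 2 ν := by
  rw [memLp_two_iff (stronglyMeasurable_kernelFun hk (Lp.stronglyMeasurable f)).aestronglyMeasurable]
  refine ne_top_of_le_ne_top ?_ (lintegral_enorm_kernelFun_sq_le hk (Lp.aestronglyMeasurable f))
  rw [lintegral_enorm_sq_Lp]
  exact ENNReal.mul_ne_top hk2 (by simp)

/-- A square integrable kernel. -/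
structure HSKernel (ν : Measure α) (k : α × α → ℂ) (C : ℝ) : Prop where
  meas : StronglyMeasurable k
  nonneg : 0 ≤ C
  le : ∫⁻ p, ‖k p‖ₑ ^ 2 ∂(ν.prod ν) ≤ ENNReal.ofReal C ^ 2

namespace HSKernel

variable {C : ℝ} (h : HSKernel ν k C)
include h

lemma ne_top : ∫⁻ p, ‖k p‖ₑ ^ 2 ∂(ν.prod ν) ≠ ∞ := ne_top_of_le_ne_top (by simp) h.le

lemma norm_toLp_le (f : Lp ℂ 2 ν) :
    ‖(memLp_kernelFun h.meas h.ne_top f).toLp‖ ≤ C * ‖f‖ := by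
  have h1 := lintegral_enorm_kernelFun_sq_le h.meas (Lp.aestronglyMeasurable f)
  rw [lintegral_enorm_sq_Lp, ← eLpNorm_two_sq] at h1
  have h2 : eLpNorm (kernelFun ν k f) 2 ν ≤ ENNReal.ofReal C * ‖f‖ₑ := by
    have h3 := h1.trans (mul_le_mul_left h.le _)
    rw [← mul_pow] at h3
    exact (ENNReal.pow_le_pow_left_iff two_ne_zero).1 h3
  rw [Lp.norm_toLp]
  refine ENNReal.toReal_le_of_le_ofReal (mul_nonneg h.nonneg (norm_nonneg _)) ?_
  rwa [ENNReal.ofReal_mul h.nonneg, ofReal_norm]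

/-- The integral operator with kernel `k`. -/
def op : Lp ℂ 2 ν →L[ℂ] Lp ℂ 2 ν :=
  LinearMap.mkContinuous
    { toFun := fun f => (memLp_kernelFun h.meas h.ne_top f).toLp
      map_add' := by
        intro f g
        rw [← MemLp.toLp_add]
        refine MemLp.toLp_congr _ _ ?_
        filter_upwards [ae_memLp_kernel h.meas h.ne_top] with x hx
        have hf : Integrable (fun y => k (x, y) * f y) ν := hx.integrable_mul (Lp.memLp f)
        have hg : Integrable (fun y => k (x, y) * g y) ν := hx.integrable_mul (Lp.memLp g)
        rw [Pi.add_apply, kernelFun, kernelFun, kernelFun, ← integral_add hf hg]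
        refine integral_congr_ae ?_
        filter_upwards [Lp.coeFn_add f g] with y hy
        rw [hy, Pi.add_apply, mul_add]
      map_smul' := by
        intro c f
        rw [RingHom.id_apply, ← MemLp.toLp_const_smul]
        refine MemLp.toLp_congr _ _ (Eventually.of_forall fun x => ?_)
        rw [Pi.smul_apply, kernelFun, kernelFun, smul_eq_mul, ← integral_const_mul]
        refine integral_congr_ae ?_
        filter_upwards [Lp.coeFn_smul c f] with y hy
        rw [hy, Pi.smul_apply, smul_eq_mul, mul_left_comm] } C h.norm_toLp_le

lemma op_coeFn (f : Lp ℂ 2 ν) : h.op f =ᵐ[ν] kernelFun ν k f :=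
  (memLp_kernelFun h.meas h.ne_top f).coeFn_toLp

lemma norm_op_apply_le (f : Lp ℂ 2 ν) : ‖h.op f‖ ≤ C * ‖f‖ := h.norm_toLp_le f

/-- The tensor product of conj g and f is square integrable for the product measure, and so is k.
This justifies Fubini in the computations of matrix elements. -/
lemma integrable (f g : Lp ℂ 2 ν) :
    Integrable (fun p : α × α => (starRingEnd ℂ) (g p.1) * (k p * f p.2)) (ν.prod ν) := by
  have hm : AEStronglyMeasurable (fun p : α × α => (starRingEnd ℂ) (g p.1) * f p.2)
      (ν.prod ν) := by
    refine AEStronglyMeasurable.mul ?_ ?_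
    · exact (Complex.continuous_conj.comp_stronglyMeasurable
        ((Lp.stronglyMeasurable g).comp_measurable measurable_fst)).aestronglyMeasurable
    · exact ((Lp.stronglyMeasurable f).comp_measurable measurable_snd).aestronglyMeasurable
  have h1 : MemLp (fun p : α × α => (starRingEnd ℂ) (g p.1) * f p.2) 2 (ν.prod ν) := by
    rw [memLp_two_iff hm]
    have : ∀ p : α × α, ‖(starRingEnd ℂ) (g p.1) * f p.2‖ₑ ^ 2 =
        ‖g p.1‖ₑ ^ 2 * ‖f p.2‖ₑ ^ 2 := by
      intro p
      rw [enorm_mul, mul_pow, RCLike.enorm_conj]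
    simp only [this]
    rw [lintegral_prod_mul ((Lp.stronglyMeasurable g).enorm.pow_const 2).aemeasurable
      ((Lp.stronglyMeasurable f).enorm.pow_const 2).aemeasurable, lintegral_enorm_sq_Lp,
      lintegral_enorm_sq_Lp]
    exact ENNReal.mul_ne_top (by simp) (by simp)
  have h2 : MemLp k 2 (ν.prod ν) := (memLp_two_iff h.meas.aestronglyMeasurable).2 h.ne_top
  refine (h2.integrable_mul h1).congr (Eventually.of_forall fun p => ?_)
  simp only [Pi.mul_apply]
  ring

lemma inner_op (f g : Lp ℂ 2 ν) : ⟪g, h.op f⟫_ℂ =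
    ∫ p, (starRingEnd ℂ) (g p.1) * (k p * f p.2) ∂(ν.prod ν) := by
  rw [integral_prod _ (h.integrable f g), L2.inner_def]
  refine integral_congr_ae ?_
  filter_upwards [h.op_coeFn f] with x hx
  rw [hx, RCLike.inner_apply, integral_const_mul, mul_comm]
  rfl

lemma isSelfAdjoint_op (hsymm : ∀ x y, k (y, x) = (starRingEnd ℂ) (k (x, y))) :
    IsSelfAdjoint h.op := by
  refine ContinuousLinearMap.isSelfAdjoint_iff_isSymmetric.2 fun f g => ?_
  change ⟪h.op f, g⟫_ℂ = ⟪f, h.op g⟫_ℂ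
  rw [← inner_conj_symm, h.inner_op, h.inner_op, ← integral_conj, ← integral_prod_swap]
  refine integral_congr_ae (Eventually.of_forall fun p => ?_)
  simp only [map_mul, Complex.conj_conj, Prod.fst_swap, Prod.snd_swap]
  rw [← hsymm p.swap.1 p.swap.2]
  simp only [Prod.fst_swap, Prod.snd_swap, Prod.mk.eta]
  ring

/-- For almost every x the values at x of the images of the basis vectors are inner products with
conj k(x, ·). Bessel's inequality bounds their square sum by ∫|k(x, y)|² dy, and integrating in x
bounds the Hilbert–Schmidt sum. -/
lemma isCompactOperator_op : IsCompactOperator h.op := by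
  obtain ⟨w, b, -⟩ := exists_hilbertBasis ℂ (Lp ℂ 2 ν)
  refine HilbertBasis.isCompactOperator_of_summable b _ (summable_of_sum_le (c := C ^ 2)
    (fun i => by positivity) fun F => ?_)
  have key : ∑ i ∈ F, ‖h.op (b i)‖ₑ ^ 2 ≤ ENNReal.ofReal C ^ 2 := by
    calc ∑ i ∈ F, ‖h.op (b i)‖ₑ ^ 2
        = ∑ i ∈ F, ∫⁻ x, ‖kernelFun ν k (b i) x‖ₑ ^ 2 ∂ν := by
          refine Finset.sum_congr rfl fun i _ => ?_
          rw [← lintegral_enorm_sq_Lp]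
          refine lintegral_congr_ae ?_
          filter_upwards [h.op_coeFn (b i)] with x hx
          rw [hx]
      _ = ∫⁻ x, ∑ i ∈ F, ‖kernelFun ν k (b i) x‖ₑ ^ 2 ∂ν := by
          rw [lintegral_finsetSum]
          exact fun i _ => ((stronglyMeasurable_kernelFun h.meas
            (Lp.stronglyMeasurable (b i))).enorm.pow_const 2)
      _ ≤ ∫⁻ x, ∫⁻ y, ‖k (x, y)‖ₑ ^ 2 ∂ν ∂ν := by
          refine lintegral_mono_ae ?_
          filter_upwards [ae_memLp_kernel h.meas h.ne_top] with x hx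
          have hc : MemLp (fun y => (starRingEnd ℂ) (k (x, y))) 2 ν := hx.star
          have h1 : ∀ i, kernelFun ν k (b i) x = ⟪hc.toLp, b i⟫_ℂ := by
            intro i
            rw [L2.inner_def]
            refine integral_congr_ae ?_
            filter_upwards [hc.coeFn_toLp] with y hy
            rw [hy, RCLike.inner_apply, Complex.conj_conj, mul_comm]
          have h2 := b.orthonormal.sum_inner_products_le (s := F) hc.toLp
          have h3 : ∑ i ∈ F, ‖kernelFun ν k (b i) x‖ₑ ^ 2 =
              ENNReal.ofReal (∑ i ∈ F, ‖⟪b i, hc.toLp⟫_ℂ‖ ^ 2) := by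
            rw [ENNReal.ofReal_sum_of_nonneg (fun i _ => by positivity)]
            refine Finset.sum_congr rfl fun i _ => ?_
            rw [h1, ENNReal.ofReal_pow (norm_nonneg _), norm_inner_symm, ofReal_norm]
          rw [h3]
          refine (ENNReal.ofReal_le_ofReal h2).trans_eq ?_
          rw [ENNReal.ofReal_pow (norm_nonneg _), ofReal_norm, ← lintegral_enorm_sq_Lp]
          refine lintegral_congr_ae ?_
          filter_upwards [hc.coeFn_toLp] with y hy
          rw [hy, RCLike.enorm_conj]
      _ ≤ ENNReal.ofReal C ^ 2 := by
          rw [← lintegral_prod _ (h.meas.enorm.pow_const 2).aemeasurable]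
          exact h.le
  have h2 : ENNReal.ofReal (∑ i ∈ F, ‖h.op (b i)‖ ^ 2) ≤ ENNReal.ofReal (C ^ 2) := by
    rw [ENNReal.ofReal_sum_of_nonneg (fun i _ => by positivity), ENNReal.ofReal_pow h.nonneg]
    refine le_trans (le_of_eq (Finset.sum_congr rfl fun i _ => ?_)) key
    rw [ENNReal.ofReal_pow (norm_nonneg _), ofReal_norm]
  exact (ENNReal.ofReal_le_ofReal_iff (by positivity)).1 h2

end HSKernel

end HilbertSchmidt

/-! ### The frequency measure -/

instance (G : Geometry) : SFinite (freqMeasure G) := by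
  cases G <;> simp only [freqMeasure] <;> infer_instance

/-- Counting measure on 2πℤ is invariant only under shifts by the lattice, which are almost all
shifts for that same measure. The weaker form serves both geometries at once. -/
lemma ae_measurePreserving_add (G : Geometry) :
    ∀ᵐ η ∂(freqMeasure G), MeasurePreserving (fun ξ => ξ + η) (freqMeasure G) (freqMeasure G) := by
  cases G with
  | line => exact Eventually.of_forall fun η => measurePreserving_add_right volume η
  | circle =>
    refine ae_freqMeasure_circle.2 fun m => ⟨by fun_prop, ?_⟩
    simp only [freqMeasure]
    rw [Measure.map_sum (by fun_prop)]
    have h : ∀ n : ℤ, Measure.map (fun ξ : ℝ => ξ + 2 * Real.pi * (m : ℝ))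
        (Measure.dirac (2 * Real.pi * (n : ℝ))) =
        ((fun n : ℤ => Measure.dirac (2 * Real.pi * (n : ℝ))) ∘ Equiv.addRight m) n := by
      intro n
      rw [Measure.map_dirac' (by fun_prop)]
      simp only [Function.comp_apply, Equiv.coe_addRight]
      congr 1
      push_cast
      ring
    simp only [h]
    exact Measure.sum_comp_equiv (Equiv.addRight m) _

lemma measurePreserving_neg_freq (G : Geometry) :
    MeasurePreserving (fun ξ => -ξ) (freqMeasure G) (freqMeasure G) := by
  cases G with
  | line => exact Measure.measurePreserving_neg volume
  | circle =>
    refine ⟨by fun_prop, ?_⟩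
    simp only [freqMeasure]
    rw [Measure.map_sum (by fun_prop)]
    have h : ∀ n : ℤ, Measure.map (fun ξ : ℝ => -ξ) (Measure.dirac (2 * Real.pi * (n : ℝ))) =
        ((fun n : ℤ => Measure.dirac (2 * Real.pi * (n : ℝ))) ∘ Equiv.neg ℤ) n := by
      intro n
      rw [Measure.map_dirac' (by fun_prop)]
      simp only [Function.comp_apply, Equiv.neg_apply]
      congr 1
      push_cast
      ring
    simp only [h]
    exact Measure.sum_comp_equiv (Equiv.neg ℤ) _

/-- The change of variables `(η, ζ) ↦ (ζ + η, η)`. -/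
lemma measurePreserving_shear (G : Geometry) :
    MeasurePreserving (fun p : ℝ × ℝ => (p.2 + p.1, p.1))
      ((freqMeasure G).prod (freqMeasure G)) ((freqMeasure G).prod (freqMeasure G)) := by
  have h := MeasurePreserving.skew_product (MeasurePreserving.id (freqMeasure G))
    (g := fun η ζ : ℝ => ζ + η) (by fun_prop : Measurable fun p : ℝ × ℝ => p.2 + p.1)
    ((ae_measurePreserving_add G).mono fun η hη => hη.map_eq)
  exact Measure.measurePreserving_swap.comp h

/-- Scaling ξ ↦ κξ. -/
lemma lintegral_weight_line {p : ℝ} {κ : ℝ} (hκ : 0 < κ) :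
    ∫⁻ ξ : ℝ, ENNReal.ofReal ((|ξ| + κ) ^ (-p)) =
      ENNReal.ofReal (κ ^ (1 - p)) * ∫⁻ ξ : ℝ, ENNReal.ofReal ((1 + ‖ξ‖) ^ (-p)) := by
  conv_lhs => rw [← Real.smul_map_volume_mul_left hκ.ne']
  have h1 : Measurable fun ξ : ℝ => ENNReal.ofReal ((|ξ| + κ) ^ (-p)) := by fun_prop
  rw [lintegral_smul_measure, lintegral_map h1 (by fun_prop), abs_of_pos hκ]
  have h2 : ∀ ξ : ℝ, ENNReal.ofReal ((|κ * ξ| + κ) ^ (-p)) =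
      ENNReal.ofReal (κ ^ (-p)) * ENNReal.ofReal ((1 + ‖ξ‖) ^ (-p)) := by
    intro ξ
    rw [← ENNReal.ofReal_mul (by positivity), ← Real.mul_rpow hκ.le (by positivity), abs_mul,
      abs_of_pos hκ, Real.norm_eq_abs]
    congr 2
    ring
  simp only [h2]
  rw [lintegral_const_mul _ (by fun_prop), smul_eq_mul, ← mul_assoc,
    ← ENNReal.ofReal_mul hκ.le, sub_eq_add_neg, Real.rpow_add hκ, Real.rpow_one]

/-- The sum is compared with an integral over unit cells: for x in (n, n+1] one has |x| + κ ≤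
2(|2πn| + κ), where κ ≥ 1 absorbs the length of the cell. The factor 2 becomes 2^p. -/
lemma lintegral_weight_circle_le {p : ℝ} (hp : 0 ≤ p) {κ : ℝ} (hκ : 1 ≤ κ) :
    ∫⁻ ξ, ENNReal.ofReal ((|ξ| + κ) ^ (-p)) ∂(freqMeasure .circle) ≤
      ENNReal.ofReal (2 ^ p) * ∫⁻ ξ : ℝ, ENNReal.ofReal ((|ξ| + κ) ^ (-p)) := by
  simp only [freqMeasure]
  rw [lintegral_sum_measure, ← lintegral_const_mul _ (by fun_prop),
    ← setLIntegral_univ (μ := volume), ← iUnion_Ioc_intCast ℝ,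
    lintegral_iUnion (fun _ => measurableSet_Ioc) (pairwise_disjoint_Ioc_intCast ℝ)]
  refine ENNReal.tsum_le_tsum fun n => ?_
  rw [lintegral_dirac]
  calc ENNReal.ofReal ((|2 * Real.pi * (n : ℝ)| + κ) ^ (-p))
      = ∫⁻ _ in Ioc (n : ℝ) (n + 1), ENNReal.ofReal ((|2 * Real.pi * (n : ℝ)| + κ) ^ (-p)) := by
        simp
    _ ≤ _ := by
        refine setLIntegral_mono' measurableSet_Ioc fun x hx => ?_
        rw [← ENNReal.ofReal_mul (by positivity)]
        refine ENNReal.ofReal_le_ofReal ?_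
        have h1 : |x| ≤ |(n : ℝ)| + 1 := by
          have : x = n + (x - n) := by ring
          rw [this]
          refine (abs_add_le _ _).trans (add_le_add_right ?_ _)
          rw [abs_le]; constructor <;> linarith [hx.1, hx.2]
        have h2 : |(n : ℝ)| ≤ |2 * Real.pi * (n : ℝ)| := by
          rw [abs_mul, abs_of_pos (by positivity : 0 < 2 * Real.pi)]
          have := Real.pi_gt_three
          nlinarith [abs_nonneg (n : ℝ)]
        have h3 : (|x| + κ) ≤ 2 * (|2 * Real.pi * (n : ℝ)| + κ) := by
          linarith [abs_nonneg (2 * Real.pi * (n : ℝ))]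
        have h4 := Real.rpow_le_rpow_of_nonpos (by positivity) h3 (neg_nonpos.2 hp)
        rw [Real.mul_rpow (by norm_num) (by positivity)] at h4
        calc (|2 * Real.pi * (n : ℝ)| + κ) ^ (-p)
            = 2 ^ p * (2 ^ (-p) * (|2 * Real.pi * (n : ℝ)| + κ) ^ (-p)) := by
              rw [← mul_assoc, ← Real.rpow_add (by norm_num)]; simp
          _ ≤ _ := by gcongr

lemma exists_lintegral_weight_le (G : Geometry) {p : ℝ} (hp : 1 < p) :
    ∃ C : ℝ, 0 < C ∧ ∀ κ : ℝ, 1 ≤ κ →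
      ∫⁻ ξ, ENNReal.ofReal ((|ξ| + κ) ^ (-p)) ∂(freqMeasure G) ≤
        ENNReal.ofReal (C * κ ^ (1 - p)) := by
  have hfin : ∫⁻ ξ : ℝ, ENNReal.ofReal ((1 + ‖ξ‖) ^ (-p)) < ∞ :=
    finite_integral_one_add_norm (by simpa using hp)
  set I := ∫⁻ ξ : ℝ, ENNReal.ofReal ((1 + ‖ξ‖) ^ (-p)) with hI
  have hle : I ≤ ENNReal.ofReal (I.toReal + 1) := by
    rw [← ENNReal.ofReal_toReal hfin.ne]
    exact ENNReal.ofReal_le_ofReal (by rw [ENNReal.toReal_ofReal ENNReal.toReal_nonneg]; linarith)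
  have hIpos : 0 < I.toReal + 1 := by positivity
  have hline : ∀ κ : ℝ, 1 ≤ κ → ∫⁻ ξ : ℝ, ENNReal.ofReal ((|ξ| + κ) ^ (-p)) ≤
      ENNReal.ofReal ((I.toReal + 1) * κ ^ (1 - p)) := by
    intro κ hκ
    rw [lintegral_weight_line (by linarith), mul_comm, ENNReal.ofReal_mul hIpos.le]
    gcongr
  cases G with
  | line => exact ⟨I.toReal + 1, hIpos, hline⟩
  | circle =>
    refine ⟨2 ^ p * (I.toReal + 1), by positivity, fun κ hκ => ?_⟩
    refine (lintegral_weight_circle_le (by linarith) hκ).trans ?_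
    rw [mul_assoc, ENNReal.ofReal_mul (by positivity)]
    gcongr
    exact hline κ hκ

/-! ### The weighted convolution kernel -/

lemma fourierConst_pos (G : Geometry) : 0 < fourierConst G := by
  cases G
  · rw [fourierConst]; positivity
  · simp [fourierConst]

lemma fourierConst_le_one (G : Geometry) : fourierConst G ≤ 1 := by
  cases G
  · rw [fourierConst]
    refine inv_le_one_of_one_le₀ (Real.one_le_sqrt.2 ?_)
    linarith [Real.pi_gt_three]
  · simp [fourierConst]

/-- The larger weight pays: Z ≤ 2Y gives Z^{2a} ≤ 2Y^{2a}, and the exponent β − a ≥ 0 left on Y may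
be moved to the smaller X. -/
lemma weight_mul_le {X Y Z a α β : ℝ} (hX : 0 < X) (hXY : X ≤ Y) (hZ : 0 < Z) (hZXY : Z ≤ X + Y)
    (ha : 0 ≤ a) (ha' : a ≤ 1 / 2) (hβ : a ≤ β) (hαβ : α + β = 1) :
    X ^ (-(2 * α)) * Y ^ (-(2 * β)) * Z ^ (2 * a) ≤ 2 * X ^ (-(2 - 2 * a)) := by
  have hY : 0 < Y := hX.trans_le hXY
  have h1 : Z ^ (2 * a) ≤ 2 * Y ^ (2 * a) := by
    calc Z ^ (2 * a) ≤ (2 * Y) ^ (2 * a) :=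
          Real.rpow_le_rpow hZ.le (by linarith) (by linarith)
      _ = 2 ^ (2 * a) * Y ^ (2 * a) := Real.mul_rpow (by norm_num) hY.le
      _ ≤ 2 ^ (1 : ℝ) * Y ^ (2 * a) := by
          gcongr
          · norm_num
          · linarith
      _ = _ := by rw [Real.rpow_one]
  calc X ^ (-(2 * α)) * Y ^ (-(2 * β)) * Z ^ (2 * a)
      ≤ X ^ (-(2 * α)) * Y ^ (-(2 * β)) * (2 * Y ^ (2 * a)) := by gcongr
    _ = 2 * (X ^ (-(2 * α)) * Y ^ (-(2 * (β - a)))) := by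
        have : Y ^ (-(2 * (β - a))) = Y ^ (-(2 * β)) * Y ^ (2 * a) := by
          rw [← Real.rpow_add hY]; congr 1; ring
        rw [this]; ring
    _ ≤ 2 * (X ^ (-(2 * α)) * X ^ (-(2 * (β - a)))) := by
        gcongr 2 * (_ * ?_)
        exact Real.rpow_le_rpow_of_nonpos hX hXY (by linarith)
    _ = 2 * X ^ (-(2 - 2 * a)) := by
        rw [← Real.rpow_add hX]; congr 2; linarith

/-- It decouples the frequency difference Z from the two individual weights. Only a ≤ α, β is
required, so one inequality covers both the symmetric weights 1/2, 1/2 and the pair −s, s+1. -/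
lemma weight_mul_le_add {X Y Z a α β : ℝ} (hX : 0 < X) (hY : 0 < Y) (hZ : 0 < Z)
    (hZXY : Z ≤ X + Y) (ha : 0 ≤ a) (ha' : a ≤ 1 / 2) (hα : a ≤ α) (hβ : a ≤ β)
    (hαβ : α + β = 1) :
    X ^ (-(2 * α)) * Y ^ (-(2 * β)) ≤
      Z ^ (-(2 * a)) * (2 * (X ^ (-(2 - 2 * a)) + Y ^ (-(2 - 2 * a)))) := by
  have hZpos : 0 < Z ^ (2 * a) := by positivity
  rw [Real.rpow_neg hZ.le, inv_mul_eq_div, le_div_iff₀ hZpos]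
  have hX' : 0 < X ^ (-(2 - 2 * a)) := by positivity
  have hY' : 0 < Y ^ (-(2 - 2 * a)) := by positivity
  rcases le_total X Y with h | h
  · have := weight_mul_le hX h hZ hZXY ha ha' hβ hαβ
    linarith
  · have := weight_mul_le hY h hZ (by linarith) ha ha' hα (by linarith : β + α = 1)
    rw [mul_comm (X ^ _)]
    linarith

/-- The nonnegative frequencies. -/
def halfMeasure (G : Geometry) : Measure ℝ := (freqMeasure G).restrict (Ici 0)

instance (G : Geometry) : SFinite (halfMeasure G) := by
  unfold halfMeasure; infer_instance

/-- The kernel of `(|ξ| + κ)^{-α} ∘ q ∘ (|ξ| + κ)^{-β}` on the Fourier side. -/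
def weightedKernel (G : Geometry) (κ α β : ℝ) (Q : ℝ → ℂ) (p : ℝ × ℝ) : ℂ :=
  (((|p.1| + κ) ^ (-α) : ℝ) : ℂ) *
    ((fourierConst G : ℂ) * (Q (p.1 - p.2) * (((|p.2| + κ) ^ (-β) : ℝ) : ℂ)))

lemma stronglyMeasurable_weightedKernel (G : Geometry) (κ α β : ℝ) {Q : ℝ → ℂ}
    (hQ : StronglyMeasurable Q) : StronglyMeasurable (weightedKernel G κ α β Q) := by
  have h1 : Measurable fun p : ℝ × ℝ => (((|p.1| + κ) ^ (-α) : ℝ) : ℂ) := by fun_prop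
  have h2 : Measurable fun p : ℝ × ℝ => (((|p.2| + κ) ^ (-β) : ℝ) : ℂ) := by fun_prop
  exact h1.stronglyMeasurable.mul (stronglyMeasurable_const.mul
    ((hQ.comp_measurable (measurable_fst.sub measurable_snd)).mul h2.stronglyMeasurable))

lemma enorm_weightedKernel_sq_le (G : Geometry) {κ : ℝ} (hκ : 0 < κ) (α β : ℝ) (Q : ℝ → ℂ)
    (p : ℝ × ℝ) : ‖weightedKernel G κ α β Q p‖ₑ ^ 2 ≤
      ‖Q (p.1 - p.2)‖ₑ ^ 2 *
        ENNReal.ofReal ((|p.1| + κ) ^ (-(2 * α)) * (|p.2| + κ) ^ (-(2 * β))) := by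
  have hsq : ∀ (ξ γ : ℝ), ‖(((|ξ| + κ) ^ (-γ) : ℝ) : ℂ)‖ₑ ^ 2 =
      ENNReal.ofReal ((|ξ| + κ) ^ (-(2 * γ))) := by
    intro ξ γ
    rw [← ofReal_norm, ← ENNReal.ofReal_pow (norm_nonneg _), Complex.norm_real,
      Real.norm_of_nonneg (by positivity), ← Real.rpow_natCast, ← Real.rpow_mul (by positivity)]
    congr 2
    push_cast
    ring
  have hc : ‖(fourierConst G : ℂ)‖ₑ ^ 2 ≤ 1 := by
    refine pow_le_one₀ zero_le ?_
    rw [← ofReal_norm, Complex.norm_real, Real.norm_of_nonneg (fourierConst_pos G).le]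
    exact ENNReal.ofReal_le_one.2 (fourierConst_le_one G)
  rw [weightedKernel, enorm_mul, enorm_mul, enorm_mul, mul_pow, mul_pow, mul_pow, hsq, hsq,
    ENNReal.ofReal_mul (by positivity)]
  calc _ ≤ ENNReal.ofReal ((|p.1| + κ) ^ (-(2 * α))) * (1 * (‖Q (p.1 - p.2)‖ₑ ^ 2 *
        ENNReal.ofReal ((|p.2| + κ) ^ (-(2 * β))))) := by gcongr
    _ = _ := by ring

lemma lintegral_half_prod_le (G : Geometry) (F : ℝ × ℝ → ℝ≥0∞) :
    ∫⁻ p, F p ∂((halfMeasure G).prod (halfMeasure G)) ≤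
      ∫⁻ p, F p ∂((freqMeasure G).prod (freqMeasure G)) := by
  rw [halfMeasure, Measure.prod_restrict]
  exact lintegral_mono' Measure.restrict_le_self le_rfl

/-- The central estimate. In the variables ζ = ξ − η and η the weight inequality with a = −s
separates |q̂(ζ)|²(|ζ|+κ)^{2s}, whose integral is the squared norm of q, from two translates of
(|η|+κ)^{-(2+2s)}. The latter is integrable because s > −1/2, with integral of order κ^{-1-2s} =
κ^{-4ε}. -/
lemma exists_hsKernel_weightedKernel (G : Geometry) {s : ℝ} (hs : -(1 / 2) < s) (hs0 : s < 0) :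
    ∃ C : ℝ, 0 < C ∧ ∀ κ : ℝ, 1 ≤ κ → ∀ α β : ℝ, -s ≤ α → -s ≤ β → α + β = 1 →
      ∀ (Q : ℝ → ℂ), StronglyMeasurable Q → ∀ N : ℝ, 0 ≤ N →
        ∫⁻ ζ, ENNReal.ofReal ((|ζ| + κ) ^ (2 * s)) * ‖Q ζ‖ₑ ^ 2 ∂(freqMeasure G) ≤
          ENNReal.ofReal N ^ 2 →
        HSKernel (halfMeasure G) (weightedKernel G κ α β Q) (C * κ ^ (-(2 * epsOf s)) * N) := by
  obtain ⟨C₀, hC₀, hC⟩ := exists_lintegral_weight_le G (p := 2 + 2 * s) (by linarith)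
  -- One factor 2 comes from the weight inequality, another from its two terms; the square root
  -- passes from squared norms to norms.
  refine ⟨Real.sqrt (4 * C₀), by positivity, fun κ hκ α β hα hβ hαβ Q hQ N hN hQN => ?_⟩
  have hκ0 : 0 < κ := by linarith
  refine ⟨stronglyMeasurable_weightedKernel G κ α β hQ, by positivity, ?_⟩
  refine (lintegral_half_prod_le G _).trans ?_
  set μ := freqMeasure G with hμ
  set g : ℝ → ℝ≥0∞ := fun ξ => ENNReal.ofReal ((|ξ| + κ) ^ (-(2 + 2 * s))) with hg
  have hgm : Measurable g := by fun_prop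
  set h : ℝ → ℝ≥0∞ := fun ζ => ENNReal.ofReal ((|ζ| + κ) ^ (2 * s)) * ‖Q ζ‖ₑ ^ 2 with hh
  have hhm : Measurable h := (by fun_prop : Measurable fun ζ : ℝ =>
    ENNReal.ofReal ((|ζ| + κ) ^ (2 * s))).mul (hQ.enorm.pow_const 2)
  have hkm : Measurable fun p => ‖weightedKernel G κ α β Q p‖ₑ ^ 2 :=
    (stronglyMeasurable_weightedKernel G κ α β hQ).enorm.pow_const 2
  have hpt : ∀ p : ℝ × ℝ, ‖weightedKernel G κ α β Q (p.2 + p.1, p.1)‖ₑ ^ 2 ≤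
      2 * (h p.2 * (g (p.1 + p.2) + g p.1)) := by
    intro p
    refine (enorm_weightedKernel_sq_le G hκ0 α β Q _).trans ?_
    simp only [add_sub_cancel_right, hh, hg]
    have hw := weight_mul_le_add (X := |p.2 + p.1| + κ) (Y := |p.1| + κ) (Z := |p.2| + κ) (a := -s)
      (by positivity) (by positivity) (by positivity)
      (by have := abs_sub (p.2 + p.1) p.1; simp only [add_sub_cancel_right] at this; linarith)
      (by linarith) (by linarith) hα hβ hαβ
    calc _ ≤ ‖Q p.2‖ₑ ^ 2 * ENNReal.ofReal ((|p.2| + κ) ^ (-(2 * -s)) *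
          (2 * ((|p.2 + p.1| + κ) ^ (-(2 - 2 * -s)) + (|p.1| + κ) ^ (-(2 - 2 * -s))))) := by gcongr
      _ = _ := by
        rw [ENNReal.ofReal_mul (by positivity), ENNReal.ofReal_mul (by norm_num),
          ENNReal.ofReal_add (by positivity) (by positivity), add_comm p.2 p.1]
        simp only [mul_neg, neg_neg, sub_neg_eq_add, ENNReal.ofReal_ofNat]
        ring
  rw [← (measurePreserving_shear G).lintegral_comp hkm]
  calc ∫⁻ p, ‖weightedKernel G κ α β Q (p.2 + p.1, p.1)‖ₑ ^ 2 ∂(μ.prod μ)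
      ≤ ∫⁻ p, 2 * (h p.2 * (g (p.1 + p.2) + g p.1)) ∂(μ.prod μ) := lintegral_mono hpt
    _ = ∫⁻ ζ, ∫⁻ η, 2 * (h ζ * (g (η + ζ) + g η)) ∂μ ∂μ := by
        rw [lintegral_prod_symm _ (by fun_prop)]
    _ = ∫⁻ ζ, 2 * (h ζ * (2 * ∫⁻ η, g η ∂μ)) ∂μ := by
        refine lintegral_congr_ae ?_
        filter_upwards [ae_measurePreserving_add G] with ζ hζ
        rw [lintegral_const_mul _ (by fun_prop), lintegral_const_mul _ (by fun_prop),
          lintegral_add_left (by fun_prop), hζ.lintegral_comp hgm, two_mul (∫⁻ η, g η ∂μ)]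
    _ = 4 * ((∫⁻ ζ, h ζ ∂μ) * ∫⁻ η, g η ∂μ) := by
        rw [lintegral_const_mul _ (by fun_prop), lintegral_mul_const _ hhm]
        ring
    _ ≤ 4 * (ENNReal.ofReal N ^ 2 * ENNReal.ofReal (C₀ * κ ^ (1 - (2 + 2 * s)))) := by
        gcongr
        exact hC κ hκ
    _ = _ := by
        rw [← ENNReal.ofReal_pow hN, ← ENNReal.ofReal_pow (by positivity),
          ← ENNReal.ofReal_mul (by positivity), ← ENNReal.ofReal_ofNat 4,
          ← ENNReal.ofReal_mul (by norm_num), mul_pow, mul_pow, Real.sq_sqrt (by positivity),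
          ← Real.rpow_natCast (κ ^ _), ← Real.rpow_mul hκ0.le]
        have he : -(2 * epsOf s) * ((2 : ℕ) : ℝ) = 1 - (2 + 2 * s) := by
          rw [epsOf, abs_of_neg hs0]; push_cast; ring
        rw [he]
        congr 1
        ring

/-! ### Multiplication operators -/

section Multiplication

variable {α : Type*} [MeasurableSpace α] {ν : Measure α}

lemma memLp_mul_of_bound {m : α → ℂ} (hm : Measurable m) {C : ℝ} (hC : ∀ᵐ x ∂ν, ‖m x‖ ≤ C)
    (f : Lp ℂ 2 ν) : MemLp (fun x => m x * f x) 2 ν := by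
  refine (Lp.memLp f).of_le_mul (c := C) (hm.aestronglyMeasurable.mul (Lp.aestronglyMeasurable f))
    ?_
  filter_upwards [hC] with x hx
  rw [norm_mul]
  gcongr

/-- Multiplication by a bounded measurable function. -/
def mulOp (m : α → ℂ) (hm : Measurable m) (C : ℝ) (hC : ∀ᵐ x ∂ν, ‖m x‖ ≤ C) :
    Lp ℂ 2 ν →L[ℂ] Lp ℂ 2 ν :=
  LinearMap.mkContinuous
    { toFun := fun f => (memLp_mul_of_bound hm hC f).toLp
      map_add' := by
        intro f g
        rw [← MemLp.toLp_add]
        refine MemLp.toLp_congr _ _ ?_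
        filter_upwards [Lp.coeFn_add f g] with y hy
        rw [Pi.add_apply, hy, Pi.add_apply, mul_add]
      map_smul' := by
        intro c f
        rw [RingHom.id_apply, ← MemLp.toLp_const_smul]
        refine MemLp.toLp_congr _ _ ?_
        filter_upwards [Lp.coeFn_smul c f] with y hy
        rw [Pi.smul_apply, hy, Pi.smul_apply, smul_eq_mul, smul_eq_mul, mul_left_comm] } C
    (by
      intro f
      refine Lp.norm_le_mul_norm_of_ae_le_mul ?_
      filter_upwards [(memLp_mul_of_bound hm hC f).coeFn_toLp, hC] with x hx h1
      rw [LinearMap.coe_mk, AddHom.coe_mk, hx, norm_mul]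
      gcongr)

variable {m : α → ℂ} {hm : Measurable m} {C : ℝ} {hC : ∀ᵐ x ∂ν, ‖m x‖ ≤ C}

lemma mulOp_coeFn (f : Lp ℂ 2 ν) : mulOp m hm C hC f =ᵐ[ν] fun x => m x * f x :=
  (memLp_mul_of_bound hm hC f).coeFn_toLp

lemma isSelfAdjoint_mulOp (hreal : ∀ x, (starRingEnd ℂ) (m x) = m x) :
    IsSelfAdjoint (mulOp m hm C hC) := by
  refine ContinuousLinearMap.isSelfAdjoint_iff_isSymmetric.2 fun f g => ?_
  change ⟪mulOp m hm C hC f, g⟫_ℂ = ⟪f, mulOp m hm C hC g⟫_ℂ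
  rw [L2.inner_def, L2.inner_def]
  refine integral_congr_ae ?_
  filter_upwards [mulOp_coeFn (hC := hC) (hm := hm) f, mulOp_coeFn (hC := hC) (hm := hm) g]
    with x h1 h2
  rw [h1, h2, RCLike.inner_apply, RCLike.inner_apply, map_mul, hreal]
  ring

lemma injective_mulOp (hne : ∀ x, m x ≠ 0) : Function.Injective (mulOp m hm C hC) := by
  rw [injective_iff_map_eq_zero]
  intro f hf
  rw [Lp.eq_zero_iff_ae_eq_zero] at hf ⊢
  filter_upwards [hf, mulOp_coeFn (hC := hC) (hm := hm) f] with x h1 h2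
  rw [h2] at h1
  exact (mul_eq_zero.1 h1).resolve_left (hne x)

end Multiplication

/-! ### The Plancherel theorem -/

lemma lintegral_comp_div_two_pi {F : ℝ → ℝ≥0∞} (hF : AEMeasurable F volume) :
    ∫⁻ ξ : ℝ, F (ξ / (2 * Real.pi)) = ENNReal.ofReal (2 * Real.pi) * ∫⁻ w, F w := by
  have h1 : Measure.map (fun ξ : ℝ => ξ / (2 * Real.pi)) volume =
      ENNReal.ofReal (2 * Real.pi) • (volume : Measure ℝ) := by
    have := Real.map_volume_mul_left (a := (2 * Real.pi)⁻¹) (by positivity)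
    simp only [inv_inv, abs_of_pos (by positivity : 0 < 2 * Real.pi)] at this
    rw [← this]
    congr 1
    funext ξ
    rw [div_eq_inv_mul]
  rw [← lintegral_map' (f := F) (by rw [h1]; exact hF.smul_measure _) (by fun_prop), h1,
    lintegral_smul_measure, smul_eq_mul]

/-- The normalization c²·2π = 1 exactly offsets the Jacobian of ξ ↦ ξ/2π, making the rescaled
transform an isometry. -/
lemma enorm_fourierConst_line_sq_mul :
    ‖(fourierConst .line : ℂ)‖ₑ ^ 2 * ENNReal.ofReal (2 * Real.pi) = 1 := by
  rw [← ofReal_norm, ← ENNReal.ofReal_pow (norm_nonneg _), Complex.norm_real,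
    Real.norm_of_nonneg (fourierConst_pos _).le, ← ENNReal.ofReal_mul (by positivity),
    fourierConst, inv_pow, Real.sq_sqrt (by positivity), inv_mul_cancel₀ (by positivity)]
  simp

lemma aestronglyMeasurable_freq_circle (φ : ℝ → ℂ) :
    AEStronglyMeasurable φ (freqMeasure .circle) := by
  simp only [freqMeasure]
  rw [aestronglyMeasurable_sum_measure_iff]
  exact fun n => aestronglyMeasurable_dirac

lemma lintegral_freq_circle (F : ℝ → ℝ≥0∞) :
    ∫⁻ ξ, F ξ ∂(freqMeasure .circle) = ∑' n : ℤ, F (2 * Real.pi * (n : ℝ)) := by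
  simp only [freqMeasure, lintegral_sum_measure, lintegral_dirac]

lemma aestronglyMeasurable_fourierL2_line (f : Lp ℂ 2 (volume : Measure ℝ)) :
    AEStronglyMeasurable (fourierL2 .line f) volume :=
  ((Lp.aestronglyMeasurable (𝓕 f)).comp_quasiMeasurePreserving quasi_div).const_mul _

lemma lintegral_fourierL2_line (f : Lp ℂ 2 (volume : Measure ℝ)) :
    ∫⁻ ξ, ‖fourierL2 .line f ξ‖ₑ ^ 2 = ‖f‖ₑ ^ 2 := by
  have hm : AEMeasurable (fun w => ‖(𝓕 f : Lp ℂ 2 (volume : Measure ℝ)) w‖ₑ ^ 2) volume :=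
    (Lp.aestronglyMeasurable (𝓕 f)).enorm.pow_const 2
  simp only [fourierL2_line, enorm_mul, mul_pow]
  rw [lintegral_const_mul' _ _ (by simp), lintegral_comp_div_two_pi hm, ← mul_assoc,
    enorm_fourierConst_line_sq_mul, one_mul, lintegral_enorm_sq_Lp, ← ofReal_norm,
    Lp.norm_fourier_eq, ofReal_norm]

lemma exists_fourierL2_line_eq {φ : ℝ → ℂ} (hφ : MemLp φ 2 volume) :
    ∃ f : Lp ℂ 2 (volume : Measure ℝ), fourierL2 .line f =ᵐ[volume] φ := by
  have hc : (fourierConst .line : ℂ) ≠ 0 := fourierConst_ne _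
  have hg : MemLp (fun w => (fourierConst .line : ℂ)⁻¹ * φ (2 * Real.pi * w)) 2 volume := by
    refine MemLp.const_mul ?_ _
    have hm : AEStronglyMeasurable (fun w => φ (2 * Real.pi * w)) volume :=
      hφ.1.comp_quasiMeasurePreserving quasi_mul
    rw [memLp_two_iff hm]
    have h1 := lintegral_comp_div_two_pi (F := fun w => ‖φ (2 * Real.pi * w)‖ₑ ^ 2)
      (hm.enorm.pow_const 2)
    simp only [mul_div_cancel₀ _ (by positivity : (2 * Real.pi) ≠ 0)] at h1
    intro htop
    rw [htop, ENNReal.mul_top (by simp [Real.pi_pos])] at h1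
    exact (memLp_two_iff hφ.1).1 hφ h1
  refine ⟨(𝓕⁻ hg.toLp : Lp ℂ 2 (volume : Measure ℝ)), ?_⟩
  filter_upwards [quasi_div.ae hg.coeFn_toLp] with ξ hξ
  rw [fourierL2_line, FourierTransform.fourier_fourierInv_eq, hξ, mul_inv_cancel_left₀ hc]
  congr 1
  field_simp

lemma memLp_exp_circle (n : ℤ) : MemLp (fun x : ℝ =>
    Complex.exp (Complex.I * (2 * Real.pi * (n : ℝ) : ℝ) * x)) 2 (posMeasure .circle) := by
  have : IsFiniteMeasure (posMeasure .circle) := by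
    simp only [posMeasure]; infer_instance
  refine MemLp.of_bound (by fun_prop) 1 (Eventually.of_forall fun x => ?_)
  rw [Complex.norm_exp]
  simp

lemma fourierL2_circle_eq_inner (f : Lp ℂ 2 (posMeasure .circle)) (n : ℤ) :
    fourierL2 .circle f (2 * Real.pi * (n : ℝ)) = ⟪(memLp_exp_circle n).toLp, f⟫_ℂ := by
  rw [L2.inner_def, fourierL2, fourierL1]
  simp only [fourierConst, Complex.ofReal_one, one_mul]
  refine integral_congr_ae ?_
  filter_upwards [(memLp_exp_circle n).coeFn_toLp] with x hx
  rw [hx, RCLike.inner_apply, ← Complex.exp_conj, mul_comm]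
  congr 2
  rw [map_mul, map_mul, Complex.conj_I, Complex.conj_ofReal, Complex.conj_ofReal]
  ring

lemma orthonormal_exp_circle :
    Orthonormal ℂ fun n : ℤ => (memLp_exp_circle n).toLp := by
  rw [orthonormal_iff_ite]
  intro m n
  rw [← fourierL2_circle_eq_inner, fourierL2, fourierL1]
  simp only [fourierConst, Complex.ofReal_one, one_mul]
  have h1 : ∫ x, Complex.exp (-(Complex.I * (2 * Real.pi * (m : ℝ) : ℝ) * x)) *
      ((memLp_exp_circle n).toLp : ℝ → ℂ) x ∂(posMeasure .circle) =
      ∫ x in Ioc (0 : ℝ) 1, Complex.exp (2 * Real.pi * Complex.I * (n - m) * x) := by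
    refine integral_congr_ae ?_
    filter_upwards [(memLp_exp_circle n).coeFn_toLp] with x hx
    rw [hx, ← Complex.exp_add]
    congr 1
    push_cast
    ring
  rw [h1, ← intervalIntegral.integral_of_le zero_le_one]
  split_ifs with hmn
  · subst hmn; simp
  · have hne : (2 * Real.pi * Complex.I * ((n : ℂ) - m)) ≠ 0 := by
      refine mul_ne_zero Complex.two_pi_I_ne_zero ?_
      rw [sub_ne_zero]
      exact_mod_cast fun h : n = m => hmn h.symm
    rw [integral_exp_mul_complex hne]
    have : (2 * Real.pi * Complex.I * ((n : ℂ) - m)) * (1 : ℝ) =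
      ((n - m : ℤ) : ℂ) * (2 * Real.pi * Complex.I) := by push_cast; ring
    rw [this, Complex.exp_int_mul_two_pi_mul_I]
    simp

/-- The exponentials as a Hilbert basis of `L²(ℝ / ℤ)`. -/
def expBasis : HilbertBasis ℤ ℂ (Lp ℂ 2 (posMeasure .circle)) :=
  HilbertBasis.mkOfOrthogonalEqBot orthonormal_exp_circle (by
    rw [Submodule.eq_bot_iff]
    intro f hf
    refine eq_zero_of_fourierL2 .circle f (ae_freqMeasure_circle.2 fun n => ?_)
    rw [fourierL2_circle_eq_inner]
    exact hf _ (Submodule.subset_span ⟨n, rfl⟩))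

lemma expBasis_repr (f : Lp ℂ 2 (posMeasure .circle)) (n : ℤ) :
    expBasis.repr f n = fourierL2 .circle f (2 * Real.pi * (n : ℝ)) := by
  rw [expBasis.repr_apply_apply, expBasis, HilbertBasis.coe_mkOfOrthogonalEqBot,
    fourierL2_circle_eq_inner]

lemma lintegral_fourierL2_circle (f : Lp ℂ 2 (posMeasure .circle)) :
    ∫⁻ ξ, ‖fourierL2 .circle f ξ‖ₑ ^ 2 ∂(freqMeasure .circle) = ‖f‖ₑ ^ 2 := by
  rw [lintegral_freq_circle]
  simp only [← expBasis_repr]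
  have hs : Summable fun n => ‖expBasis.repr f n‖ ^ 2 := by
    have := lp.memℓp (expBasis.repr f)
    simpa using this.summable (by norm_num)
  have h1 : ‖f‖ ^ 2 = ∑' n, ‖expBasis.repr f n‖ ^ 2 := by
    have := lp.norm_rpow_eq_tsum (p := 2) (by norm_num) (expBasis.repr f)
    simpa using this
  have h2 : ∀ n, ‖expBasis.repr f n‖ₑ ^ 2 = ENNReal.ofReal (‖expBasis.repr f n‖ ^ 2) := fun n => by
    rw [ENNReal.ofReal_pow (norm_nonneg _), ofReal_norm]
  simp only [h2]
  rw [← ENNReal.ofReal_tsum_of_nonneg (fun n => by positivity) hs, ← h1,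
    ENNReal.ofReal_pow (norm_nonneg _), ofReal_norm]

lemma exists_fourierL2_circle_eq {φ : ℝ → ℂ} (hφ : MemLp φ 2 (freqMeasure .circle)) :
    ∃ f : Lp ℂ 2 (posMeasure .circle), fourierL2 .circle f =ᵐ[freqMeasure .circle] φ := by
  rw [memLp_two_iff hφ.1, lintegral_freq_circle] at hφ
  have h2 : ∀ n : ℤ, ‖φ (2 * Real.pi * (n : ℝ))‖ₑ ^ 2 =
      ENNReal.ofReal (‖φ (2 * Real.pi * (n : ℝ))‖ ^ 2) := fun n => by
    rw [ENNReal.ofReal_pow (norm_nonneg _), ofReal_norm]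
  simp only [h2] at hφ
  have hs := ENNReal.summable_toReal hφ
  simp only [ENNReal.toReal_ofReal (sq_nonneg _)] at hs
  have hmem : Memℓp (fun n : ℤ => φ (2 * Real.pi * (n : ℝ))) 2 :=
    memℓp_gen (by simpa using hs)
  refine ⟨expBasis.repr.symm ⟨_, hmem⟩, ae_freqMeasure_circle.2 fun n => ?_⟩
  rw [← expBasis_repr, LinearIsometryEquiv.apply_symm_apply]

lemma lintegral_fourierL2 (G : Geometry) (f : Lp ℂ 2 (posMeasure G)) :
    ∫⁻ ξ, ‖fourierL2 G f ξ‖ₑ ^ 2 ∂(freqMeasure G) = ‖f‖ₑ ^ 2 := by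
  cases G
  · exact lintegral_fourierL2_line f
  · exact lintegral_fourierL2_circle f

lemma memLp_fourierL2 (G : Geometry) (f : Lp ℂ 2 (posMeasure G)) :
    MemLp (fourierL2 G f) 2 (freqMeasure G) := by
  have hm : AEStronglyMeasurable (fourierL2 G f) (freqMeasure G) := by
    cases G
    · exact aestronglyMeasurable_fourierL2_line f
    · exact aestronglyMeasurable_freq_circle _
  rw [memLp_two_iff hm, lintegral_fourierL2]
  simp

lemma exists_fourierL2_eq (G : Geometry) {φ : ℝ → ℂ} (hφ : MemLp φ 2 (freqMeasure G)) :
    ∃ f : Lp ℂ 2 (posMeasure G), fourierL2 G f =ᵐ[freqMeasure G] φ := by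
  cases G
  · exact exists_fourierL2_line_eq hφ
  · exact exists_fourierL2_circle_eq hφ

/-- The Fourier transform as an isometry of `L²` spaces. -/
def fourierIso (G : Geometry) : Lp ℂ 2 (posMeasure G) →ₗᵢ[ℂ] Lp ℂ 2 (freqMeasure G) where
  toFun f := (memLp_fourierL2 G f).toLp
  map_add' f g := by
    rw [← MemLp.toLp_add]
    exact MemLp.toLp_congr _ _ (fourierL2_add G f g)
  map_smul' c f := by
    rw [RingHom.id_apply, ← MemLp.toLp_const_smul]
    exact MemLp.toLp_congr _ _ (fourierL2_smul G c f)
  norm_map' f := by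
    change ‖(memLp_fourierL2 G f).toLp‖ = ‖f‖
    have h := lintegral_fourierL2 G f
    rw [← eLpNorm_two_sq] at h
    have h2 : eLpNorm (fourierL2 G f) 2 (freqMeasure G) = ‖f‖ₑ :=
      le_antisymm ((ENNReal.pow_le_pow_left_iff two_ne_zero).1 h.le)
        ((ENNReal.pow_le_pow_left_iff two_ne_zero).1 h.ge)
    rw [Lp.norm_toLp, h2, toReal_enorm]

lemma fourierIso_coeFn (G : Geometry) (f : Lp ℂ 2 (posMeasure G)) :
    fourierIso G f =ᵐ[freqMeasure G] fourierL2 G f := (memLp_fourierL2 G f).coeFn_toLp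

lemma integral_conj_mul_fourierL2 (G : Geometry) (f g : Lp ℂ 2 (posMeasure G)) :
    ∫ ξ, (starRingEnd ℂ) (fourierL2 G f ξ) * fourierL2 G g ξ ∂(freqMeasure G) = ⟪f, g⟫_ℂ := by
  rw [← (fourierIso G).inner_map_map, L2.inner_def]
  refine integral_congr_ae ?_
  filter_upwards [fourierIso_coeFn G f, fourierIso_coeFn G g] with ξ h1 h2
  rw [h1, h2, RCLike.inner_apply, mul_comm]

/-! ### Modulations and the Fourier transform of `|f|²` -/

lemma norm_exp_neg_I_mul (ξ x : ℝ) : ‖Complex.exp (-(Complex.I * ξ * x))‖ = 1 := by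
  rw [Complex.norm_exp]; simp

/-- Multiplication by `e^{-iξx}`. -/
def modOp (G : Geometry) (ξ : ℝ) : Lp ℂ 2 (posMeasure G) →L[ℂ] Lp ℂ 2 (posMeasure G) :=
  mulOp (fun x : ℝ => Complex.exp (-(Complex.I * ξ * x))) (by fun_prop) 1
    (Eventually.of_forall fun x => (norm_exp_neg_I_mul ξ x).le)

lemma modOp_coeFn (G : Geometry) (ξ : ℝ) (f : Lp ℂ 2 (posMeasure G)) :
    modOp G ξ f =ᵐ[posMeasure G] fun x => Complex.exp (-(Complex.I * ξ * x)) * f x :=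
  mulOp_coeFn f

lemma fourierInv_compSubConst (h : 𝓢(ℝ, ℂ)) (w x : ℝ) :
    (𝓕⁻ (h.compSubConstCLM ℂ (-w)) : 𝓢(ℝ, ℂ)) x =
      Complex.exp (-(Complex.I * (2 * Real.pi * w : ℝ) * x)) * (𝓕⁻ h : 𝓢(ℝ, ℂ)) x := by
  rw [SchwartzMap.fourierInv_coe, SchwartzMap.fourierInv_coe, Real.fourierInv_eq',
    Real.fourierInv_eq']
  simp only [SchwartzMap.compSubConstCLM_apply, sub_neg_eq_add]
  rw [← integral_add_right_eq_self _ (-w), ← integral_const_mul]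
  refine integral_congr_ae (Eventually.of_forall fun v => ?_)
  simp only [neg_add_cancel_right, smul_eq_mul]
  rw [← mul_assoc, ← Complex.exp_add]
  congr 2
  simp only [RCLike.inner_apply, conj_trivial]
  push_cast
  ring

/-- Multiplication by `e^{-iξx}` on `L²(ℝ)`. -/
def modOpLine (ξ : ℝ) : Lp ℂ 2 (volume : Measure ℝ) →L[ℂ] Lp ℂ 2 (volume : Measure ℝ) :=
  mulOp (fun x : ℝ => Complex.exp (-(Complex.I * ξ * x))) (by fun_prop) 1
    (Eventually.of_forall fun x => (norm_exp_neg_I_mul ξ x).le)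

lemma modOpLine_coeFn (ξ : ℝ) (f : Lp ℂ 2 (volume : Measure ℝ)) :
    modOpLine ξ f =ᵐ[volume] fun x => Complex.exp (-(Complex.I * ξ * x)) * f x :=
  mulOp_coeFn f

/-- Both sides are continuous in f, so the identity is checked on the dense set of Schwartz
functions, where it is the translation rule for the inverse transform. -/
lemma fourier_modOp_line (ξ : ℝ) (f : Lp ℂ 2 (volume : Measure ℝ)) :
    (𝓕 (modOpLine ξ f) : Lp ℂ 2 (volume : Measure ℝ)) =
      Lp.compMeasurePreserving (fun v => v + ξ / (2 * Real.pi))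
        (measurePreserving_add_right volume _) (𝓕 f) := by
  have hd := SchwartzMap.denseRange_toLpCLM (E := ℝ) (F := ℂ) (p := 2)
    (by norm_num) (μ := (volume : Measure ℝ))
  have hc1 : Continuous fun f : Lp ℂ 2 (volume : Measure ℝ) =>
      (𝓕 (modOpLine ξ f) : Lp ℂ 2 (volume : Measure ℝ)) :=
    (Lp.fourierTransformₗᵢ ℝ ℂ).continuous.comp (modOpLine ξ).continuous
  have hc2 : Continuous fun f : Lp ℂ 2 (volume : Measure ℝ) =>
      Lp.compMeasurePreserving (fun v => v + ξ / (2 * Real.pi))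
        (measurePreserving_add_right volume _) (𝓕 f : Lp ℂ 2 (volume : Measure ℝ)) :=
    (Lp.isometry_compMeasurePreserving (measurePreserving_add_right volume _)).continuous.comp
      (Lp.fourierTransformₗᵢ ℝ ℂ).continuous
  refine congrFun (hd.equalizer hc1 hc2 ?_) f
  funext g
  simp only [Function.comp_apply, SchwartzMap.toLpCLM_apply]
  set w := ξ / (2 * Real.pi) with hw
  have hξ : ξ = 2 * Real.pi * w := by rw [hw]; field_simp
  set h : 𝓢(ℝ, ℂ) := 𝓕 g with hh
  have hg : 𝓕⁻ h = g := FourierTransform.fourierInv_fourier_eq g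
  have h1 : modOpLine ξ (g.toLp 2) =
      (𝓕⁻ (h.compSubConstCLM ℂ (-w)) : 𝓢(ℝ, ℂ)).toLp 2 := by
    apply Lp.ext
    have h2 := modOpLine_coeFn ξ (g.toLp 2)
    filter_upwards [h2, SchwartzMap.coeFn_toLp g 2 volume, SchwartzMap.coeFn_toLp
      (𝓕⁻ (h.compSubConstCLM ℂ (-w)) : 𝓢(ℝ, ℂ)) 2 volume] with x a1 a2 a3
    rw [a1, a3, a2, fourierInv_compSubConst, hg, hξ]
  rw [h1, SchwartzMap.toLp_fourier_eq, SchwartzMap.toLp_fourier_eq,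
    FourierTransform.fourier_fourierInv_eq]
  apply Lp.ext
  have h3 := Lp.coeFn_compMeasurePreserving (p := 2) (h.toLp 2 (volume : Measure ℝ))
    (measurePreserving_add_right volume w)
  filter_upwards [h3, SchwartzMap.coeFn_toLp (h.compSubConstCLM ℂ (-w)) 2 volume,
    (measurePreserving_add_right volume w).quasiMeasurePreserving.ae
      (SchwartzMap.coeFn_toLp h 2 volume)] with x a1 a2 a3
  rw [a1, a2, Function.comp_apply, a3, SchwartzMap.compSubConstCLM_apply, sub_neg_eq_add]

lemma fourierL2_modOp_line (ξ : ℝ) (f : Lp ℂ 2 (volume : Measure ℝ)) :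
    ∀ᵐ η ∂(volume : Measure ℝ),
      fourierL2 .line (modOpLine ξ f) η = fourierL2 .line f (η + ξ) := by
  have h2 := Lp.coeFn_compMeasurePreserving (p := 2) (𝓕 f : Lp ℂ 2 (volume : Measure ℝ))
    (measurePreserving_add_right volume (ξ / (2 * Real.pi)))
  filter_upwards [quasi_div.ae h2] with η hη
  rw [fourierL2_line, fourierL2_line, fourier_modOp_line, hη, Function.comp_apply, add_div]

lemma fourierL2_modOp (G : Geometry) : ∀ᵐ ξ ∂(freqMeasure G), ∀ f : Lp ℂ 2 (posMeasure G),
    fourierL2 G (modOp G ξ f) =ᵐ[freqMeasure G] fun η => fourierL2 G f (η + ξ) := by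
  cases G with
  | line =>
    exact Eventually.of_forall fun ξ f => fourierL2_modOp_line ξ f
  | circle =>
    refine ae_freqMeasure_circle.2 fun m f => ae_freqMeasure_circle.2 fun n => ?_
    simp only [fourierL2, fourierL1]
    refine congrArg _ (integral_congr_ae ?_)
    filter_upwards [modOp_coeFn .circle (2 * Real.pi * (m : ℝ)) f] with x hx
    rw [hx, ← mul_assoc, ← Complex.exp_add]
    congr 2
    push_cast
    ring

/-- The transform of |f|² at ξ is c times the inner product of f with e^{-iξx}f, and Plancherel
makes this an autocorrelation of f̂. The exceptional null set does not depend on f. -/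
lemma sqHat_eq (G : Geometry) : ∀ᵐ ξ ∂(freqMeasure G), ∀ f : L2Plus G, sqHat f ξ =
    (fourierConst G : ℂ) *
      ∫ η, (starRingEnd ℂ) (hardyHat f η) * hardyHat f (η + ξ) ∂(freqMeasure G) := by
  filter_upwards [fourierL2_modOp G] with ξ hξ f
  have h1 : ∫ η, (starRingEnd ℂ) (hardyHat f η) * hardyHat f (η + ξ) ∂(freqMeasure G) =
      ⟪(f : Lp ℂ 2 (posMeasure G)), modOp G ξ f⟫_ℂ := by
    rw [← integral_conj_mul_fourierL2]
    refine integral_congr_ae ?_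
    filter_upwards [hξ f] with η hη
    rw [hη]; rfl
  rw [h1, sqHat, fourierL1, L2.inner_def]
  refine congrArg _ (integral_congr_ae ?_)
  filter_upwards [modOp_coeFn G ξ f] with x hx
  rw [hx, RCLike.inner_apply, mul_assoc (Complex.exp _), Complex.mul_conj,
    Complex.normSq_eq_norm_sq]

/-! ### The Hardy space on the Fourier side -/

lemma lintegral_half_eq {G : Geometry} {F : ℝ → ℝ≥0∞}
    (hF : ∀ᵐ ξ ∂(freqMeasure G), ξ < 0 → F ξ = 0) :
    ∫⁻ ξ, F ξ ∂(halfMeasure G) = ∫⁻ ξ, F ξ ∂(freqMeasure G) := by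
  rw [halfMeasure, ← lintegral_indicator measurableSet_Ici]
  refine lintegral_congr_ae ?_
  filter_upwards [hF] with ξ hξ
  by_cases h : ξ ∈ Ici (0 : ℝ)
  · rw [indicator_of_mem h]
  · rw [indicator_of_notMem h, hξ (not_le.1 h)]

lemma integral_half_eq {G : Geometry} {F : ℝ → ℂ}
    (hF : ∀ᵐ ξ ∂(freqMeasure G), ξ < 0 → F ξ = 0) :
    ∫ ξ, F ξ ∂(halfMeasure G) = ∫ ξ, F ξ ∂(freqMeasure G) := by
  rw [halfMeasure, ← integral_indicator measurableSet_Ici]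
  refine integral_congr_ae ?_
  filter_upwards [hF] with ξ hξ
  by_cases h : ξ ∈ Ici (0 : ℝ)
  · rw [indicator_of_mem h]
  · rw [indicator_of_notMem h, hξ (not_le.1 h)]

lemma ae_half {G : Geometry} {p : ℝ → Prop} (h : ∀ᵐ ξ ∂(freqMeasure G), p ξ) :
    ∀ᵐ ξ ∂(halfMeasure G), p ξ := ae_restrict_of_ae h

lemma ae_half_nonneg (G : Geometry) : ∀ᵐ ξ ∂(halfMeasure G), 0 ≤ ξ :=
  ae_restrict_mem measurableSet_Ici

lemma ae_half_iff {G : Geometry} {p : ℝ → Prop} :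
    (∀ᵐ ξ ∂(halfMeasure G), p ξ) ↔ ∀ᵐ ξ ∂(freqMeasure G), 0 ≤ ξ → p ξ :=
  ae_restrict_iff' measurableSet_Ici

lemma hardyHat_eq_zero {G : Geometry} (f : L2Plus G) :
    ∀ᵐ ξ ∂(freqMeasure G), ξ < 0 → hardyHat f ξ = 0 := f.2

lemma memLp_hardyHat {G : Geometry} (f : L2Plus G) : MemLp (hardyHat f) 2 (halfMeasure G) :=
  (memLp_fourierL2 G f).restrict _

lemma hardyHat_add {G : Geometry} (f g : L2Plus G) :
    hardyHat (f + g) =ᵐ[freqMeasure G] fun ξ => hardyHat f ξ + hardyHat g ξ :=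
  fourierL2_add G f g

lemma hardyHat_smul {G : Geometry} (c : ℂ) (f : L2Plus G) :
    hardyHat (c • f) =ᵐ[freqMeasure G] fun ξ => c * hardyHat f ξ :=
  fourierL2_smul G c f

/-- The Fourier transform on the Hardy space, onto the square integrable functions of nonnegative
frequencies, as an isometry. -/
def hardyIsometry (G : Geometry) : L2Plus G →ₗᵢ[ℂ] Lp ℂ 2 (halfMeasure G) where
  toFun f := (memLp_hardyHat f).toLp
  map_add' f g := by
    rw [← MemLp.toLp_add]
    exact MemLp.toLp_congr _ _ (ae_half (hardyHat_add f g))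
  map_smul' c f := by
    rw [RingHom.id_apply, ← MemLp.toLp_const_smul]
    exact MemLp.toLp_congr _ _ (ae_half (hardyHat_smul c f))
  norm_map' f := by
    change ‖(memLp_hardyHat f).toLp‖ = ‖f‖
    have h : ∫⁻ ξ, ‖hardyHat f ξ‖ₑ ^ 2 ∂(halfMeasure G) = ‖f‖ₑ ^ 2 := by
      rw [lintegral_half_eq]
      · exact lintegral_fourierL2 G f
      · filter_upwards [hardyHat_eq_zero f] with ξ hξ h0
        rw [hξ h0]; simp
    rw [← eLpNorm_two_sq] at h
    have h2 : eLpNorm (hardyHat f) 2 (halfMeasure G) = ‖f‖ₑ :=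
      le_antisymm ((ENNReal.pow_le_pow_left_iff two_ne_zero).1 h.le)
        ((ENNReal.pow_le_pow_left_iff two_ne_zero).1 h.ge)
    rw [Lp.norm_toLp, h2, toReal_enorm]

lemma hardyIsometry_surjective (G : Geometry) : Function.Surjective (hardyIsometry G) := by
  intro φ
  have h1 : MemLp ((Ici (0 : ℝ)).indicator φ) 2 (freqMeasure G) :=
    (memLp_indicator_iff_restrict measurableSet_Ici).2 (Lp.memLp φ)
  obtain ⟨f, hf⟩ := exists_fourierL2_eq G h1
  have hmem : f ∈ L2Plus G := by
    change ∀ᵐ ξ ∂(freqMeasure G), ξ < 0 → fourierL2 G f ξ = 0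
    filter_upwards [hf] with ξ hξ h0
    rw [hξ, indicator_of_notMem (by simpa using h0)]
  refine ⟨⟨f, hmem⟩, Lp.ext ?_⟩
  have h2 := (memLp_hardyHat (⟨f, hmem⟩ : L2Plus G)).coeFn_toLp
  refine h2.trans ?_
  filter_upwards [ae_half hf, ae_half_nonneg G] with ξ hξ h0
  change fourierL2 G f ξ = _
  rw [hξ, indicator_of_mem (by simpa using h0)]

/-- The Fourier transform identifies the Hardy space with the square integrable functions of
nonnegative frequencies. -/
def hardyIso (G : Geometry) : L2Plus G ≃ₗᵢ[ℂ] Lp ℂ 2 (halfMeasure G) :=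
  LinearIsometryEquiv.ofSurjective (hardyIsometry G) (hardyIsometry_surjective G)

lemma hardyIso_coeFn {G : Geometry} (f : L2Plus G) :
    hardyIso G f =ᵐ[halfMeasure G] hardyHat f := (memLp_hardyHat f).coeFn_toLp

/-- `∫ q |f|² dx` as the quadratic form of the weighted convolution operator. -/
lemma integrable_potential {G : Geometry} {κ C : ℝ} {Q : ℝ → ℂ}
    (h : HSKernel (halfMeasure G) (weightedKernel G κ (1 / 2) (1 / 2) Q) C) (f : L2Plus G)
    (y : Lp ℂ 2 (halfMeasure G))
    (hy : ∀ᵐ ξ ∂(halfMeasure G), hardyHat f ξ = (((|ξ| + κ) ^ (-(1 / 2) : ℝ) : ℝ) : ℂ) * y ξ) :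
    Integrable (fun ξ => Q (-ξ) * sqHat f ξ) (freqMeasure G) ∧
      ∫ ξ, Q (-ξ) * sqHat f ξ ∂(freqMeasure G) = ⟪y, h.op y⟫_ℂ := by
  set μ := freqMeasure G with hμ
  set w : ℝ → ℂ := fun ξ => (((|ξ| + κ) ^ (-(1 / 2) : ℝ) : ℝ) : ℂ) with hw
  have hwc : ∀ ξ, (starRingEnd ℂ) (w ξ) = w ξ := fun ξ => Complex.conj_ofReal _
  set φ : ℝ → ℂ := (Ici (0 : ℝ)).indicator fun ξ => w ξ * y ξ with hφ
  have hfφ : hardyHat f =ᵐ[μ] φ := by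
    filter_upwards [ae_half_iff.1 hy, hardyHat_eq_zero f] with ξ h1 h2
    by_cases h0 : 0 ≤ ξ
    · rw [h1 h0, hφ, indicator_of_mem (by simpa using h0)]
    · rw [h2 (not_le.1 h0), hφ, indicator_of_notMem (by simpa using h0)]
  have hsq : ∀ᵐ ξ ∂μ, Q (-ξ) * sqHat f ξ =
      ∫ η, (starRingEnd ℂ) (φ η) * ((fourierConst G : ℂ) * Q (-ξ) * φ (ξ + η)) ∂μ := by
    filter_upwards [sqHat_eq G, ae_measurePreserving_add G] with ξ h1 h2
    rw [h1, ← mul_assoc, ← integral_const_mul]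
    refine integral_congr_ae ?_
    filter_upwards [hfφ, h2.quasiMeasurePreserving.ae hfφ] with η h3 h4
    rw [h3, h4, add_comm η ξ]
    ring
  set F : ℝ × ℝ → ℂ := fun p =>
    (starRingEnd ℂ) (φ p.2) * ((fourierConst G : ℂ) * Q (p.2 - p.1) * φ p.1) with hF
  set F' : ℝ × ℝ → ℂ := fun p =>
    (starRingEnd ℂ) (y p.1) * (weightedKernel G κ (1 / 2) (1 / 2) Q p * y p.2) with hF'
  -- Writing f̂ as weight times y puts one half-weight on each side of q̂, which is the symmetric
  -- kernel; the swap matches the order of its arguments, and the indicator restricts to nonnegative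
  -- frequencies.
  have hFF' : F = (Ici (0 : ℝ) ×ˢ Ici (0 : ℝ)).indicator (F' ∘ Prod.swap) := by
    funext p
    by_cases hp : p ∈ Ici (0 : ℝ) ×ˢ Ici (0 : ℝ)
    · rw [indicator_of_mem hp, hF, hF', hφ]
      simp only [Function.comp_apply, Prod.fst_swap, Prod.snd_swap, indicator_of_mem hp.1,
        indicator_of_mem hp.2, weightedKernel, map_mul, hwc]
      simp only [hw]
      ring
    · rw [indicator_of_notMem hp, hF]
      rw [mem_prod, not_and_or] at hp
      rcases hp with hp | hp
      · simp only [hφ, indicator_of_notMem hp, mul_zero]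
      · simp only [hφ, indicator_of_notMem hp, map_zero, zero_mul]
  have hms : MeasurableSet (Ici (0 : ℝ) ×ˢ Ici (0 : ℝ)) := measurableSet_Ici.prod measurableSet_Ici
  have hint' : Integrable (F' ∘ Prod.swap) ((halfMeasure G).prod (halfMeasure G)) :=
    (h.integrable y y).swap
  have hint : Integrable F (μ.prod μ) := by
    rw [hFF', integrable_indicator_iff hms, IntegrableOn, ← Measure.prod_restrict]
    exact hint'
  have hval : ∫ p, F p ∂(μ.prod μ) = ⟪y, h.op y⟫_ℂ := by
    rw [hFF', integral_indicator hms, ← Measure.prod_restrict, h.inner_op]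
    exact integral_prod_swap F'
  -- The shear (ξ, η) ↦ (ξ+η, η) carries the double integral of F to the iterated integral of Q(−ξ)
  -- against the autocorrelation. Integrability of the outer integrand is then part of Fubini's
  -- theorem.
  have hS := measurePreserving_shear G
  have hS' : Integrable (fun p : ℝ × ℝ => F (p.2 + p.1, p.1)) (μ.prod μ) :=
    hS.integrable_comp_of_integrable hint
  have hSval : ∫ p : ℝ × ℝ, F (p.2 + p.1, p.1) ∂(μ.prod μ) = ∫ p, F p ∂(μ.prod μ) := by
    have hms : AEStronglyMeasurable F (Measure.map (fun p : ℝ × ℝ => (p.2 + p.1, p.1))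
        (μ.prod μ)) := by rw [hS.map_eq]; exact hint.1
    rw [← integral_map hS.measurable.aemeasurable hms, hS.map_eq]
  have hFv : ∀ ξ η : ℝ, F (ξ + η, η) =
      (starRingEnd ℂ) (φ η) * ((fourierConst G : ℂ) * Q (-ξ) * φ (ξ + η)) := by
    intro ξ η
    simp only [hF]
    rw [show η - (ξ + η) = -ξ by ring]
  constructor
  · refine hS'.integral_prod_right.congr ?_
    filter_upwards [hsq] with ξ hξ
    rw [hξ]
    simp only [hFv]
  · rw [← hval, ← hSval, integral_prod_symm _ hS']
    refine integral_congr_ae ?_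
    filter_upwards [hsq] with ξ hξ
    rw [hξ]
    simp only [hFv]

/-! ### Uniqueness of the Fourier transform of a distribution -/

/-- Every smooth compactly supported function of frequency occurs as a test weight, so bump
functions can localize in frequency. -/
lemma exists_fourierInv_eq {u : ℝ → ℝ} (hu : ContDiff ℝ (⊤ : ℕ∞) u) (hc : HasCompactSupport u) :
    ∃ g : 𝓢(ℝ, ℂ), ∀ ξ : ℝ, (𝓕⁻ g : 𝓢(ℝ, ℂ)) (ξ / (2 * Real.pi)) = (u ξ : ℂ) := by
  have hpi : (2 * Real.pi) ≠ 0 := by positivity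
  have h1 : ContDiff ℝ (⊤ : ℕ∞) fun v : ℝ => ((u (2 * Real.pi * v) : ℝ) : ℂ) :=
    Complex.ofRealCLM.contDiff.comp (hu.comp (contDiff_const.mul contDiff_id))
  have h2 : HasCompactSupport fun v : ℝ => ((u (2 * Real.pi * v) : ℝ) : ℂ) := by
    have h3 : HasCompactSupport fun v : ℝ => u (2 * Real.pi * v) :=
      hc.comp_homeomorph (Homeomorph.mulLeft₀ (2 * Real.pi) hpi)
    exact h3.comp_left (g := fun x : ℝ => (x : ℂ)) rfl
  refine ⟨𝓕 (h2.toSchwartzMap h1), fun ξ => ?_⟩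
  rw [FourierTransform.fourierInv_fourier_eq]
  change ((u (2 * Real.pi * (ξ / (2 * Real.pi))) : ℝ) : ℂ) = u ξ
  rw [mul_div_cancel₀ _ hpi]

lemma HasFourierTransform.locallyIntegrable {G : Geometry} {T : 𝓢'(ℝ, ℂ)} {φ : ℝ → ℂ}
    (h : HasFourierTransform G T φ) : LocallyIntegrable φ (freqMeasure G) := by
  intro x
  let b : ContDiffBump x := ⟨1, 2, one_pos, one_lt_two⟩
  obtain ⟨g, hg⟩ := exists_fourierInv_eq b.contDiff b.hasCompactSupport
  refine ⟨Metric.closedBall x 1, Metric.closedBall_mem_nhds x one_pos, ?_⟩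
  refine ((h.2 g).1.integrableOn (s := Metric.closedBall x 1)).congr ?_
  filter_upwards [ae_restrict_mem Metric.isClosed_closedBall.measurableSet] with ξ hξ
  rw [hg, b.one_of_mem_closedBall hξ, Complex.ofReal_one, mul_one]

/-- Fundamental lemma of the calculus of variations. Hence the arbitrary choice in `distHat` is
harmless up to null sets. -/
lemma HasFourierTransform.ae_eq {G : Geometry} {T : 𝓢'(ℝ, ℂ)} {φ ψ : ℝ → ℂ}
    (h : HasFourierTransform G T φ) (h' : HasFourierTransform G T ψ) :
    φ =ᵐ[freqMeasure G] ψ := by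
  have := ae_eq_zero_of_integral_contDiff_smul_eq_zero
    (h.locallyIntegrable.sub h'.locallyIntegrable) (fun u hu hc => by
      obtain ⟨g, hg⟩ := exists_fourierInv_eq hu hc
      obtain ⟨i1, e1⟩ := h.2 g
      obtain ⟨i2, e2⟩ := h'.2 g
      have h3 := mul_left_cancel₀ (fourierConst_ne G) (e1.symm.trans e2)
      have h4 := integral_sub i1 i2
      rw [h3, sub_self] at h4
      rw [← h4]
      refine integral_congr_ae (Eventually.of_forall fun ξ => ?_)
      simp only [hg, Pi.sub_apply, Complex.real_smul]
      ring)
  filter_upwards [this] with ξ hξ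
  exact sub_eq_zero.1 hξ

lemma hasFourierTransform_distHat {G : Geometry} {T : 𝓢'(ℝ, ℂ)}
    (h : ∃ φ, HasFourierTransform G T φ) : HasFourierTransform G T (distHat G T) := by
  rw [distHat, dif_pos h]
  exact h.choose_spec

lemma HasFourierTransform.distHat_ae_eq {G : Geometry} {T : 𝓢'(ℝ, ℂ)} {φ : ℝ → ℂ}
    (h : HasFourierTransform G T φ) : distHat G T =ᵐ[freqMeasure G] φ :=
  (hasFourierTransform_distHat ⟨φ, h⟩).ae_eq h

/-! ### Real distributions -/

lemma conj_fourierInv_of_real {g : 𝓢(ℝ, ℂ)} (hg : ∀ x, (g x).im = 0) (v : ℝ) :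
    (starRingEnd ℂ) ((𝓕⁻ g : 𝓢(ℝ, ℂ)) v) = (𝓕⁻ g : 𝓢(ℝ, ℂ)) (-v) := by
  rw [SchwartzMap.fourierInv_coe, Real.fourierInv_eq', Real.fourierInv_eq', ← integral_conj]
  refine integral_congr_ae (Eventually.of_forall fun x => ?_)
  simp only [smul_eq_mul, map_mul, ← Complex.exp_conj, Complex.conj_eq_iff_im.2 (hg x),
    Complex.conj_I, Complex.conj_ofReal, RCLike.inner_apply]
  congr 2
  push_cast
  ring

/-- For a real test function the value of T is its own conjugate, and conjugating the integral
reflects ξ. Complex test functions follow by splitting into real and imaginary parts. -/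
lemma HasFourierTransform.conj_neg {G : Geometry} {T : 𝓢'(ℝ, ℂ)} {φ : ℝ → ℂ}
    (h : HasFourierTransform G T φ) (hT : IsRealValued T) :
    HasFourierTransform G T fun ξ => (starRingEnd ℂ) (φ (-ξ)) := by
  have hneg := measurePreserving_neg_freq G
  refine ⟨Complex.continuous_conj.comp_aestronglyMeasurable
    (h.1.comp_quasiMeasurePreserving hneg.quasiMeasurePreserving), ?_⟩
  have hreal : ∀ g : 𝓢(ℝ, ℂ), (∀ x, (g x).im = 0) →
      Integrable (fun ξ => (starRingEnd ℂ) (φ (-ξ)) * (𝓕⁻ g : 𝓢(ℝ, ℂ)) (ξ / (2 * Real.pi)))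
        (freqMeasure G) ∧
      T g = (fourierConst G : ℂ) *
        ∫ ξ, (starRingEnd ℂ) (φ (-ξ)) * (𝓕⁻ g : 𝓢(ℝ, ℂ)) (ξ / (2 * Real.pi)) ∂(freqMeasure G) := by
    intro g hg
    obtain ⟨i1, e1⟩ := h.2 g
    have hF : ∀ ξ, (starRingEnd ℂ) (φ (-ξ)) * (𝓕⁻ g : 𝓢(ℝ, ℂ)) (ξ / (2 * Real.pi)) =
        (starRingEnd ℂ) (φ (-ξ) * (𝓕⁻ g : 𝓢(ℝ, ℂ)) (-ξ / (2 * Real.pi))) := by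
      intro ξ
      rw [map_mul, conj_fourierInv_of_real hg, neg_div, neg_neg]
    simp only [hF]
    have i2 : Integrable (fun ξ => φ (-ξ) * (𝓕⁻ g : 𝓢(ℝ, ℂ)) (-ξ / (2 * Real.pi)))
        (freqMeasure G) := hneg.integrable_comp_of_integrable i1
    refine ⟨Complex.conjLIE.integrable_comp_iff.2 i2, ?_⟩
    rw [integral_conj]
    have h3 : ∫ ξ, φ (-ξ) * (𝓕⁻ g : 𝓢(ℝ, ℂ)) (-ξ / (2 * Real.pi)) ∂(freqMeasure G) =
        ∫ ξ, φ ξ * (𝓕⁻ g : 𝓢(ℝ, ℂ)) (ξ / (2 * Real.pi)) ∂(freqMeasure G) :=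
      hneg.integral_comp (MeasurableEquiv.neg ℝ).measurableEmbedding
        (fun ξ => φ ξ * (𝓕⁻ g : 𝓢(ℝ, ℂ)) (ξ / (2 * Real.pi)))
    rw [h3]
    have h4 := Complex.conj_eq_iff_im.2 (hT g hg)
    rw [e1, map_mul, Complex.conj_ofReal] at h4
    rw [e1, h4]
  intro g
  let gre : 𝓢(ℝ, ℂ) := g.postcompCLM (Complex.ofRealCLM ∘L Complex.reCLM : ℂ →L[ℝ] ℂ)
  let gim : 𝓢(ℝ, ℂ) := g.postcompCLM (Complex.ofRealCLM ∘L Complex.imCLM : ℂ →L[ℝ] ℂ)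
  have hg : g = gre + Complex.I • gim := by
    ext x
    simp [gre, gim, mul_comm Complex.I, Complex.re_add_im]
  obtain ⟨i1, e1⟩ := hreal gre fun x => by simp [gre]
  obtain ⟨i2, e2⟩ := hreal gim fun x => by simp [gim]
  have h5 : ∀ ξ, (starRingEnd ℂ) (φ (-ξ)) * (𝓕⁻ g : 𝓢(ℝ, ℂ)) (ξ / (2 * Real.pi)) =
      (starRingEnd ℂ) (φ (-ξ)) * (𝓕⁻ gre : 𝓢(ℝ, ℂ)) (ξ / (2 * Real.pi)) +
        Complex.I * ((starRingEnd ℂ) (φ (-ξ)) * (𝓕⁻ gim : 𝓢(ℝ, ℂ)) (ξ / (2 * Real.pi))) := by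
    intro ξ
    rw [hg, FourierTransform.fourierInv_add, FourierTransform.fourierInv_smul]
    simp only [add_apply, smul_apply, smul_eq_mul]
    ring
  simp only [h5]
  refine ⟨i1.add (i2.const_mul _), ?_⟩
  rw [integral_add i1 (i2.const_mul _), integral_const_mul, mul_add, mul_left_comm, ← e1, ← e2]
  conv_lhs => rw [hg, map_add, map_smul]
  rfl

lemma distHat_neg {G : Geometry} {T : 𝓢'(ℝ, ℂ)} (h : ∃ φ, HasFourierTransform G T φ)
    (hT : IsRealValued T) :
    ∀ᵐ ξ ∂(freqMeasure G), distHat G T ξ = (starRingEnd ℂ) (distHat G T (-ξ)) :=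
  (hasFourierTransform_distHat h).ae_eq ((hasFourierTransform_distHat h).conj_neg hT)

/-! ### Distributions with a given Fourier transform -/

lemma rpow_sq_eq {x : ℝ} (hx : 0 ≤ x) (σ : ℝ) : (x ^ σ) ^ 2 = x ^ (2 * σ) := by
  rw [← Real.rpow_natCast, ← Real.rpow_mul hx, mul_comm σ]; rfl

/-- Cauchy–Schwarz with the splitting −2 = σ + (−2−σ); the second weight is square integrable since
2(−2−σ) ≤ −2. -/
lemma WeightedL2.integrable_mul_decay {G : Geometry} {σ : ℝ} (hσ : -1 / 2 < σ) {φ : ℝ → ℂ}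
    (h : WeightedL2 G σ φ) :
    Integrable (fun ξ => φ ξ * (((|ξ| + 1) ^ (-(2 : ℝ)) : ℝ) : ℂ)) (freqMeasure G) := by
  have h1 : MemLp (fun ξ => (((|ξ| + 1) ^ σ : ℝ) : ℂ) * φ ξ) 2 (freqMeasure G) := by
    have hm : AEStronglyMeasurable (fun ξ => (((|ξ| + 1) ^ σ : ℝ) : ℂ) * φ ξ) (freqMeasure G) :=
      (by fun_prop : Measurable fun ξ : ℝ => (((|ξ| + 1) ^ σ : ℝ) : ℂ)).aestronglyMeasurable.mul h.1
    rw [← memLp_norm_iff hm, memLp_two_iff_integrable_sq hm.norm]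
    refine h.2.congr (Eventually.of_forall fun ξ => ?_)
    simp only [norm_mul, Complex.norm_real]
    rw [Real.norm_of_nonneg (by positivity), mul_pow, rpow_sq_eq (by positivity)]
  have h2 : MemLp (fun ξ : ℝ => (((|ξ| + 1) ^ (-2 - σ) : ℝ) : ℂ)) 2 (freqMeasure G) := by
    have hm : Measurable fun ξ : ℝ => (((|ξ| + 1) ^ (-2 - σ) : ℝ) : ℂ) := by fun_prop
    obtain ⟨C, hC, hCle⟩ := exists_lintegral_weight_le G (p := 2) (by norm_num)
    rw [memLp_two_iff hm.aestronglyMeasurable]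
    refine ne_top_of_le_ne_top ENNReal.ofReal_ne_top ((lintegral_mono fun ξ => ?_).trans
      (hCle 1 le_rfl))
    rw [← ofReal_norm, ← ENNReal.ofReal_pow (norm_nonneg _), Complex.norm_real,
      Real.norm_of_nonneg (by positivity), rpow_sq_eq (by positivity)]
    refine ENNReal.ofReal_le_ofReal (Real.rpow_le_rpow_of_exponent_le ?_ ?_)
    · linarith [abs_nonneg ξ]
    · linarith
  refine (h1.integrable_mul h2).congr (Eventually.of_forall fun ξ => ?_)
  simp only [Pi.mul_apply]
  have h3 : (|ξ| + 1) ^ (-(2 : ℝ)) = (|ξ| + 1) ^ σ * (|ξ| + 1) ^ (-2 - σ) := by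
    rw [← Real.rpow_add (by positivity)]; congr 1; ring
  rw [h3]
  push_cast
  ring

lemma norm_schwartz_div_le (g : 𝓢(ℝ, ℂ)) (ξ : ℝ) :
    ‖g (ξ / (2 * Real.pi))‖ ≤ ((2 * Real.pi) ^ 2 * 4 *
      (Finset.Iic ((2 : ℕ), (0 : ℕ))).sup (schwartzSeminormFamily ℂ ℝ ℂ) g) *
        (|ξ| + 1) ^ (-(2 : ℝ)) := by
  have h := SchwartzMap.one_add_le_sup_seminorm_apply (𝕜 := ℂ) (m := (2, 0)) (k := 2) (n := 0)
    le_rfl le_rfl g (ξ / (2 * Real.pi))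
  rw [norm_iteratedFDeriv_zero] at h
  have hpos : 0 < |ξ| + 1 := by positivity
  rw [Real.rpow_neg hpos.le, Real.rpow_two, ← div_eq_mul_inv, le_div_iff₀ (by positivity)]
  have h1 : |ξ| + 1 ≤ 2 * Real.pi * (1 + ‖ξ / (2 * Real.pi)‖) := by
    rw [Real.norm_eq_abs, abs_div, abs_of_pos (by positivity : 0 < 2 * Real.pi), mul_add,
      mul_div_cancel₀ _ (by positivity)]
    linarith [Real.pi_gt_three]
  calc ‖g (ξ / (2 * Real.pi))‖ * (|ξ| + 1) ^ 2
      ≤ ‖g (ξ / (2 * Real.pi))‖ * (2 * Real.pi * (1 + ‖ξ / (2 * Real.pi)‖)) ^ 2 := by gcongr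
    _ = (2 * Real.pi) ^ 2 * ((1 + ‖ξ / (2 * Real.pi)‖) ^ 2 * ‖g (ξ / (2 * Real.pi))‖) := by ring
    _ ≤ (2 * Real.pi) ^ 2 * (2 ^ 2 *
        (Finset.Iic ((2 : ℕ), (0 : ℕ))).sup (schwartzSeminormFamily ℂ ℝ ℂ) g) := by
        exact mul_le_mul_of_nonneg_left h (by positivity)
    _ = _ := by ring

lemma integrable_mul_schwartz {G : Geometry} {φ : ℝ → ℂ}
    (hφ : AEStronglyMeasurable φ (freqMeasure G))
    (h : Integrable (fun ξ => φ ξ * (((|ξ| + 1) ^ (-(2 : ℝ)) : ℝ) : ℂ)) (freqMeasure G))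
    (g : 𝓢(ℝ, ℂ)) :
    Integrable (fun ξ => φ ξ * g (ξ / (2 * Real.pi))) (freqMeasure G) := by
  refine (h.norm.const_mul ((2 * Real.pi) ^ 2 * 4 *
    (Finset.Iic ((2 : ℕ), (0 : ℕ))).sup (schwartzSeminormFamily ℂ ℝ ℂ) g)).mono'
    (hφ.mul (by fun_prop : Continuous fun ξ : ℝ => g (ξ / (2 * Real.pi))).aestronglyMeasurable)
    (Eventually.of_forall fun ξ => ?_)
  rw [norm_mul, norm_mul, Complex.norm_real, Real.norm_of_nonneg (by positivity)]
  calc _ ≤ ‖φ ξ‖ * _ := mul_le_mul_of_nonneg_left (norm_schwartz_div_le g ξ) (norm_nonneg _)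
    _ = _ := by ring

/-- Integration against φ is bounded by Schwartz seminorms of order two, hence a tempered
distribution; its inverse Fourier transform is the one sought. -/
lemma exists_hasFourierTransform {G : Geometry} {σ : ℝ} (hσ : -1 / 2 < σ) {φ : ℝ → ℂ}
    (hφ : WeightedL2 G σ φ) : ∃ T : 𝓢'(ℝ, ℂ), HasFourierTransform G T φ := by
  have hint := hφ.integrable_mul_decay hσ
  have hi := integrable_mul_schwartz hφ.1 hint
  let S : 𝓢(ℝ, ℂ) →L[ℂ] ℂ := SchwartzMap.mkCLMtoNormedSpace
    (fun g => (fourierConst G : ℂ) * ∫ ξ, φ ξ * g (ξ / (2 * Real.pi)) ∂(freqMeasure G))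
    (fun f g => by
      rw [← mul_add, ← integral_add (hi f) (hi g)]
      simp only [add_apply, mul_add])
    (fun c g => by
      simp only [smul_apply, smul_eq_mul, RingHom.id_apply]
      simp only [mul_left_comm _ c, integral_const_mul])
    (by
      refine ⟨Finset.Iic ((2 : ℕ), (0 : ℕ)), (2 * Real.pi) ^ 2 * 4 *
        ∫ ξ, ‖φ ξ * (((|ξ| + 1) ^ (-(2 : ℝ)) : ℝ) : ℂ)‖ ∂(freqMeasure G), by positivity,
        fun g => ?_⟩
      rw [norm_mul, Complex.norm_real, Real.norm_of_nonneg (fourierConst_pos G).le]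
      refine (mul_le_of_le_one_left (norm_nonneg _) (fourierConst_le_one G)).trans ?_
      refine (norm_integral_le_integral_norm _).trans ?_
      rw [mul_right_comm, ← integral_const_mul]
      refine integral_mono (hi g).norm (hint.norm.const_mul _) fun ξ => ?_
      simp only [norm_mul, Complex.norm_real]
      rw [Real.norm_of_nonneg (by positivity : (0 : ℝ) ≤ (|ξ| + 1) ^ (-(2 : ℝ)))]
      calc _ ≤ ‖φ ξ‖ * _ := mul_le_mul_of_nonneg_left (norm_schwartz_div_le g ξ) (norm_nonneg _)
        _ = _ := by ring)
  let T₀ : 𝓢'(ℝ, ℂ) := ContinuousLinearMap.toPointwiseConvergenceCLM _ _ _ _ S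
  refine ⟨𝓕⁻ T₀, hφ.1, fun g => ⟨hi _, ?_⟩⟩
  rw [TemperedDistribution.fourierInv_apply]
  rfl

lemma exists_memHPlus {G : Geometry} {σ : ℝ} (hσ : -1 / 2 < σ) {φ : ℝ → ℂ}
    (hφ : WeightedL2 G σ φ) (hφ0 : ∀ᵐ ξ ∂(freqMeasure G), ξ < 0 → φ ξ = 0) :
    ∃ T : 𝓢'(ℝ, ℂ), MemHPlus G σ T ∧ distHat G T =ᵐ[freqMeasure G] φ := by
  obtain ⟨T, hT⟩ := exists_hasFourierTransform hσ hφ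
  have h := hT.distHat_ae_eq
  refine ⟨T, ⟨⟨⟨φ, hT⟩, (hasFourierTransform_distHat ⟨φ, hT⟩).1, hφ.2.congr ?_⟩, ?_⟩, h⟩
  · filter_upwards [h] with ξ hξ
    rw [hξ]
  · filter_upwards [h, hφ0] with ξ h1 h2 h3
    rw [h1, h2 h3]

/-! ### Small perturbations and the resolvent form -/

namespace FormFactors

variable {H : Type*} [NormedAddCommGroup H] [InnerProductSpace ℂ H] [CompleteSpace H]

/-- The factors `B` and `J = 1 - S` with `S` of norm at most `1/2`. -/
def ofPerturbation (B S : H →L[ℂ] H) (hB : IsSelfAdjoint B) (hBi : Function.Injective B)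
    (hS : IsSelfAdjoint S) (hn : ‖S‖ ≤ 1 / 2) : FormFactors H where
  B := B
  J := 1 - S
  invJ := Ring.inverse (1 - S)
  isSelfAdjoint_B := hB
  injective_B := hBi
  isSelfAdjoint_J := (IsSelfAdjoint.one _).sub hS
  coercive y := by
    have h1 : (⟪y, S y⟫_ℂ).re ≤ 1 / 2 * ‖y‖ ^ 2 := by
      refine (Complex.re_le_norm _).trans ((norm_inner_le_norm _ _).trans ?_)
      have h2 := S.le_of_opNorm_le hn y
      nlinarith [norm_nonneg y]
    have h3 : (⟪y, y⟫_ℂ).re = ‖y‖ ^ 2 := inner_self_eq_norm_sq (𝕜 := ℂ) y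
    rw [sub_apply, one_apply_eq_self, inner_sub_right, Complex.sub_re, h3]
    linarith
  J_invJ := Ring.mul_inverse_cancel _ (isUnit_one_sub_of_norm_lt_one (by linarith))
  invJ_J := Ring.inverse_mul_cancel _ (isUnit_one_sub_of_norm_lt_one (by linarith))

variable (D : FormFactors H)

/-- Here b plays the role of B f for a possibly non-L² datum f, and u₀ = B J⁻¹ b is (𝓛+κ)⁻¹f, which
is in H. The resolvent identity gives ⟨f, (𝓛+z)⁻¹f⟩ = ⟨b, J⁻¹b⟩ + (κ−z)⟨u₀, (1−(κ−z)T)⁻¹u₀⟩, where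
only a matrix element of the pencil between vectors of H depends on z. The vector y is B⁻¹u, so that
⟨b, y⟩ stands for ⟨f, u⟩. -/
lemma exists_meromorphic (κ : ℝ) (b : H) : ∃ F : ℂ → ℂ,
    MeromorphicOn F {z | -z ∉ essSpec (D.op κ)} ∧
    AnalyticOnNhd ℂ F {z | -z ∈ resolventSet (D.op κ)} ∧
    ∀ z, -z ∈ resolventSet (D.op κ) → ∃ y,
      (1 - (-z + κ) • D.T) (D.B y) = D.B (D.invJ b) ∧
      (∀ u, (1 - (-z + κ) • D.T) u = D.B (D.invJ b) → u = D.B y) ∧ F z = ⟪b, y⟫_ℂ := by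
  set u₀ := D.B (D.invJ b) with hu₀
  have haff : ∀ z : ℂ, AnalyticAt ℂ (fun z : ℂ => -z + κ) z := fun z => by fun_prop
  refine ⟨fun z => ⟪b, D.invJ b⟫_ℂ + (-z + κ) * ⟪u₀, Ring.inverse (1 - (-z + κ) • D.T) u₀⟫_ℂ,
    fun z hz => ?_, fun z hz => ?_, fun z hz => ?_⟩
  · obtain ⟨K, hK, hU⟩ := (notMem_essSpec_shiftedInverse D.isSelfAdjoint_T).1 hz
    have h : MeromorphicAt (fun z : ℂ =>
        ⟪u₀, (Ring.inverse (1 - (-z + κ) • D.T) : H →L[ℂ] H) u₀⟫_ℂ) z :=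
      MeromorphicAt.comp_analyticAt (g := fun z : ℂ => -z + κ)
        (meromorphicAt_inverse_pencil D.isSelfAdjoint_T hK hU u₀ u₀) (haff z)
    exact (MeromorphicAt.const _ z).add ((haff z).meromorphicAt.mul h)
  · have hU : IsUnit (1 - (-z + κ) • D.T + 0) := by
      rw [add_zero]
      exact mem_resolventSet_shiftedInverse.1 hz
    have h := analyticAt_inverse_pencil hU u₀ u₀
    simp only [add_zero] at h
    have h2 := AnalyticAt.fun_comp (g := fun z => ⟪u₀, (Ring.inverse (1 - z • D.T) : H →L[ℂ] H) u₀⟫_ℂ)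
      (f := fun z : ℂ => -z + κ) h (haff z)
    exact analyticAt_const.add ((haff z).mul h2)
  · have hU : IsUnit (1 - (-z + κ) • D.T) := mem_resolventSet_shiftedInverse.1 hz
    set V := Ring.inverse (1 - (-z + κ) • D.T) with hV
    have h1 : ∀ x, (1 - (-z + κ) • D.T) (V x) = x := fun x => by
      rw [← mul_apply_eq_comp, Ring.mul_inverse_cancel _ hU, one_apply_eq_self]
    have h2 : ∀ x, V ((1 - (-z + κ) • D.T) x) = x := fun x => by
      rw [← mul_apply_eq_comp, Ring.inverse_mul_cancel _ hU, one_apply_eq_self]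
    have h3 : V u₀ = D.B (D.invJ b + (-z + κ) • D.invJ (D.B (V u₀))) := by
      have h4 := h1 u₀
      rw [sub_apply, one_apply_eq_self, smul_apply, sub_eq_iff_eq_add, T_apply] at h4
      rw [map_add, map_smul, ← hu₀]
      exact h4
    refine ⟨D.invJ b + (-z + κ) • D.invJ (D.B (V u₀)), ?_, fun u hu => ?_, ?_⟩
    · rw [← h3, h1]
    · rw [← h3, ← hu, h2]
    · rw [inner_add_right, inner_smul_right, ← D.inner_invJ b (D.B _), ← D.inner_B]

end FormFactors

/-! ### Conjugation of bounded operators by a unitary map. -/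

section Transport

variable {H H' : Type*} [NormedAddCommGroup H] [InnerProductSpace ℂ H]
  [NormedAddCommGroup H'] [InnerProductSpace ℂ H']

/-- The operator on `H` which corresponds to an operator on `H'`. -/
def pullOp (e : H ≃ₗᵢ[ℂ] H') (A : H' →L[ℂ] H') : H →L[ℂ] H :=
  (e.symm.toContinuousLinearEquiv : H' →L[ℂ] H) ∘L A ∘L (e.toContinuousLinearEquiv : H →L[ℂ] H')

lemma pullOp_apply (e : H ≃ₗᵢ[ℂ] H') (A : H' →L[ℂ] H') (x : H) :
    pullOp e A x = e.symm (A (e x)) := rfl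

lemma apply_pullOp (e : H ≃ₗᵢ[ℂ] H') (A : H' →L[ℂ] H') (x : H) :
    e (pullOp e A x) = A (e x) := by
  rw [pullOp_apply, LinearIsometryEquiv.apply_symm_apply]

lemma injective_pullOp {e : H ≃ₗᵢ[ℂ] H'} {A : H' →L[ℂ] H'} (hA : Function.Injective A) :
    Function.Injective (pullOp e A) :=
  e.symm.injective.comp (hA.comp e.injective)

lemma norm_pullOp_le {e : H ≃ₗᵢ[ℂ] H'} {A : H' →L[ℂ] H'} {C : ℝ} (hC : 0 ≤ C)
    (hA : ∀ x, ‖A x‖ ≤ C * ‖x‖) : ‖pullOp e A‖ ≤ C := by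
  refine ContinuousLinearMap.opNorm_le_bound _ hC fun x => ?_
  rw [pullOp_apply, LinearIsometryEquiv.norm_map, ← e.norm_map x]
  exact hA _

lemma isCompactOperator_pullOp {e : H ≃ₗᵢ[ℂ] H'} {A : H' →L[ℂ] H'} (hA : IsCompactOperator A) :
    IsCompactOperator (pullOp e A) := by
  have h := (hA.comp_clm (e.toContinuousLinearEquiv : H →L[ℂ] H')).clm_comp
    (e.symm.toContinuousLinearEquiv : H' →L[ℂ] H)
  exact h

lemma isSelfAdjoint_pullOp [CompleteSpace H] [CompleteSpace H'] {e : H ≃ₗᵢ[ℂ] H'}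
    {A : H' →L[ℂ] H'} (hA : IsSelfAdjoint A) : IsSelfAdjoint (pullOp e A) := by
  refine ContinuousLinearMap.isSelfAdjoint_iff_isSymmetric.2 fun x y => ?_
  change ⟪pullOp e A x, y⟫_ℂ = ⟪x, pullOp e A y⟫_ℂ
  rw [← e.inner_map_map, ← e.inner_map_map x, apply_pullOp, apply_pullOp]
  exact ContinuousLinearMap.isSelfAdjoint_iff_isSymmetric.1 hA _ _

end Transport

/-! ### Weighted norms -/

/-- The weight `(|ξ| + κ)^α`. -/
def freqWeight (κ α ξ : ℝ) : ℂ := (((|ξ| + κ) ^ α : ℝ) : ℂ)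

lemma measurable_freqWeight (κ α : ℝ) : Measurable (freqWeight κ α) :=
  (by fun_prop : Measurable fun ξ : ℝ => (((|ξ| + κ) ^ α : ℝ) : ℂ))

lemma conj_freqWeight (κ α ξ : ℝ) : (starRingEnd ℂ) (freqWeight κ α ξ) = freqWeight κ α ξ :=
  Complex.conj_ofReal _

lemma freqWeight_ne_zero {κ : ℝ} (hκ : 1 ≤ κ) (α ξ : ℝ) : freqWeight κ α ξ ≠ 0 :=
  Complex.ofReal_ne_zero.2 (by positivity)

lemma freqWeight_mul {κ : ℝ} (hκ : 1 ≤ κ) (α β ξ : ℝ) :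
    freqWeight κ α ξ * freqWeight κ β ξ = freqWeight κ (α + β) ξ := by
  rw [freqWeight, freqWeight, freqWeight, ← Complex.ofReal_mul, ← Real.rpow_add (by positivity)]

lemma freqWeight_zero (κ ξ : ℝ) : freqWeight κ 0 ξ = 1 := by
  rw [freqWeight, Real.rpow_zero, Complex.ofReal_one]

lemma freqWeight_mul_neg {κ : ℝ} (hκ : 1 ≤ κ) (α ξ : ℝ) :
    freqWeight κ α ξ * freqWeight κ (-α) ξ = 1 := by
  rw [freqWeight_mul hκ, add_neg_cancel, freqWeight_zero]

lemma freqWeight_one {κ ξ : ℝ} (hξ : 0 ≤ ξ) : freqWeight κ 1 ξ = (ξ : ℂ) + κ := by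
  rw [freqWeight, Real.rpow_one, abs_of_nonneg hξ, Complex.ofReal_add]

lemma norm_freqWeight {κ : ℝ} (hκ : 1 ≤ κ) (α ξ : ℝ) : ‖freqWeight κ α ξ‖ = (|ξ| + κ) ^ α := by
  rw [freqWeight, Complex.norm_real, Real.norm_of_nonneg (by positivity)]

lemma norm_freqWeight_le {κ : ℝ} (hκ : 1 ≤ κ) {α : ℝ} (hα : α ≤ 0) (ξ : ℝ) :
    ‖freqWeight κ α ξ‖ ≤ 1 := by
  rw [norm_freqWeight hκ]
  exact Real.rpow_le_one_of_one_le_of_nonpos (by linarith [abs_nonneg ξ]) hα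

/-- Multiplication by `(|ξ| + κ)^α` for `α ≤ 0`. -/
def weightOp (G : Geometry) {κ : ℝ} (hκ : 1 ≤ κ) {α : ℝ} (hα : α ≤ 0) :
    Lp ℂ 2 (halfMeasure G) →L[ℂ] Lp ℂ 2 (halfMeasure G) :=
  mulOp (freqWeight κ α) (measurable_freqWeight κ α) 1
    (Eventually.of_forall (norm_freqWeight_le hκ hα))

lemma weightOp_coeFn {G : Geometry} {κ : ℝ} (hκ : 1 ≤ κ) {α : ℝ} (hα : α ≤ 0)
    (f : Lp ℂ 2 (halfMeasure G)) :
    weightOp G hκ hα f =ᵐ[halfMeasure G] fun ξ => freqWeight κ α ξ * f ξ := mulOp_coeFn f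

lemma norm_sq_Lp {G : Geometry} (y : Lp ℂ 2 (halfMeasure G)) :
    ∫ ξ, ‖y ξ‖ ^ 2 ∂(halfMeasure G) = ‖y‖ ^ 2 := by
  have h : ⟪y, y⟫_ℂ = ((∫ ξ, ‖y ξ‖ ^ 2 ∂(halfMeasure G) : ℝ) : ℂ) := by
    rw [L2.inner_def, ← integral_complex_ofReal]
    refine integral_congr_ae (Eventually.of_forall fun ξ => ?_)
    change ⟪y ξ, y ξ⟫_ℂ = _
    rw [inner_self_eq_norm_sq_to_K]
    push_cast
    rfl
  rw [inner_self_eq_norm_sq_to_K] at h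
  exact Complex.ofReal_injective (h.symm.trans (Complex.ofReal_pow _ 2).symm)

lemma integrable_norm_sq_Lp {G : Geometry} (y : Lp ℂ 2 (halfMeasure G)) :
    Integrable (fun ξ => ‖y ξ‖ ^ 2) (halfMeasure G) := by
  have h := Lp.memLp y
  exact (memLp_two_iff_integrable_sq h.1.norm).1 h.norm

lemma norm_freqWeight_mul_sq {κ : ℝ} (hκ : 1 ≤ κ) (σ ξ : ℝ) (c : ℂ) :
    ‖freqWeight κ σ ξ * c‖ ^ 2 = (|ξ| + κ) ^ (2 * σ) * ‖c‖ ^ 2 := by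
  rw [norm_mul, mul_pow, norm_freqWeight hκ, rpow_sq_eq (by positivity)]

lemma sobolevNorm_eq {G : Geometry} {κ : ℝ} (hκ : 1 ≤ κ) {σ : ℝ} {φ : ℝ → ℂ}
    (h0 : ∀ᵐ ξ ∂(freqMeasure G), ξ < 0 → φ ξ = 0) {y : Lp ℂ 2 (halfMeasure G)}
    (hy : y =ᵐ[halfMeasure G] fun ξ => freqWeight κ σ ξ * φ ξ) :
    sobolevNorm G σ κ φ = ‖y‖ := by
  rw [sobolevNorm, ← Real.sqrt_sq (norm_nonneg y), ← norm_sq_Lp]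
  congr 1
  have h1 : ∀ᵐ ξ ∂(freqMeasure G), ξ ∉ Ici (0 : ℝ) → (|ξ| + κ) ^ (2 * σ) * ‖φ ξ‖ ^ 2 = 0 := by
    filter_upwards [h0] with ξ hξ h
    rw [hξ (not_le.1 h)]
    simp
  rw [← setIntegral_eq_integral_of_ae_compl_eq_zero h1]
  refine integral_congr_ae ?_
  filter_upwards [hy] with ξ hξ
  rw [hξ, norm_freqWeight_mul_sq hκ]

lemma rpow_le_of_comparable {X Y κ t : ℝ} (hX : 0 < X) (hXY : X ≤ Y) (hκ : 1 ≤ κ)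
    (hYX : Y ≤ κ * X) : Y ^ t ≤ κ ^ |t| * X ^ t ∧ X ^ t ≤ κ ^ |t| * Y ^ t := by
  have hY : 0 < Y := hX.trans_le hXY
  have h1 : 1 ≤ κ ^ |t| := Real.one_le_rpow hκ (abs_nonneg t)
  rcases le_total 0 t with ht | ht
  · rw [abs_of_nonneg ht] at h1 ⊢
    refine ⟨?_, (Real.rpow_le_rpow hX.le hXY ht).trans (le_mul_of_one_le_left (by positivity) h1)⟩
    rw [← Real.mul_rpow (by linarith) hX.le]
    exact Real.rpow_le_rpow hY.le hYX ht
  · rw [abs_of_nonpos ht] at h1 ⊢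
    refine ⟨(Real.rpow_le_rpow_of_nonpos hX hXY ht).trans
      (le_mul_of_one_le_left (by positivity) h1), ?_⟩
    have h2 := Real.rpow_le_rpow_of_nonpos hY hYX ht
    rw [Real.mul_rpow (by linarith) hX.le] at h2
    rw [Real.rpow_neg (by linarith)]
    have h3 : 0 < κ ^ t := by positivity
    rw [inv_mul_eq_div, le_div_iff₀ h3]
    linarith

lemma integrable_weight_iff {G : Geometry} {κ : ℝ} (hκ : 1 ≤ κ) {t : ℝ} {φ : ℝ → ℂ}
    (hφ : AEStronglyMeasurable φ (freqMeasure G)) :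
    Integrable (fun ξ => (|ξ| + κ) ^ t * ‖φ ξ‖ ^ 2) (freqMeasure G) ↔
      Integrable (fun ξ => (|ξ| + 1) ^ t * ‖φ ξ‖ ^ 2) (freqMeasure G) := by
  have hm : ∀ κ : ℝ, AEStronglyMeasurable (fun ξ => (|ξ| + κ) ^ t * ‖φ ξ‖ ^ 2) (freqMeasure G) :=
    fun κ => (by fun_prop : Measurable fun ξ : ℝ => (|ξ| + κ) ^ t).aestronglyMeasurable.mul
      (hφ.norm.pow 2)
  have hw : ∀ ξ : ℝ, _ := fun ξ => rpow_le_of_comparable (X := |ξ| + 1) (Y := |ξ| + κ) (κ := κ)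
    (t := t) (by positivity) (by linarith) hκ (by nlinarith [abs_nonneg ξ])
  constructor
  · intro h
    refine (h.const_mul (κ ^ |t|)).mono' (hm 1) (Eventually.of_forall fun ξ => ?_)
    rw [Real.norm_of_nonneg (by positivity), ← mul_assoc]
    exact mul_le_mul_of_nonneg_right (hw ξ).2 (by positivity)
  · intro h
    refine (h.const_mul (κ ^ |t|)).mono' (hm κ) (Eventually.of_forall fun ξ => ?_)
    rw [Real.norm_of_nonneg (by positivity), ← mul_assoc]
    exact mul_le_mul_of_nonneg_right (hw ξ).1 (by positivity)

/-- Membership in H^σ does not depend on κ, so any κ ≥ 1 may be used to represent it by an L²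
function of the nonnegative frequencies. Later Sobolev statements are all read through such
representatives. -/
lemma weightedL2_iff {G : Geometry} {κ : ℝ} (hκ : 1 ≤ κ) {σ : ℝ} {φ : ℝ → ℂ}
    (hφ : AEStronglyMeasurable φ (freqMeasure G))
    (h0 : ∀ᵐ ξ ∂(freqMeasure G), ξ < 0 → φ ξ = 0) :
    WeightedL2 G σ φ ↔ ∃ y : Lp ℂ 2 (halfMeasure G),
      y =ᵐ[halfMeasure G] fun ξ => freqWeight κ σ ξ * φ ξ := by
  have h1 : ∀ᵐ ξ ∂(freqMeasure G), ξ ∉ Ici (0 : ℝ) → (|ξ| + κ) ^ (2 * σ) * ‖φ ξ‖ ^ 2 = 0 := by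
    filter_upwards [h0] with ξ hξ h
    rw [hξ (not_le.1 h)]
    simp
  have hm : AEStronglyMeasurable (fun ξ => freqWeight κ σ ξ * φ ξ) (halfMeasure G) :=
    (measurable_freqWeight κ σ).aestronglyMeasurable.mul hφ.restrict
  rw [WeightedL2, ← integrable_weight_iff hκ hφ, and_iff_right hφ]
  have h2 : Integrable (fun ξ => (|ξ| + κ) ^ (2 * σ) * ‖φ ξ‖ ^ 2) (freqMeasure G) ↔
      Integrable (fun ξ => (|ξ| + κ) ^ (2 * σ) * ‖φ ξ‖ ^ 2) (halfMeasure G) := by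
    refine ⟨fun h => h.restrict, fun h => ?_⟩
    have h3 := (integrable_indicator_iff measurableSet_Ici).2 h
    refine h3.congr ?_
    filter_upwards [h1] with ξ hξ
    by_cases h : ξ ∈ Ici (0 : ℝ)
    · rw [indicator_of_mem h]
    · rw [indicator_of_notMem h, hξ h]
  rw [h2]
  constructor
  · intro h
    have hmem : MemLp (fun ξ => freqWeight κ σ ξ * φ ξ) 2 (halfMeasure G) := by
      rw [← memLp_norm_iff hm, memLp_two_iff_integrable_sq hm.norm]
      exact h.congr (Eventually.of_forall fun ξ => (norm_freqWeight_mul_sq hκ σ ξ _).symm)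
    exact ⟨hmem.toLp, hmem.coeFn_toLp⟩
  · rintro ⟨y, hy⟩
    refine (integrable_norm_sq_Lp y).congr ?_
    filter_upwards [hy] with ξ hξ
    rw [hξ, norm_freqWeight_mul_sq hκ]

lemma sobolevNorm_le_sobolevNorm {G : Geometry} {σ κ κ' : ℝ} {φ : ℝ → ℂ}
    (hφ : Integrable (fun ξ => (|ξ| + κ') ^ (2 * σ) * ‖φ ξ‖ ^ 2) (freqMeasure G))
    (hκ : 1 ≤ κ)
    (h : ∀ ξ : ℝ, (|ξ| + κ) ^ (2 * σ) ≤ (|ξ| + κ') ^ (2 * σ)) :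
    sobolevNorm G σ κ φ ≤ sobolevNorm G σ κ' φ := by
  refine Real.sqrt_le_sqrt (integral_mono_of_nonneg (Eventually.of_forall fun ξ => ?_) hφ
    (Eventually.of_forall fun ξ => ?_))
  · positivity
  · exact mul_le_mul_of_nonneg_right (h ξ) (by positivity)

/-! ### The potential on the Fourier side -/

/-- q̂ is determined only almost everywhere, while symmetry of the kernel is used at every pair of
frequencies. Averaging with the reflected conjugate gives a representative that is Hermitian
everywhere. -/
lemma exists_hermitian_representative {G : Geometry} {q : 𝓢'(ℝ, ℂ)}
    (h : ∃ φ, HasFourierTransform G q φ) (hq : IsRealValued q) :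
    ∃ Q : ℝ → ℂ, StronglyMeasurable Q ∧ (∀ ξ, Q (-ξ) = (starRingEnd ℂ) (Q ξ)) ∧
      Q =ᵐ[freqMeasure G] distHat G q := by
  have hm := (hasFourierTransform_distHat h).1
  have hneg := (measurePreserving_neg_freq G).quasiMeasurePreserving
  refine ⟨fun ξ => (hm.mk _ ξ + (starRingEnd ℂ) (hm.mk _ (-ξ))) / 2, ?_, fun ξ => ?_, ?_⟩
  · have h2 := Complex.continuous_conj.comp_stronglyMeasurable
      (hm.stronglyMeasurable_mk.comp_measurable measurable_neg)
    exact (hm.stronglyMeasurable_mk.add h2).div stronglyMeasurable_const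
  · simp only [neg_neg, map_div₀, map_add, Complex.conj_conj, map_ofNat]
    rw [add_comm]
  · filter_upwards [hm.ae_eq_mk, hneg.ae hm.ae_eq_mk, distHat_neg h hq] with ξ h1 h2 h3
    rw [← h1, ← h2, ← h3]
    ring

lemma sobolevNorm_nonneg (G : Geometry) (σ κ : ℝ) (φ : ℝ → ℂ) : 0 ≤ sobolevNorm G σ κ φ :=
  Real.sqrt_nonneg _

lemma lintegral_weight_eq_sobolevNorm {G : Geometry} {σ κ : ℝ} (hκ : 1 ≤ κ) {φ Q : ℝ → ℂ}
    (hφ : WeightedL2 G σ φ) (hQ : Q =ᵐ[freqMeasure G] φ) :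
    ∫⁻ ζ, ENNReal.ofReal ((|ζ| + κ) ^ (2 * σ)) * ‖Q ζ‖ₑ ^ 2 ∂(freqMeasure G) =
      ENNReal.ofReal (sobolevNorm G σ κ φ) ^ 2 := by
  have hi := (integrable_weight_iff hκ hφ.1).2 hφ.2
  rw [← ENNReal.ofReal_pow (sobolevNorm_nonneg _ _ _ _), sobolevNorm, Real.sq_sqrt
    (integral_nonneg fun ξ => by positivity), ofReal_integral_eq_lintegral_ofReal hi
    (Eventually.of_forall fun ξ => by positivity)]
  refine lintegral_congr_ae ?_
  filter_upwards [hQ] with ξ hξ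
  rw [ENNReal.ofReal_mul (by positivity), ENNReal.ofReal_pow (norm_nonneg _), ofReal_norm, hξ]

/-- The Fourier transform of `q f` at nonnegative frequencies. -/
def convHat (G : Geometry) (Q φ : ℝ → ℂ) (ξ : ℝ) : ℂ :=
  ∫ η, (fourierConst G : ℂ) * (Q (ξ - η) * φ η) ∂(halfMeasure G)

/-- For all choices of weights the operator produces the same convolution q̂ ∗ f̂, merely
reweighted. This is what relates the different kernels to one another. -/
lemma op_weightedKernel {G : Geometry} {κ α β C : ℝ} {Q φ : ℝ → ℂ}
    (h : HSKernel (halfMeasure G) (weightedKernel G κ α β Q) C) {y : Lp ℂ 2 (halfMeasure G)}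
    (hy : φ =ᵐ[halfMeasure G] fun η => freqWeight κ (-β) η * y η) :
    h.op y =ᵐ[halfMeasure G] fun ξ => freqWeight κ (-α) ξ * convHat G Q φ ξ := by
  filter_upwards [h.op_coeFn y] with ξ hξ
  rw [hξ, kernelFun, convHat, ← integral_const_mul]
  refine integral_congr_ae ?_
  filter_upwards [hy] with η hη
  rw [hη]
  simp only [weightedKernel, freqWeight]
  ring

lemma weightedKernel_symm (G : Geometry) (κ α : ℝ) {Q : ℝ → ℂ}
    (hQ : ∀ ξ, Q (-ξ) = (starRingEnd ℂ) (Q ξ)) (x y : ℝ) :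
    weightedKernel G κ α α Q (y, x) = (starRingEnd ℂ) (weightedKernel G κ α α Q (x, y)) := by
  simp only [weightedKernel, map_mul, Complex.conj_ofReal, ← hQ, neg_sub]
  ring

/-! ### The form factors on the Hardy space -/

section Factors

variable {G : Geometry} {κ : ℝ}

lemma neg_half_nonpos : (-(1 / 2) : ℝ) ≤ 0 := by norm_num

/-- The factors `B = (𝓛₀ + κ)^{-1/2}` and `J = 1 - S`. -/
def weightFactors (hκ : 1 ≤ κ) (S : Lp ℂ 2 (halfMeasure G) →L[ℂ] Lp ℂ 2 (halfMeasure G))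
    (hS : IsSelfAdjoint S) (hn : ∀ y, ‖S y‖ ≤ 1 / 2 * ‖y‖) : FormFactors (L2Plus G) :=
  FormFactors.ofPerturbation (pullOp (hardyIso G) (weightOp G hκ neg_half_nonpos))
    (pullOp (hardyIso G) S)
    (isSelfAdjoint_pullOp (isSelfAdjoint_mulOp (conj_freqWeight κ _)))
    (injective_pullOp (injective_mulOp (freqWeight_ne_zero hκ _)))
    (isSelfAdjoint_pullOp hS) (norm_pullOp_le (by norm_num) hn)

variable {hκ : 1 ≤ κ} {S : Lp ℂ 2 (halfMeasure G) →L[ℂ] Lp ℂ 2 (halfMeasure G)}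
  {hS : IsSelfAdjoint S} {hn : ∀ y, ‖S y‖ ≤ 1 / 2 * ‖y‖}

lemma hardyIso_B (y : L2Plus G) : hardyIso G ((weightFactors hκ S hS hn).B y) =
    weightOp G hκ neg_half_nonpos (hardyIso G y) := apply_pullOp _ _ _

lemma hardyIso_J (y : L2Plus G) : hardyIso G ((weightFactors hκ S hS hn).J y) =
    hardyIso G y - S (hardyIso G y) := by
  change hardyIso G (y - pullOp (hardyIso G) S y) = _
  rw [map_sub, apply_pullOp]

lemma hardyHat_B (y : L2Plus G) : hardyHat ((weightFactors hκ S hS hn).B y) =ᵐ[halfMeasure G]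
    fun ξ => freqWeight κ (-(1 / 2)) ξ * hardyIso G y ξ := by
  refine (hardyIso_coeFn _).symm.trans ?_
  rw [hardyIso_B]
  exact weightOp_coeFn _ _ _

lemma aestronglyMeasurable_hardyHat (f : L2Plus G) :
    AEStronglyMeasurable (hardyHat f) (freqMeasure G) := (memLp_fourierL2 G f).1

lemma mul_hardyHat_B (y : L2Plus G) : hardyIso G y =ᵐ[halfMeasure G]
    fun ξ => freqWeight κ (1 / 2) ξ * hardyHat ((weightFactors hκ S hS hn).B y) ξ := by
  filter_upwards [hardyHat_B (hκ := hκ) (hS := hS) (hn := hn) y] with ξ hξ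
  rw [hξ, ← mul_assoc, freqWeight_mul_neg hκ, one_mul]

lemma eq_B_of_hardyHat {f y : L2Plus G}
    (h : hardyIso G y =ᵐ[halfMeasure G] fun ξ => freqWeight κ (1 / 2) ξ * hardyHat f ξ) :
    f = (weightFactors hκ S hS hn).B y := by
  refine (hardyIso G).injective (Lp.ext ?_)
  filter_upwards [hardyIso_coeFn f, hardyIso_coeFn ((weightFactors hκ S hS hn).B y),
    hardyHat_B (hκ := hκ) (hS := hS) (hn := hn) y, h] with ξ h1 h2 h3 h4
  rw [h1, h2, h3, h4, ← mul_assoc, freqWeight_mul hκ, neg_add_cancel, freqWeight_zero, one_mul]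

lemma mem_HPlus_half_iff (f : L2Plus G) :
    f ∈ HPlus G (1 / 2) ↔ ∃ y, f = (weightFactors hκ S hS hn).B y := by
  change WeightedL2 G (1 / 2) (hardyHat f) ↔ _
  rw [weightedL2_iff hκ (aestronglyMeasurable_hardyHat f) (hardyHat_eq_zero f)]
  constructor
  · rintro ⟨y, hy⟩
    refine ⟨(hardyIso G).symm y, eq_B_of_hardyHat ?_⟩
    rwa [LinearIsometryEquiv.apply_symm_apply]
  · rintro ⟨y, rfl⟩
    exact ⟨_, mul_hardyHat_B y⟩

lemma integrable_freeForm {f : L2Plus G} (hf : f ∈ HPlus G (1 / 2)) :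
    Integrable (fun ξ => ξ * ‖hardyHat f ξ‖ ^ 2) (freqMeasure G) := by
  refine hf.2.mono' (aestronglyMeasurable_id.mul (hf.1.norm.pow 2))
    (Eventually.of_forall fun ξ => ?_)
  rw [norm_mul, Real.norm_eq_abs, Real.norm_of_nonneg (by positivity)]
  refine mul_le_mul_of_nonneg_right ?_ (by positivity)
  norm_num

/-- On nonnegative frequencies ξ = (|ξ|+κ) − κ, and the first term undoes the weight in B. -/
lemma freeForm_B (y : L2Plus G) : ((freeForm ((weightFactors hκ S hS hn).B y) : ℝ) : ℂ) =
    ⟪y, y⟫_ℂ - κ * ⟪(weightFactors hκ S hS hn).B y, (weightFactors hκ S hS hn).B y⟫_ℂ := by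
  set f := (weightFactors hκ S hS hn).B y with hf
  have h0 : ∀ᵐ ξ ∂(freqMeasure G), ξ ∉ Ici (0 : ℝ) → ξ * ‖hardyHat f ξ‖ ^ 2 = 0 := by
    filter_upwards [hardyHat_eq_zero f] with ξ hξ h
    rw [hξ (not_le.1 h)]
    simp
  have h1 : freeForm f = ‖y‖ ^ 2 - κ * ‖f‖ ^ 2 := by
    rw [freeForm, ← setIntegral_eq_integral_of_ae_compl_eq_zero h0, ← (hardyIso G).norm_map y,
      ← (hardyIso G).norm_map f, ← norm_sq_Lp, ← norm_sq_Lp, ← integral_const_mul,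
      ← integral_sub (integrable_norm_sq_Lp _) ((integrable_norm_sq_Lp _).const_mul κ)]
    refine integral_congr_ae ?_
    filter_upwards [ae_half_nonneg G, hardyIso_coeFn f,
      mul_hardyHat_B (hκ := hκ) (hS := hS) (hn := hn) y] with ξ hξ h2 h3
    rw [h2, h3, norm_freqWeight_mul_sq hκ, abs_of_nonneg hξ]
    norm_num
    ring
  have h2 : ⟪y, y⟫_ℂ = (‖y‖ : ℂ) ^ 2 := inner_self_eq_norm_sq_to_K y
  have h3 : ⟪f, f⟫_ℂ = (‖f‖ : ℂ) ^ 2 := inner_self_eq_norm_sq_to_K f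
  rw [h1, h2, h3]
  push_cast
  rfl

lemma pairing_B {y : L2Plus G} {b : Lp ℂ 2 (halfMeasure G)} {φ : ℝ → ℂ}
    (hb : b =ᵐ[halfMeasure G] fun ξ => freqWeight κ (-(1 / 2)) ξ * φ ξ) :
    pairing G (hardyHat ((weightFactors hκ S hS hn).B y)) φ = ⟪y, (hardyIso G).symm b⟫_ℂ := by
  rw [pairing, ← integral_half_eq, ← (hardyIso G).inner_map_map,
    LinearIsometryEquiv.apply_symm_apply, L2.inner_def]
  · refine integral_congr_ae ?_
    filter_upwards [hb, hardyHat_B (hκ := hκ) (hS := hS) (hn := hn) y] with ξ h1 h2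
    rw [h1, h2, RCLike.inner_apply, map_mul, conj_freqWeight]
    ring
  · filter_upwards [hardyHat_eq_zero ((weightFactors hκ S hS hn).B y)] with ξ hξ h
    rw [hξ h]
    simp

lemma pairing_conj (φ ψ : ℝ → ℂ) : pairing G φ ψ = (starRingEnd ℂ) (pairing G ψ φ) := by
  rw [pairing, pairing, ← integral_conj]
  refine integral_congr_ae (Eventually.of_forall fun ξ => ?_)
  simp only [map_mul, Complex.conj_conj]
  ring

lemma pairing_B' {y : L2Plus G} {b : Lp ℂ 2 (halfMeasure G)} {φ : ℝ → ℂ}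
    (hb : b =ᵐ[halfMeasure G] fun ξ => freqWeight κ (-(1 / 2)) ξ * φ ξ) :
    pairing G φ (hardyHat ((weightFactors hκ S hS hn).B y)) = ⟪(hardyIso G).symm b, y⟫_ℂ := by
  rw [pairing_conj, pairing_B hb]
  exact inner_conj_symm (𝕜 := ℂ) ((hardyIso G).symm b) y

/-- The datum in H^{-1/2}_+ enters only through b, its image under the weight −1/2; the
distributional equation then becomes an equation in L²_+ for the pencil. -/
lemma shiftedApplyEq_iff {T : 𝓢'(ℝ, ℂ)} {b : Lp ℂ 2 (halfMeasure G)}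
    (hb : b =ᵐ[halfMeasure G] fun ξ => freqWeight κ (-(1 / 2)) ξ * distHat G T ξ)
    {z : ℂ} {u : L2Plus G} :
    ShiftedApplyEq ((weightFactors hκ S hS hn).op κ) z u T ↔
      (1 - (-z + κ) • (weightFactors hκ S hS hn).T) u =
        (weightFactors hκ S hS hn).B ((weightFactors hκ S hS hn).invJ ((hardyIso G).symm b)) := by
  set D := weightFactors hκ S hS hn with hD
  rw [← D.weak_equation_iff]
  constructor
  · intro h x
    have h1 := h ⟨D.T x, mem_domain_shiftedInverse x⟩
    have h2 := pairing_B (hκ := hκ) (hS := hS) (hn := hn) (y := D.invJ (D.B x)) hb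
    have h3 : D.op κ ⟨D.T x, mem_domain_shiftedInverse x⟩ = x - (κ : ℂ) • D.T x :=
      shiftedInverse_apply x _
    rw [h3] at h1
    exact h1.trans h2
  · intro h g
    obtain ⟨x, hx, hLx⟩ := exists_eq_of_domain_shiftedInverse g
    have h2 := pairing_B (hκ := hκ) (hS := hS) (hn := hn) (y := D.invJ (D.B x)) hb
    have h3 : D.op κ g = x - (κ : ℂ) • D.T x := hLx
    rw [h3, hx, h x, ← h2, D.T_apply]

/-- At z = κ the pencil is the identity, so the weak equation is already solved: u = B J⁻¹ b. -/
lemma isResolventOf_shift_iff {f : 𝓢'(ℝ, ℂ)} {b : Lp ℂ 2 (halfMeasure G)}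
    (hb : b =ᵐ[halfMeasure G] fun ξ => freqWeight κ (-(1 / 2)) ξ * distHat G f ξ) {u : L2Plus G} :
    IsResolventOf ((weightFactors hκ S hS hn).op κ) κ f u ↔
      u = (weightFactors hκ S hS hn).B
        ((weightFactors hκ S hS hn).invJ ((hardyIso G).symm b)) := by
  rw [IsResolventOf, shiftedApplyEq_iff hb, neg_add_cancel, zero_smul, sub_zero, one_apply_eq_self]
  exact ⟨And.right, fun h => ⟨(mem_HPlus_half_iff (hκ := hκ) (hS := hS) (hn := hn) u).2 ⟨_, h⟩, h⟩⟩

lemma neg_mem_resolventSet : (-κ : ℂ) ∈ resolventSet ((weightFactors hκ S hS hn).op κ) := by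
  rw [FormFactors.op, mem_resolventSet_shiftedInverse, neg_add_cancel, zero_smul, sub_zero]
  exact isUnit_one

lemma hardyIso_invJ {b v : Lp ℂ 2 (halfMeasure G)} (h : v - S v = b) :
    (weightFactors hκ S hS hn).invJ ((hardyIso G).symm b) = (hardyIso G).symm v := by
  have h1 : (weightFactors hκ S hS hn).J ((hardyIso G).symm v) = (hardyIso G).symm b := by
    refine (hardyIso G).injective ?_
    rw [hardyIso_J, LinearIsometryEquiv.apply_symm_apply, LinearIsometryEquiv.apply_symm_apply, h]
  rw [← h1, FormFactors.invJ_J_apply]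

end Factors

section Lax

variable {G : Geometry} {κ : ℝ}

/-! ### The free operator -/

/-- The factors of `𝓛₀ + κ`. -/
def freeFactors (G : Geometry) (hκ : 1 ≤ κ) : FormFactors (L2Plus G) :=
  weightFactors hκ 0 (IsSelfAdjoint.zero _) (fun y => by
    rw [zero_apply, norm_zero]; positivity)

lemma freeFactors_invJ (hκ : 1 ≤ κ) (x : L2Plus G) : (freeFactors G hκ).invJ x = x := by
  have h := hardyIso_invJ (hκ := hκ) (S := 0) (hS := IsSelfAdjoint.zero _) (hn := fun y => by
    rw [zero_apply, norm_zero]; positivity) (b := hardyIso G x) (v := hardyIso G x)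
    (by rw [zero_apply, sub_zero])
  rwa [LinearIsometryEquiv.symm_apply_apply] at h

lemma hardyHat_freeFactors_T (hκ : 1 ≤ κ) (x : L2Plus G) :
    hardyHat ((freeFactors G hκ).T x) =ᵐ[halfMeasure G]
      fun ξ => freqWeight κ (-1) ξ * hardyHat x ξ := by
  rw [FormFactors.T_apply, freeFactors_invJ]
  filter_upwards [hardyHat_B (hκ := hκ) (S := 0) (hS := IsSelfAdjoint.zero _) (hn := fun y => by
    rw [zero_apply, norm_zero]; positivity) ((freeFactors G hκ).B x),
    hardyIso_coeFn ((freeFactors G hκ).B x),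
    hardyHat_B (hκ := hκ) (S := 0) (hS := IsSelfAdjoint.zero _) (hn := fun y => by
    rw [zero_apply, norm_zero]; positivity) x, hardyIso_coeFn x] with ξ h1 h2 h3 h4
  refine h1.trans ?_
  rw [h2]
  refine (congrArg _ h3).trans ?_
  rw [h4, ← mul_assoc, freqWeight_mul hκ]
  norm_num

lemma eq_of_hardyHat {f g : L2Plus G} (h : hardyHat f =ᵐ[halfMeasure G] hardyHat g) : f = g :=
  (hardyIso G).injective (Lp.ext ((hardyIso_coeFn f).trans (h.trans (hardyIso_coeFn g).symm)))

/-- The case S = 0 for any κ ≥ 1, in which T is multiplication by (ξ+κ)⁻¹. It allows comparison with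
𝓛 at a common shift. -/
lemma freeOp_eq (hκ : 1 ≤ κ) : freeOp G = (freeFactors G hκ).op κ := by
  refine LinearPMap.eq_of_eq_graph ?_
  rw [freeOp_graph]
  ext ⟨f, g⟩
  have hmem : (f, g) ∈ freeGraph G ↔
      ∀ᵐ ξ ∂(halfMeasure G), hardyHat g ξ = ξ * hardyHat f ξ := by
    refine ⟨fun h => ae_half h, fun h => ?_⟩
    change ∀ᵐ ξ ∂(freqMeasure G), hardyHat g ξ = ξ * hardyHat f ξ
    filter_upwards [ae_half_iff.1 h, hardyHat_eq_zero f, hardyHat_eq_zero g] with ξ h1 h2 h3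
    rcases le_or_gt 0 ξ with h0 | h0
    · exact h1 h0
    · rw [h2 h0, h3 h0, mul_zero]
  rw [hmem, LinearPMap.mem_graph_iff]
  constructor
  · intro h
    have hT : (freeFactors G hκ).T (g + (κ : ℂ) • f) = f := by
      refine eq_of_hardyHat ?_
      filter_upwards [hardyHat_freeFactors_T hκ (g + (κ : ℂ) • f), h,
        ae_half (hardyHat_add g ((κ : ℂ) • f)), ae_half (hardyHat_smul (κ : ℂ) f),
        ae_half_nonneg G] with ξ h1 h2 h3 h4 h5
      rw [h1, h3, h4, h2, ← add_mul, ← freqWeight_one h5, ← mul_assoc, freqWeight_mul hκ,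
        neg_add_cancel, freqWeight_zero, one_mul]
    refine ⟨⟨f, hT ▸ mem_domain_shiftedInverse _⟩, rfl, ?_⟩
    obtain ⟨x, hx, hLx⟩ := exists_eq_of_domain_shiftedInverse
      (T := (freeFactors G hκ).T) (hT := (freeFactors G hκ).injective_T) (κ := κ)
      ⟨f, hT ▸ mem_domain_shiftedInverse _⟩
    refine hLx.trans ?_
    have hx' : x = g + (κ : ℂ) • f := (freeFactors G hκ).injective_T (hx.symm.trans hT.symm)
    rw [← hx, hx', add_sub_cancel_right]
  · rintro ⟨y, hy, hLy⟩
    obtain ⟨x, hx, hLx⟩ := exists_eq_of_domain_shiftedInverse y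
    have h1 : f = (freeFactors G hκ).T x := hy.symm.trans hx
    have h2 : x = g + (κ : ℂ) • f := by
      rw [h1]
      exact sub_eq_iff_eq_add.1 (hLx.symm.trans hLy)
    filter_upwards [hardyHat_freeFactors_T hκ x, ae_half (hardyHat_add g ((κ : ℂ) • f)),
      ae_half (hardyHat_smul (κ : ℂ) f), ae_half_nonneg G] with ξ h3 h4 h5 h6
    rw [← h1, h2, h4, h5] at h3
    have h7 := congrArg (freqWeight κ 1 ξ * ·) h3
    simp only [← mul_assoc] at h7
    rw [freqWeight_mul_neg hκ, one_mul, freqWeight_one h6] at h7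
    linear_combination -h7

/-! ### The Lax operator -/

variable {Q : ℝ → ℂ} {C : ℝ}

/-- The factors of `𝓛 + κ`. -/
def laxFactors (hκ : 1 ≤ κ) (hQ : ∀ ξ, Q (-ξ) = (starRingEnd ℂ) (Q ξ))
    (h : HSKernel (halfMeasure G) (weightedKernel G κ (1 / 2) (1 / 2) Q) C) (hC : C ≤ 1 / 2) :
    FormFactors (L2Plus G) :=
  weightFactors hκ h.op (h.isSelfAdjoint_op (weightedKernel_symm G κ _ hQ))
    (fun y => (h.norm_op_apply_le y).trans (mul_le_mul_of_nonneg_right hC (norm_nonneg _)))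

variable (hκ : 1 ≤ κ) (hQ : ∀ ξ, Q (-ξ) = (starRingEnd ℂ) (Q ξ))
  (h : HSKernel (halfMeasure G) (weightedKernel G κ (1 / 2) (1 / 2) Q) C) (hC : C ≤ 1 / 2)

include h in
lemma integrable_potentialForm_B {q : 𝓢'(ℝ, ℂ)} (hq : Q =ᵐ[freqMeasure G] distHat G q)
    (y : L2Plus G) :
    Integrable (fun ξ => distHat G q (-ξ) * sqHat ((laxFactors hκ hQ h hC).B y) ξ)
      (freqMeasure G) ∧
    potentialForm G q ((laxFactors hκ hQ h hC).B y) =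
      ⟪hardyIso G y, h.op (hardyIso G y)⟫_ℂ := by
  have h1 := integrable_potential h ((laxFactors hκ hQ h hC).B y) (hardyIso G y) (hardyHat_B y)
  have h2 : (fun ξ => Q (-ξ) * sqHat ((laxFactors hκ hQ h hC).B y) ξ) =ᵐ[freqMeasure G]
      fun ξ => distHat G q (-ξ) * sqHat ((laxFactors hκ hQ h hC).B y) ξ := by
    filter_upwards [(measurePreserving_neg_freq G).quasiMeasurePreserving.ae hq] with ξ hξ
    rw [hξ]
  exact ⟨h1.1.congr h2, (integral_congr_ae h2).symm.trans h1.2⟩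

lemma hasQuadraticForm_lax {q : 𝓢'(ℝ, ℂ)} (hq : Q =ᵐ[freqMeasure G] distHat G q) :
    HasQuadraticForm ((laxFactors hκ hQ h hC).op κ) (HPlus G (1 / 2)) (laxForm G q) := by
  refine FormFactors.hasQuadraticForm_op _ mem_HPlus_half_iff fun y => ?_
  have h1 : ⟪y, (laxFactors hκ hQ h hC).J y⟫_ℂ =
      ⟪y, y⟫_ℂ - ⟪hardyIso G y, h.op (hardyIso G y)⟫_ℂ := by
    have h2 := hardyIso_J (hκ := hκ) (S := h.op) (hS := h.isSelfAdjoint_op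
      (weightedKernel_symm G κ _ hQ)) (hn := fun y => (h.norm_op_apply_le y).trans
      (mul_le_mul_of_nonneg_right hC (norm_nonneg _))) y
    have h3 := (hardyIso G).inner_map_map y ((laxFactors hκ hQ h hC).J y)
    rw [← h3, ← (hardyIso G).inner_map_map y y, ← inner_sub_right]
    exact congrArg _ h2
  rw [h1, laxForm, (integrable_potentialForm_B hκ hQ h hC hq y).2]
  have h4 : ((freeForm ((laxFactors hκ hQ h hC).B y) : ℝ) : ℂ) = ⟪y, y⟫_ℂ -
      κ * ⟪(laxFactors hκ hQ h hC).B y, (laxFactors hκ hQ h hC).B y⟫_ℂ := freeForm_B y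
  rw [h4]
  ring

/-- From J = 1 − S one gets J⁻¹ − 1 = J⁻¹S, so the two operators T differ by B J⁻¹ S B, which is
compact because S is Hilbert–Schmidt. -/
lemma essSpec_lax :
    essSpec ((laxFactors hκ hQ h hC).op κ) = essSpec (freeOp G) := by
  rw [freeOp_eq hκ]
  refine essSpec_shiftedInverse_eq (FormFactors.isSelfAdjoint_T _) (FormFactors.isSelfAdjoint_T _) ?_
  set D := laxFactors hκ hQ h hC with hD
  have hT : D.T - (freeFactors G hκ).T = (D.B * D.invJ) * pullOp (hardyIso G) h.op * D.B := by
    ext1 x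
    have h1 : (freeFactors G hκ).T x = D.B (D.B x) := by
      rw [FormFactors.T_apply, freeFactors_invJ]; rfl
    have h2 : ∀ w, D.invJ (pullOp (hardyIso G) h.op w) = D.invJ w - w := by
      intro w
      have h3 : D.J w = w - pullOp (hardyIso G) h.op w := rfl
      have h4 := D.invJ_J_apply w
      rw [h3, map_sub] at h4
      rw [sub_eq_iff_eq_add.1 h4, add_sub_cancel_left]
    rw [sub_apply, h1, D.T_apply, mul_apply_eq_comp, mul_apply_eq_comp, mul_apply_eq_comp, h2,
      map_sub]
  rw [hT]
  exact ((isCompactOperator_pullOp h.isCompactOperator_op).clm_comp (D.B * D.invJ)).comp_clm D.B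

/-! ### Regularity of the resolvent -/

lemma exists_weighted_half {s : ℝ} (hs : -(1 / 2) < s) (hκ : 1 ≤ κ) {φ : ℝ → ℂ}
    {b : Lp ℂ 2 (halfMeasure G)}
    (hb : b =ᵐ[halfMeasure G] fun ξ => freqWeight κ s ξ * φ ξ) :
    weightOp G hκ (by linarith : -(1 / 2) - s ≤ 0) b =ᵐ[halfMeasure G]
      fun ξ => freqWeight κ (-(1 / 2)) ξ * φ ξ := by
  filter_upwards [weightOp_coeFn hκ (by linarith : -(1 / 2) - s ≤ 0) b, hb] with ξ h1 h2
  rw [h1, h2, ← mul_assoc, freqWeight_mul hκ]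
  congr 2
  ring

/-- With W the weight −1/2 − s this reads S W = W A, where A carries the weights −s and s+1. Both
sides are the weight −1/2 times one and the same convolution. -/
lemma weightedKernel_intertwine {s C' : ℝ} (hs : -(1 / 2) < s)
    (hA : HSKernel (halfMeasure G) (weightedKernel G κ (-s) (s + 1) Q) C')
    (v : Lp ℂ 2 (halfMeasure G)) :
    h.op (weightOp G hκ (by linarith : -(1 / 2) - s ≤ 0) v) =
      weightOp G hκ (by linarith : -(1 / 2) - s ≤ 0) (hA.op v) := by
  have h1 := weightOp_coeFn hκ (by linarith : -(1 / 2) - s ≤ 0) v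
  have h2 := op_weightedKernel (φ := fun ξ => freqWeight κ (-(s + 1)) ξ * v ξ) hA (y := v)
    (EventuallyEq.refl _ _)
  have h3 := op_weightedKernel (φ := fun ξ => freqWeight κ (-(s + 1)) ξ * v ξ) h
    (y := weightOp G hκ (by linarith : -(1 / 2) - s ≤ 0) v) (by
      filter_upwards [h1] with ξ hξ
      rw [hξ, ← mul_assoc, freqWeight_mul hκ]
      congr 2
      ring)
  refine Lp.ext ?_
  filter_upwards [h2, h3, weightOp_coeFn hκ (by linarith : -(1 / 2) - s ≤ 0) (hA.op v)]
    with ξ e2 e3 e4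
  rw [e3, e4, e2, ← mul_assoc, freqWeight_mul hκ]
  congr 2
  ring

variable {S : Lp ℂ 2 (halfMeasure G) →L[ℂ] Lp ℂ 2 (halfMeasure G)}
  {hS : IsSelfAdjoint S} {hn : ∀ y, ‖S y‖ ≤ 1 / 2 * ‖y‖}

/-- The weights of B and W add up to −(s+1), so v is the L² representative of u in H^{s+1}_κ. -/
lemma mem_HPlus_B_weightOp {s : ℝ} (hs : -(1 / 2) < s) (v : Lp ℂ 2 (halfMeasure G))
    {u : L2Plus G} (hu : u = (weightFactors hκ S hS hn).B
      ((hardyIso G).symm (weightOp G hκ (by linarith : -(1 / 2) - s ≤ 0) v))) :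
    u ∈ HPlus G (s + 1) ∧ sobolevNorm G (s + 1) κ (hardyHat u) = ‖v‖ := by
  have h1 : v =ᵐ[halfMeasure G] fun ξ => freqWeight κ (s + 1) ξ * hardyHat u ξ := by
    filter_upwards [hardyHat_B (hκ := hκ) (hS := hS) (hn := hn)
      ((hardyIso G).symm (weightOp G hκ (by linarith : -(1 / 2) - s ≤ 0) v)),
      weightOp_coeFn hκ (by linarith : -(1 / 2) - s ≤ 0) v] with ξ h1 h2
    rw [hu, h1, LinearIsometryEquiv.apply_symm_apply, h2, ← mul_assoc, ← mul_assoc,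
      freqWeight_mul hκ, freqWeight_mul hκ]
    have : s + 1 + -(1 / 2) + (-(1 / 2) - s) = 0 := by ring
    rw [this, freqWeight_zero, one_mul]
  exact ⟨(weightedL2_iff hκ (aestronglyMeasurable_hardyHat u) (hardyHat_eq_zero u)).2 ⟨v, h1⟩,
    sobolevNorm_eq hκ (hardyHat_eq_zero u) h1⟩

/-- Solving (1 − A)v = b in L² and applying W gives (1 − S)W v = W b, so B W v is the resolvent
applied to f while ‖v‖ is its H^{s+1}_κ norm. The bound ‖A‖ ≤ 1/2 gives ‖v‖ ≤ 2‖b‖. The free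
solution corresponds to b, and v − b = A v is small by the Hilbert–Schmidt bound. -/
lemma exists_resolvent_bound {s C' : ℝ} (hs : -(1 / 2) < s)
    (hA : HSKernel (halfMeasure G) (weightedKernel G κ (-s) (s + 1) Q) C') (hC' : C' ≤ 1 / 2)
    {f : 𝓢'(ℝ, ℂ)} (hf : MemHPlus G s f) :
    ∃ u u₀, IsResolventOf ((laxFactors hκ hQ h hC).op κ) κ f u ∧
      IsResolventOf (freeOp G) κ f u₀ ∧ u ∈ HPlus G (s + 1) ∧ u₀ ∈ HPlus G (s + 1) ∧
      sobolevNorm G (s + 1) κ (hardyHat u) ≤ 2 * sobolevNorm G s κ (distHat G f) ∧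
      sobolevNorm G (s + 1) κ (hardyHat (u - u₀)) ≤
        2 * C' * sobolevNorm G s κ (distHat G f) := by
  obtain ⟨b, hb⟩ := (weightedL2_iff hκ hf.1.2.1 hf.2).1 hf.1.2
  have hbn := sobolevNorm_eq hκ hf.2 hb
  have hα : -(1 / 2) - s ≤ 0 := by linarith
  have hAn : ‖hA.op‖ ≤ 1 / 2 := ContinuousLinearMap.opNorm_le_bound _ (by norm_num) fun y =>
    (hA.norm_op_apply_le y).trans (mul_le_mul_of_nonneg_right hC' (norm_nonneg _))
  have hunit : IsUnit (1 - hA.op) := isUnit_one_sub_of_norm_lt_one (by linarith)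
  obtain ⟨v, hv⟩ : ∃ v, v - hA.op v = b :=
    ⟨Ring.inverse (1 - hA.op) b, by
      have := Ring.mul_inverse_cancel _ hunit
      have h2 := congrArg (fun A : Lp ℂ 2 (halfMeasure G) →L[ℂ] Lp ℂ 2 (halfMeasure G) => A b) this
      exact h2⟩
  have hvn : ‖v‖ ≤ 2 * ‖b‖ := by
    have h1 : ‖v‖ ≤ ‖b‖ + ‖hA.op v‖ := by
      rw [← hv]
      simpa using norm_add_le (v - hA.op v) (hA.op v)
    have h2 := hA.op.le_of_opNorm_le hAn v
    linarith
  have hb' := exists_weighted_half hs hκ hb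
  have hvb : weightOp G hκ hα v - h.op (weightOp G hκ hα v) = weightOp G hκ hα b := by
    rw [weightedKernel_intertwine hκ h hs hA, ← map_sub, hv]
  have hdiff : v - b = hA.op v := by rw [← hv, sub_sub_cancel]
  have hu := mem_HPlus_B_weightOp hκ hs v (S := h.op) (hS := h.isSelfAdjoint_op
    (weightedKernel_symm G κ _ hQ)) (hn := fun y => (h.norm_op_apply_le y).trans
    (mul_le_mul_of_nonneg_right hC (norm_nonneg _))) rfl
  have hu₀ := mem_HPlus_B_weightOp hκ hs b (S := h.op) (hS := h.isSelfAdjoint_op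
    (weightedKernel_symm G κ _ hQ)) (hn := fun y => (h.norm_op_apply_le y).trans
    (mul_le_mul_of_nonneg_right hC (norm_nonneg _))) rfl
  have hd := mem_HPlus_B_weightOp hκ hs (v - b) (S := h.op) (hS := h.isSelfAdjoint_op
    (weightedKernel_symm G κ _ hQ)) (hn := fun y => (h.norm_op_apply_le y).trans
    (mul_le_mul_of_nonneg_right hC (norm_nonneg _))) rfl
  refine ⟨_, _, ?_, ?_, hu.1, hu₀.1, ?_, ?_⟩
  · refine (isResolventOf_shift_iff hb').2 ?_
    rw [hardyIso_invJ hvb]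
  · rw [freeOp_eq hκ]
    refine (isResolventOf_shift_iff hb').2 ?_
    exact congrArg _ (freeFactors_invJ hκ _).symm
  · rw [hu.2, hbn]
    exact hvn
  · rw [← map_sub, ← map_sub, ← map_sub, hd.2, hdiff, hbn]
    refine (hA.norm_op_apply_le v).trans ?_
    have := mul_le_mul_of_nonneg_left hvn hA.nonneg
    linarith

/-! ### The action on Sobolev spaces -/

lemma norm_weightOp_apply_le {α : ℝ} (hα : α ≤ 0) (y : Lp ℂ 2 (halfMeasure G)) :
    ‖weightOp G hκ hα y‖ ≤ ‖y‖ := by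
  refine Lp.norm_le_norm_of_ae_le ?_
  filter_upwards [weightOp_coeFn hκ hα y] with ξ hξ
  rw [hξ, norm_mul]
  exact mul_le_of_le_one_left (norm_nonneg _) (norm_freqWeight_le hκ hα ξ)

lemma exists_lax_apply {s C' : ℝ} (hs : -(1 / 2) < s)
    (hA : HSKernel (halfMeasure G) (weightedKernel G 1 (-s) (s + 1) Q) C')
    {f : L2Plus G} (hf : f ∈ HPlus G (s + 1)) :
    ∃ T : 𝓢'(ℝ, ℂ), MemHPlus G s T ∧ ShiftedApplyEq ((laxFactors hκ hQ h hC).op κ) 0 f T ∧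
      sobolevNorm G s 1 (distHat G T) ≤ (2 + C') * sobolevNorm G (s + 1) 1 (hardyHat f) := by
  have hfm := aestronglyMeasurable_hardyHat f
  have hf0 := hardyHat_eq_zero f
  obtain ⟨y, hy⟩ := (weightedL2_iff le_rfl hfm hf0).1 hf
  have hAy := op_weightedKernel (φ := hardyHat f) hA (y := y) (by
    filter_upwards [hy] with ξ hξ
    rw [hξ, ← mul_assoc, freqWeight_mul le_rfl, neg_add_cancel, freqWeight_zero, one_mul])
  -- This is (ξ+1)^s times ξ f̂ − q̂ ∗ f̂, after writing ξ = (ξ+1) − 1. The three terms account for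
  -- the constant 1 + 1 + C'.
  set g := y - weightOp G le_rfl (by norm_num : (-1 : ℝ) ≤ 0) y - hA.op y with hg
  set φ : ℝ → ℂ := (Ici (0 : ℝ)).indicator fun ξ => freqWeight 1 (-s) ξ * g ξ with hφ
  have hφm : AEStronglyMeasurable φ (freqMeasure G) :=
    (aestronglyMeasurable_indicator_iff measurableSet_Ici).2
      ((measurable_freqWeight 1 (-s)).aestronglyMeasurable.mul (Lp.aestronglyMeasurable g))
  have hφ0 : ∀ᵐ ξ ∂(freqMeasure G), ξ < 0 → φ ξ = 0 := Eventually.of_forall fun ξ hξ =>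
    indicator_of_notMem (by simpa using hξ) _
  have hφh : φ =ᵐ[halfMeasure G] fun ξ => freqWeight 1 (-s) ξ * g ξ := by
    filter_upwards [ae_half_nonneg G] with ξ hξ
    rw [hφ, indicator_of_mem (by simpa using hξ)]
  have hgφ : g =ᵐ[halfMeasure G] fun ξ => freqWeight 1 s ξ * φ ξ := by
    filter_upwards [hφh] with ξ hξ
    rw [hξ, ← mul_assoc, freqWeight_mul_neg le_rfl, one_mul]
  have hφf : φ =ᵐ[halfMeasure G] fun ξ => ξ * hardyHat f ξ - convHat G Q (hardyHat f) ξ := by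
    have hle := le_refl (1 : ℝ)
    filter_upwards [hφh, Lp.coeFn_sub (y - weightOp G le_rfl (by norm_num : (-1 : ℝ) ≤ 0) y)
      (hA.op y), Lp.coeFn_sub y (weightOp G le_rfl (by norm_num : (-1 : ℝ) ≤ 0) y),
      weightOp_coeFn le_rfl (by norm_num : (-1 : ℝ) ≤ 0) y, hy, hAy, ae_half_nonneg G]
      with ξ e1 e2 e3 e4 e5 e6 e7
    rw [e1, hg, e2, Pi.sub_apply, e3, Pi.sub_apply, e4, e5, e6, neg_neg]
    have w1 : freqWeight 1 (-s) ξ * freqWeight 1 s ξ = 1 := by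
      rw [freqWeight_mul hle, neg_add_cancel, freqWeight_zero]
    have w2 : freqWeight 1 (s + 1) ξ = freqWeight 1 s ξ * ((ξ : ℂ) + 1) := by
      rw [← freqWeight_mul hle, freqWeight_one e7, Complex.ofReal_one]
    have w3 : freqWeight 1 (-1) ξ * ((ξ : ℂ) + 1) = 1 := by
      have := freqWeight_one (κ := 1) e7
      rw [Complex.ofReal_one] at this
      rw [← this, freqWeight_mul hle, neg_add_cancel, freqWeight_zero]
    rw [w2]
    linear_combination (((ξ : ℂ) + 1) * hardyHat f ξ - hardyHat f ξ - convHat G Q (hardyHat f) ξ) *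
      w1 - freqWeight 1 (-s) ξ * freqWeight 1 s ξ * hardyHat f ξ * w3
  have hφw : WeightedL2 G s φ := (weightedL2_iff le_rfl hφm hφ0).2 ⟨g, hgφ⟩
  obtain ⟨T, hT, hTφ⟩ := exists_memHPlus (by linarith) hφw hφ0
  refine ⟨T, hT, ?_, ?_⟩
  · obtain ⟨b, hb⟩ := (weightedL2_iff hκ hT.1.2.1 hT.2).1 hT.1.2
    -- The norm bound uses the weight with parameter 1, whereas the operator was built with κ, so f
    -- is represented a second time.
    obtain ⟨yκ, hyκ⟩ := (weightedL2_iff hκ hfm hf0).1 hf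
    have hb' := exists_weighted_half hs hκ hb
    refine (shiftedApplyEq_iff hb').2 ?_
    set b' := weightOp G hκ (by linarith : -(1 / 2) - s ≤ 0) b with hb'_def
    set yf := weightOp G hκ (by linarith : -(1 / 2) - s ≤ 0) yκ with hyf_def
    have hyf : yf =ᵐ[halfMeasure G] fun ξ => freqWeight κ (1 / 2) ξ * hardyHat f ξ := by
      filter_upwards [weightOp_coeFn hκ (by linarith : -(1 / 2) - s ≤ 0) yκ, hyκ] with ξ h1 h2
      rw [h1, h2, ← mul_assoc, freqWeight_mul hκ]
      congr 2
      ring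
    set D := laxFactors hκ hQ h hC with hD
    have hfB : f = D.B ((hardyIso G).symm yf) := eq_B_of_hardyHat (by
      rwa [LinearIsometryEquiv.apply_symm_apply])
    have hSy := op_weightedKernel (φ := hardyHat f) h (y := yf) (by
      filter_upwards [hyf] with ξ hξ
      rw [hξ, ← mul_assoc, freqWeight_mul hκ, neg_add_cancel, freqWeight_zero, one_mul])
    -- This is B applied to (𝓛+κ)f = T + κf, with B T represented by `b'`.
    have hkey : D.J ((hardyIso G).symm yf) = (hardyIso G).symm b' + (κ : ℂ) • D.B f := by
      refine (hardyIso G).injective ?_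
      have e1 : hardyIso G (D.J ((hardyIso G).symm yf)) = yf - h.op yf := by
        refine (hardyIso_J _).trans ?_
        rw [LinearIsometryEquiv.apply_symm_apply]
      have e2 : hardyIso G (D.B f) = weightOp G hκ neg_half_nonpos (hardyIso G f) := hardyIso_B f
      rw [e1, map_add, map_smul, e2, LinearIsometryEquiv.apply_symm_apply]
      refine Lp.ext ?_
      filter_upwards [Lp.coeFn_sub yf (h.op yf), hyf, hSy,
        Lp.coeFn_add b' ((κ : ℂ) • weightOp G hκ neg_half_nonpos (hardyIso G f)), hb',
        Lp.coeFn_smul (κ : ℂ) (weightOp G hκ neg_half_nonpos (hardyIso G f)),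
        weightOp_coeFn hκ neg_half_nonpos (hardyIso G f), hardyIso_coeFn f, ae_half hTφ, hφf,
        ae_half_nonneg G] with ξ i1 i2 i3 i4 i5 i6 i7 i8 i9 i10 i11
      rw [i1, i4, Pi.sub_apply, Pi.add_apply, i2, i3, i5, i6, Pi.smul_apply, i7, i8, i9, i10,
        smul_eq_mul]
      have w : freqWeight κ (1 / 2) ξ = freqWeight κ (-(1 / 2)) ξ * ((ξ : ℂ) + κ) := by
        rw [← freqWeight_one i11, freqWeight_mul hκ]
        norm_num
      rw [w]
      ring
    have h5 : (hardyIso G).symm yf = D.invJ ((hardyIso G).symm b') + (κ : ℂ) • D.invJ (D.B f) := by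
      rw [← D.invJ_J_apply ((hardyIso G).symm yf), hkey, map_add, map_smul]
    change (1 - (-0 + (κ : ℂ)) • D.T) f = D.B (D.invJ ((hardyIso G).symm b'))
    rw [neg_zero, zero_add, sub_apply, one_apply_eq_self, smul_apply, D.T_apply, sub_eq_iff_eq_add,
      ← map_smul, ← map_add, ← h5, ← hfB]
  · have hTg : g =ᵐ[halfMeasure G] fun ξ => freqWeight 1 s ξ * distHat G T ξ := by
      filter_upwards [hgφ, ae_half hTφ] with ξ h1 h2
      rw [h1, h2]
    rw [sobolevNorm_eq le_rfl hT.2 hTg, sobolevNorm_eq le_rfl hf0 hy]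
    have h1 := norm_weightOp_apply_le le_rfl (by norm_num : (-1 : ℝ) ≤ 0) y
    have h2 := hA.norm_op_apply_le y
    have h3 := norm_sub_le (y - weightOp G le_rfl (by norm_num : (-1 : ℝ) ≤ 0) y) (hA.op y)
    have h4 := norm_sub_le y (weightOp G le_rfl (by norm_num : (-1 : ℝ) ≤ 0) y)
    rw [hg]
    linarith

end Lax

/-! ### Choice of the constants. -/

lemma epsOf_pos {s : ℝ} (hs : -(1 / 2) < s) (hs0 : s < 0) : 0 < epsOf s := by
  rw [epsOf, abs_of_neg hs0]
  linarith

lemma exists_threshold {C ε : ℝ} (hC : 0 < C) (hε : 0 < ε) : ∃ Cs : ℝ, 1 ≤ Cs ∧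
    ∀ N κ : ℝ, 0 ≤ N → Cs * (1 + N) ^ (1 / (2 * ε)) ≤ κ →
      1 ≤ κ ∧ C * κ ^ (-(2 * ε)) * N ≤ 1 / 2 := by
  -- The second entry gives 2C(1+N) ≤ κ^{2ε}, hence smallness of the perturbation; the first gives κ
  -- ≥ 1.
  refine ⟨max 1 ((2 * C) ^ (1 / (2 * ε))), le_max_left _ _, fun N κ hN hκ => ?_⟩
  have h1 : 1 ≤ (1 + N) ^ (1 / (2 * ε)) := Real.one_le_rpow (by linarith) (by positivity)
  have hκ1 : 1 ≤ κ := (one_le_mul_of_one_le_of_one_le (le_max_left _ _) h1).trans hκ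
  refine ⟨hκ1, ?_⟩
  have h2 : (2 * C * (1 + N)) ^ (1 / (2 * ε)) ≤ κ := by
    rw [Real.mul_rpow (by positivity) (by positivity)]
    exact (mul_le_mul_of_nonneg_right (le_max_right _ _) (by positivity)).trans hκ
  have h3 : 2 * C * (1 + N) ≤ κ ^ (2 * ε) := by
    have h4 := Real.rpow_le_rpow (by positivity) h2 (by positivity : 0 ≤ 2 * ε)
    rwa [← Real.rpow_mul (by positivity), one_div_mul_cancel (by positivity), Real.rpow_one] at h4
  have h5 : 0 < κ ^ (2 * ε) := by positivity
  rw [Real.rpow_neg (by linarith), mul_right_comm, ← div_eq_mul_inv, div_le_iff₀ h5]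
  nlinarith

/-- The symmetric weights define the form and the operator; the weights −s, s+1 act between H^{s+1}
and H^s. Both satisfy the lower bound −s because s > −1/2. -/
lemma exists_lax_hsKernel (G : Geometry) {s : ℝ} (hs : -(1 / 2) < s) (hs0 : s < 0) :
    ∃ C : ℝ, 0 < C ∧ ∀ (q : 𝓢'(ℝ, ℂ)) (Q : ℝ → ℂ), MemH G s q → StronglyMeasurable Q →
      Q =ᵐ[freqMeasure G] distHat G q → ∀ κ : ℝ, 1 ≤ κ →
      HSKernel (halfMeasure G) (weightedKernel G κ (1 / 2) (1 / 2) Q)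
        (C * κ ^ (-(2 * epsOf s)) * sobolevNorm G s κ (distHat G q)) ∧
      HSKernel (halfMeasure G) (weightedKernel G κ (-s) (s + 1) Q)
        (C * κ ^ (-(2 * epsOf s)) * sobolevNorm G s κ (distHat G q)) := by
  obtain ⟨C, hC, h⟩ := exists_hsKernel_weightedKernel G hs hs0
  refine ⟨C, hC, fun q Q hq hQ hQq κ hκ => ?_⟩
  have h1 := (lintegral_weight_eq_sobolevNorm hκ hq.2 hQq).le
  exact ⟨h κ hκ _ _ (by linarith) (by linarith) (by norm_num) Q hQ _ (sobolevNorm_nonneg _ _ _ _) h1,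
    h κ hκ _ _ le_rfl (by linarith) (by ring) Q hQ _ (sobolevNorm_nonneg _ _ _ _) h1⟩

lemma sobolevNorm_le_one_of_nonpos {G : Geometry} {σ κ : ℝ} (hσ : σ ≤ 0) (hκ : 1 ≤ κ)
    {φ : ℝ → ℂ} (hφ : WeightedL2 G σ φ) : sobolevNorm G σ κ φ ≤ sobolevNorm G σ 1 φ :=
  sobolevNorm_le_sobolevNorm hφ.2 hκ fun ξ =>
    Real.rpow_le_rpow_of_nonpos (by positivity) (by linarith) (by linarith)

/-! ### The resolvent on Sobolev spaces of negative order. -/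

section Resolvent

variable {G : Geometry} {κ : ℝ} {hκ : 1 ≤ κ}
  {S : Lp ℂ 2 (halfMeasure G) →L[ℂ] Lp ℂ 2 (halfMeasure G)}
  {hS : IsSelfAdjoint S} {hn : ∀ y, ‖S y‖ ≤ 1 / 2 * ‖y‖}

/-- The constant 2 bounds J⁻¹. Passing from κ-norms to norms with parameter 1 costs nothing, since κ
≥ 1 enlarges the positive-order norm and shrinks the negative-order one. -/
lemma exists_resolvent_half {f : 𝓢'(ℝ, ℂ)} (hf : MemHPlus G (-(1 / 2)) f) :
    ∃ u, IsResolventOf ((weightFactors hκ S hS hn).op κ) κ f u ∧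
      (∀ u', IsResolventOf ((weightFactors hκ S hS hn).op κ) κ f u' → u' = u) ∧
      sobolevNorm G (1 / 2) 1 (hardyHat u) ≤ 2 * sobolevNorm G (-(1 / 2)) 1 (distHat G f) := by
  obtain ⟨b, hb⟩ := (weightedL2_iff hκ hf.1.2.1 hf.2).1 hf.1.2
  set D := weightFactors hκ S hS hn with hD
  set y := D.invJ ((hardyIso G).symm b) with hy
  refine ⟨D.B y, (isResolventOf_shift_iff hb).2 rfl,
    fun u' hu' => (isResolventOf_shift_iff hb).1 hu', ?_⟩
  have hmem : D.B y ∈ HPlus G (1 / 2) :=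
    (mem_HPlus_half_iff (hκ := hκ) (hS := hS) (hn := hn) _).2 ⟨y, rfl⟩
  calc sobolevNorm G (1 / 2) 1 (hardyHat (D.B y))
      ≤ sobolevNorm G (1 / 2) κ (hardyHat (D.B y)) :=
        sobolevNorm_le_sobolevNorm
          ((integrable_weight_iff hκ (aestronglyMeasurable_hardyHat _)).2 hmem.2) le_rfl fun ξ =>
          Real.rpow_le_rpow (by positivity) (by linarith) (by norm_num)
    _ = ‖y‖ := by
        rw [sobolevNorm_eq hκ (hardyHat_eq_zero _) (mul_hardyHat_B y), LinearIsometryEquiv.norm_map]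
    _ ≤ 2 * ‖b‖ := by
        rw [← (hardyIso G).symm.norm_map b]
        exact D.norm_invJ_le _
    _ = 2 * sobolevNorm G (-(1 / 2)) κ (distHat G f) := by rw [sobolevNorm_eq hκ hf.2 hb]
    _ ≤ _ := by
        gcongr
        exact sobolevNorm_le_one_of_nonpos neg_half_nonpos hκ hf.1.2

lemma exists_resolvent_form {s : ℝ} (hs : -(1 / 2) < s) {f : 𝓢'(ℝ, ℂ)} (hf : MemHPlus G s f) :
    ∃ F : ℂ → ℂ,
      MeromorphicOn F {z | -z ∉ essSpec ((weightFactors hκ S hS hn).op κ)} ∧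
      AnalyticOnNhd ℂ F {z | -z ∈ resolventSet ((weightFactors hκ S hS hn).op κ)} ∧
      ∀ z : ℂ, -z ∈ resolventSet ((weightFactors hκ S hS hn).op κ) →
        ∃ u, IsResolventOf ((weightFactors hκ S hS hn).op κ) z f u ∧
          (∀ u', IsResolventOf ((weightFactors hκ S hS hn).op κ) z f u' → u' = u) ∧
          F z = pairing G (distHat G f) (hardyHat u) := by
  obtain ⟨b, hb⟩ := (weightedL2_iff hκ hf.1.2.1 hf.2).1 hf.1.2
  have hb' := exists_weighted_half hs hκ hb
  set b' := weightOp G hκ (by linarith : -(1 / 2) - s ≤ 0) b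
  obtain ⟨F, hF, hF', hF''⟩ :=
    (weightFactors hκ S hS hn).exists_meromorphic κ ((hardyIso G).symm b')
  refine ⟨F, hF, hF', fun z hz => ?_⟩
  obtain ⟨y, h1, h2, h3⟩ := hF'' z hz
  refine ⟨(weightFactors hκ S hS hn).B y,
    ⟨(mem_HPlus_half_iff (hκ := hκ) (hS := hS) (hn := hn) _).2 ⟨y, rfl⟩,
      (shiftedApplyEq_iff hb').2 h1⟩,
    fun u' hu' => h2 u' ((shiftedApplyEq_iff hb').1 hu'.2), ?_⟩
  rw [h3, pairing_B' hb']

end Resolvent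

end BenjaminOno

end

/-! ### Assembly of the proposition. -/

open BenjaminOno in
theorem proposition3p2 (G : Geometry) (s : ℝ) (hs : -(1 / 2) < s) (hs0 : s < 0) :
    ∃ Cs : ℝ, 1 ≤ Cs ∧ ∃ K : ℝ, 0 < K ∧
      ∀ q : 𝓢'(ℝ, ℂ), MemH G s q → IsRealValued q →
        -- the quadratic form is well defined on the form domain
        (∀ f ∈ HPlus G (1 / 2),
          Integrable (fun ξ => ξ * ‖hardyHat f ξ‖ ^ 2) (freqMeasure G) ∧
          Integrable (fun ξ => distHat G q (-ξ) * sqHat f ξ) (freqMeasure G)) ∧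
        -- existence and uniqueness of the operator
        ∃ L : L2Plus G →ₗ.[ℂ] L2Plus G,
          (IsSelfAdjoint L ∧ IsSemibounded L ∧
            HasQuadraticForm L (HPlus G (1 / 2)) (laxForm G q)) ∧
          (∀ L' : L2Plus G →ₗ.[ℂ] L2Plus G,
            IsSelfAdjoint L' → IsSemibounded L' →
            HasQuadraticForm L' (HPlus G (1 / 2)) (laxForm G q) → L' = L) ∧
          -- the mapping property of the operator
          (∀ f ∈ HPlus G (s + 1), ∃ T : 𝓢'(ℝ, ℂ), MemHPlus G s T ∧ ShiftedApplyEq L 0 f T ∧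
            sobolevNorm G s 1 (distHat G T) ≤
              K * (1 + sobolevNorm G s 1 (distHat G q)) * sobolevNorm G (s + 1) 1 (hardyHat f)) ∧
          -- the resolvent for large κ
          (∀ κ : ℝ,
            Cs * (1 + sobolevNorm G s κ (distHat G q)) ^ (1 / (2 * epsOf s)) ≤ κ →
            (-κ : ℂ) ∈ resolventSet L ∧
            (∃ B : ℝ, ∀ f : 𝓢'(ℝ, ℂ), MemHPlus G (-(1 / 2)) f →
              ∃ u, IsResolventOf L κ f u ∧ (∀ u', IsResolventOf L κ f u' → u' = u) ∧
                sobolevNorm G (1 / 2) 1 (hardyHat u) ≤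
                  B * sobolevNorm G (-(1 / 2)) 1 (distHat G f)) ∧
            ∀ f : 𝓢'(ℝ, ℂ), MemHPlus G s f →
              ∃ u u₀, IsResolventOf L κ f u ∧ IsResolventOf (freeOp G) κ f u₀ ∧
                u ∈ HPlus G (s + 1) ∧ u₀ ∈ HPlus G (s + 1) ∧
                sobolevNorm G (s + 1) κ (hardyHat u) ≤ K * sobolevNorm G s κ (distHat G f) ∧
                sobolevNorm G (s + 1) κ (hardyHat (u - u₀)) ≤
                  K * κ ^ (-(2 * epsOf s)) * sobolevNorm G s κ (distHat G q) *
                    sobolevNorm G s κ (distHat G f)) ∧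
          -- the essential spectrum
          essSpec L = essSpec (freeOp G) ∧
          -- meromorphy of the quadratic form of the resolvent off the essential spectrum
          (∀ f : 𝓢'(ℝ, ℂ), MemHPlus G s f → ∃ F : ℂ → ℂ,
            MeromorphicOn F {z | -z ∉ essSpec L} ∧
            AnalyticOnNhd ℂ F {z | -z ∈ resolventSet L} ∧
            ∀ z : ℂ, -z ∈ resolventSet L →
              ∃ u, IsResolventOf L z f u ∧ (∀ u', IsResolventOf L z f u' → u' = u) ∧
                F z = pairing G (distHat G f) (hardyHat u)) := by
  obtain ⟨C, hC, hker⟩ := exists_lax_hsKernel G hs hs0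
  have hε := epsOf_pos hs hs0
  obtain ⟨Cs, hCs, hthr⟩ := exists_threshold hC hε
  -- One K for all bounds: 2 is needed for the resolvent, 2C for the difference of resolvents, and 2
  -- + C‖q‖ is at most K(1 + ‖q‖) for the operator itself.
  refine ⟨Cs, hCs, 2 + 2 * C, by positivity, fun q hq hqr => ?_⟩
  obtain ⟨Q, hQm, hQ, hQq⟩ := exists_hermitian_representative hq.1 hqr
  have hN : ∀ κ, 0 ≤ sobolevNorm G s κ (distHat G q) := fun κ => sobolevNorm_nonneg _ _ _ _
  -- A reference κ₀ at which 𝓛 is built. The threshold is evaluated with the H^s norm of parameter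
  -- 1, which dominates the one of parameter κ₀ because s < 0.
  obtain ⟨κ₀, hκ₀, hsmall₀⟩ : ∃ κ₀ : ℝ, 1 ≤ κ₀ ∧
      C * κ₀ ^ (-(2 * epsOf s)) * sobolevNorm G s κ₀ (distHat G q) ≤ 1 / 2 := by
    obtain ⟨h1, h2⟩ := hthr _ _ (hN 1) le_rfl
    refine ⟨_, h1, le_trans ?_ h2⟩
    gcongr
    exact sobolevNorm_le_one_of_nonpos hs0.le h1 hq.2
  have hk₀ := (hker q Q hq hQm hQq κ₀ hκ₀).1
  set D := laxFactors hκ₀ hQ hk₀ hsmall₀ with hD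
  have hform : HasQuadraticForm (D.op κ₀) (HPlus G (1 / 2)) (laxForm G q) :=
    hasQuadraticForm_lax hκ₀ hQ hk₀ hsmall₀ hQq
  refine ⟨fun f hf => ⟨integrable_freeForm hf, ?_⟩, D.op κ₀,
    ⟨D.isSelfAdjoint_op κ₀, D.isSemibounded_op κ₀, hform⟩,
    fun L' hL' _ hL'form => hform.unique (D.isSelfAdjoint_op κ₀) hL' hL'form, fun f hf => ?_,
    fun κ hκ => ?_, essSpec_lax hκ₀ hQ hk₀ hsmall₀, fun f hf => exists_resolvent_form hs hf⟩
  · obtain ⟨y, rfl⟩ : ∃ y, f = D.B y := (mem_HPlus_half_iff f).1 hf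
    exact (integrable_potentialForm_B hκ₀ hQ hk₀ hsmall₀ hQq y).1
  · obtain ⟨T, hT, hTf, hTn⟩ := exists_lax_apply hκ₀ hQ hk₀ hsmall₀ hs
      (hker q Q hq hQm hQq 1 le_rfl).2 hf
    refine ⟨T, hT, hTf, hTn.trans (mul_le_mul_of_nonneg_right ?_ (sobolevNorm_nonneg _ _ _ _))⟩
    rw [Real.one_rpow]
    nlinarith [hN 1]
  · obtain ⟨hκ1, hsmall⟩ := hthr _ _ (hN κ) hκ
    obtain ⟨hk, hA⟩ := hker q Q hq hQm hQq κ hκ1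
    -- The construction at κ has the same quadratic form as the one at κ₀, so it is the same
    -- operator, and the resolvent bounds may be proved with the factors at κ.
    have hop : (laxFactors hκ1 hQ hk hsmall).op κ = D.op κ₀ :=
      hform.unique (D.isSelfAdjoint_op κ₀) (FormFactors.isSelfAdjoint_op _ κ)
        (hasQuadraticForm_lax hκ1 hQ hk hsmall hQq)
    rw [← hop]
    refine ⟨neg_mem_resolventSet, ⟨2, fun f hf => exists_resolvent_half hf⟩, fun f hf => ?_⟩
    obtain ⟨u, u₀, h1, h2, h3, h4, h5, h6⟩ :=
      exists_resolvent_bound hκ1 hQ hk hsmall hs hA hsmall hf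
    have hf0 := sobolevNorm_nonneg G s κ (distHat G f)
    refine ⟨u, u₀, h1, h2, h3, h4, h5.trans ?_, h6.trans ?_⟩
    · gcongr
      linarith
    · refine mul_le_mul_of_nonneg_right ?_ hf0
      have : 0 ≤ κ ^ (-(2 * epsOf s)) * sobolevNorm G s κ (distHat G q) :=
        mul_nonneg (by positivity) (hN κ)
      nlinarith
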